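/- Let $\mathrm{SU}(2)$ carry its normalised Haar measure $\mathrm{d}\mu$ and the left-invariant vector fields $Z_1,Z_2,Z_3$ generated by $-\tfrac{i}{2}\sigma_k$ ($\sigma_k$ the Pauli matrices), so that $[Z_i,Z_j]=\epsilon_{ijk}Z_k$; put $X_\pm=-(Z_2\pm iZ_1)$ and $Z^\alpha=Z_1^{\alpha_1}Z_2^{\alpha_2}Z_3^{\alpha_3}$ for $\alpha\in\mathbb{N}^3$. For $0<\varepsilon<2$ and $\rho_\star>0$ consider, in coordinates $(\tau,\rho,g)\in\mathbb{R}\times\mathbb{R}\times\mathrm{SU}(2)$, the lower domain, the portion of past null infinity and the short incoming null hypersurface \[ \underline{\mathcal N}_\varepsilon=\Big\{-1\le\tau\le-1+\varepsilon,\ 0\le\rho\le\tfrac{2\rho_\star}{1-\tau}\Big\},\quad \mathscr I^-_{\rho_\star}=\{\tau=-1,\ 0\le\rho\le\rho_\star\},\quad \underline{\mathcal B}_\varepsilon=\Big\{-1\le\tau\le-1+\varepsilon,\ \rho=\tfrac{2\rho_\star}{1-\tau}\Big\}. \] Let $\mathrm{dv}=\mathrm{d}\tau\,\mathrm{d}\rho\,\mathrm{d}\mu$,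 and let $\mathrm{d}\underline{\mathcal B}=\frac{\sqrt2\,\rho}{1-\tau}\,\mathrm{d}\tau\,\mathrm{d}\mu$ be the measure induced on $\underline{\mathcal B}_\varepsilon$ by contracting $\mathrm{dv}$ with $\frac1{\sqrt2}\big((1+\tau)\partial_\tau-\rho\,\partial_\rho\big)$. Write $D'=\partial_\rho^{p'}\partial_\tau^{q'}Z^\alpha$, let $\sum_\mho$ denote the sum over all $(q',p',\alpha)\in\mathbb{N}\times\mathbb{N}\times\mathbb{N}^3$ with $q'+p'+|\alpha|\le m$, and set $\|f\|^2_{H^m(\underline{\mathcal N}_\varepsilon)}=\sum_\mho\int_{\underline{\mathcal N}_\varepsilon}|D'f|^2\,\mathrm{dv}$. Let $m,p,q\in\mathbb{N}$ (zero allowed) with $m+p<q$. Then there is a constant $C>0$, depending only on $m$, $p$ and $q$ (in particular independent of $\varepsilon$ and $\rho_\star$), such that the following holds for all $0<\varepsilon<2$, $\rho_\star>0$ and $\Omega_\star>0$. Let $\psi,\psi_0,\psi_1,\psi_2$ be complex-valued functions of class $C^{m+p+q+1}$ on $\underline{\mathcal N}_\varepsilon$, up to its boundary, which satisfy there the transport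 system \begin{align*} (1+\tau)\partial_\tau\psi_2-\rho\,\partial_\rho\psi_2-\tfrac12X_-\psi-X_-\psi_1&=0,\\ (1-\tau)\partial_\tau\psi_1+\rho\,\partial_\rho\psi_1+\tfrac12\big((1-\tau)\partial_\tau\psi+\rho\,\partial_\rho\psi\big)-X_+\psi_2-\tfrac12\psi-\psi_1&=0,\\ (1+\tau)\partial_\tau\psi_1-\rho\,\partial_\rho\psi_1-\tfrac12\big((1+\tau)\partial_\tau\psi-\rho\,\partial_\rho\psi\big)-X_-\psi_0-\tfrac12\psi+\psi_1&=0,\\ (1-\tau)\partial_\tau\psi_0+\rho\,\partial_\rho\psi_0+\tfrac12X_+\psi-X_+\psi_1&=0. \end{align*} Suppose that for each $f\in\{\psi,\psi_0,\psi_1,\psi_2\}$ the characteristic data satisfy \[ \sum_\mho\int_{\mathscr I^-_{\rho_\star}}|D'(\partial_\tau^q\partial_\rho^pf)|^2\,\mathrm{d}\rho\,\mathrm{d}\mu+\sum_\mho\int_{\underline{\mathcal B}_\varepsilon}|D'(\partial_\tau^q\partial_\rho^pf)|^2\,\mathrm{d}\underline{\mathcal B}\le\Omega_\star , \] and that $\|\partial_\rho^p\partial_\tau^qg\|^2_{H^m(\underline{\mathcal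 N}_\varepsilon)}\le\Omega_\star$ for each $g\in\{\psi,\psi_0,\psi_1\}$. Then \[ \|\partial_\rho^p\partial_\tau^q\psi_2\|^2_{H^m(\underline{\mathcal N}_\varepsilon)}\le C\,\Omega_\star . \] -/

import Mathlib

open MeasureTheory Set

namespace LowerDomain

noncomputable section

/-! ### The group `SU(2)`, its Haar measure and its left-invariant frame -/

/-- The group `SU(2)`. -/
abbrev SU2 : Type := Matrix.specialUnitaryGroup (Fin 2) ℂ

instance instTopologicalGroupSU2 : IsTopologicalGroup SU2 where
  continuous_inv :=
    (continuous_star.comp continuous_subtype_val).subtype_mk _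

instance instCompactSpaceSU2 : CompactSpace SU2 := by
  have hK : IsCompact (Set.univ.pi fun _ : Fin 2 => Set.univ.pi fun _ : Fin 2 =>
      Metric.closedBall (0 : ℂ) 1) :=
    isCompact_univ_pi fun _ => isCompact_univ_pi fun _ => isCompact_closedBall 0 1
  have hclosed : IsClosed {A : Matrix (Fin 2) (Fin 2) ℂ |
      (star A * A = 1 ∧ A * star A = 1) ∧ A.det = 1} := by
    refine IsClosed.and (IsClosed.and ?_ ?_) ?_
    · exact isClosed_eq (continuous_star.mul continuous_id) continuous_const
    · exact isClosed_eq (continuous_id.mul continuous_star) continuous_const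
    · exact isClosed_eq continuous_id.matrix_det continuous_const
  refine isCompact_iff_compactSpace.mp (hK.of_isClosed_subset hclosed ?_)
  intro A hA i _ j _
  have hU : A ∈ Matrix.unitaryGroup (Fin 2) ℂ := hA.1
  simpa using entry_norm_bound_of_unitary hU i j

instance instMeasurableSpaceSU2 : MeasurableSpace SU2 := borel SU2

instance instBorelSpaceSU2 : BorelSpace SU2 := ⟨rfl⟩

/-- The normalised Haar measure `dμ` on `SU(2)`. -/
def haarSU2 : Measure SU2 := Measure.haarMeasure ⊤

/-- The matrices `-i σₖ`, where `σ₁, σ₂, σ₃` (indices `0, 1, 2`) are the Pauli matrices. -/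
def pauliJ : Fin 3 → Matrix (Fin 2) (Fin 2) ℂ :=
  ![!![0, -Complex.I; -Complex.I, 0], !![0, -1; 1, 0], !![-Complex.I, 0; 0, Complex.I]]

/-- The basis `ξₖ = -(i/2) σₖ` of the Lie algebra `su(2)`. -/
def su2Basis (k : Fin 3) : Matrix (Fin 2) (Fin 2) ℂ := (1 / 2 : ℝ) • pauliJ k

/-- The normalisation of the basis: `[ξ₁, ξ₂] = ξ₃` and cyclic permutations. -/
theorem su2Basis_commutator (k : Fin 3) :
    su2Basis k * su2Basis (k + 1) - su2Basis (k + 1) * su2Basis k = su2Basis (k + 2) := by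
  fin_cases k <;> ext i j <;> fin_cases i <;> fin_cases j <;>
    simp [su2Basis, pauliJ] <;> ring_nf <;>
    simp [Complex.I_sq] <;> norm_num

theorem pauliJ_sq (k : Fin 3) : pauliJ k * pauliJ k = -1 := by
  fin_cases k <;> ext i j <;> fin_cases i <;> fin_cases j <;>
    simp [pauliJ, Matrix.mul_apply, Fin.sum_univ_two]

theorem exp_su2Basis (k : Fin 3) (t : ℝ) :
    NormedSpace.exp (t • su2Basis k)
      = algebraMap ℝ (Matrix (Fin 2) (Fin 2) ℂ) (Real.cos (t / 2))
        + Real.sin (t / 2) • pauliJ k := by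
  let L := Complex.liftAux (pauliJ k) (pauliJ_sq k)
  have hL : Continuous L := by
    have h : (fun z : ℂ => L z) = fun z : ℂ =>
        algebraMap ℝ (Matrix (Fin 2) (Fin 2) ℂ) z.re + z.im • pauliJ k := by
      funext z
      exact Complex.liftAux_apply _ _ z
    change Continuous (fun z : ℂ => L z)
    rw [h]
    refine Continuous.add ?_ ?_
    · exact (continuous_algebraMap ℝ (Matrix (Fin 2) (Fin 2) ℂ)).comp Complex.continuous_re
    · exact Complex.continuous_im.smul continuous_const
  have h1 : L (((t / 2 : ℝ) : ℂ) * Complex.I) = t • su2Basis k := by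
    change Complex.liftAux _ _ _ = _
    rw [Complex.liftAux_apply]
    simp [su2Basis, smul_smul, div_eq_mul_inv]
  have h2 : L (NormedSpace.exp (((t / 2 : ℝ) : ℂ) * Complex.I))
      = NormedSpace.exp (L (((t / 2 : ℝ) : ℂ) * Complex.I)) := by
    let _ : NormedRing (Matrix (Fin 2) (Fin 2) ℂ) := Matrix.linftyOpNormedRing
    let _ : NormedAlgebra ℂ (Matrix (Fin 2) (Fin 2) ℂ) := Matrix.linftyOpNormedAlgebra
    exact NormedSpace.map_exp L hL _
  rw [← h1, ← h2, ← Complex.exp_eq_exp_ℂ]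
  change Complex.liftAux _ _ _ = _
  rw [Complex.liftAux_apply, Complex.exp_ofReal_mul_I_re, Complex.exp_ofReal_mul_I_im]

theorem exp_su2Basis_mem (k : Fin 3) (t : ℝ) :
    NormedSpace.exp (t • su2Basis k) ∈ Matrix.specialUnitaryGroup (Fin 2) ℂ := by
  have h : (Real.cos (t / 2) : ℂ) ^ 2 + (Real.sin (t / 2) : ℂ) ^ 2 = 1 := by
    exact_mod_cast Real.cos_sq_add_sin_sq (t / 2)
  rw [exp_su2Basis, Matrix.mem_specialUnitaryGroup_iff, Matrix.mem_unitaryGroup_iff]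
  set c := Real.cos (t / 2)
  set s := Real.sin (t / 2)
  have hI : Complex.I ^ 2 = -1 := Complex.I_sq
  constructor
  · fin_cases k <;> ext i j <;> fin_cases i <;> fin_cases j <;>
      simp [pauliJ, Matrix.mul_apply, Fin.sum_univ_two, Matrix.algebraMap_eq_diagonal,
        Matrix.star_eq_conjTranspose] <;>
      first
        | ring1
        | linear_combination h
        | linear_combination h - (s : ℂ) ^ 2 * hI
  · fin_cases k <;> simp [pauliJ, Matrix.det_fin_two, Matrix.algebraMap_eq_diagonal] <;>
      first
        | linear_combination h
        | linear_combination h - (s : ℂ) ^ 2 * hI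

/-- The one-parameter subgroup `t ↦ exp (t ξₖ)` of `SU(2)`. -/
def oneParam (k : Fin 3) (t : ℝ) : SU2 :=
  ⟨NormedSpace.exp (t • su2Basis k), exp_su2Basis_mem k t⟩

/-- The matrix with rows `(a, -b̄)` and `(b, ā)`, divided by `(|a|² + |b|²)^{1/2}`. -/
def normalizedMatrix (v : ℂ × ℂ) : Matrix (Fin 2) (Fin 2) ℂ :=
  (Real.sqrt (Complex.normSq v.1 + Complex.normSq v.2))⁻¹ •
    !![v.1, -(starRingEnd ℂ v.2); v.2, starRingEnd ℂ v.1]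

theorem normalizedMatrix_mem {v : ℂ × ℂ} (hv : v ≠ 0) :
    normalizedMatrix v ∈ Matrix.specialUnitaryGroup (Fin 2) ℂ := by
  obtain ⟨a, b⟩ := v
  have hpos : 0 < Complex.normSq a + Complex.normSq b := by
    by_cases ha : a = 0
    · have hb : b ≠ 0 := fun hb => hv (by rw [ha, hb]; rfl)
      exact add_pos_of_nonneg_of_pos (Complex.normSq_nonneg a) (Complex.normSq_pos.mpr hb)
    · exact add_pos_of_pos_of_nonneg (Complex.normSq_pos.mpr ha) (Complex.normSq_nonneg b)
  set n : ℝ := (Real.sqrt (Complex.normSq a + Complex.normSq b))⁻¹ with hn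
  have h1 : n ^ 2 * (Complex.normSq a + Complex.normSq b) = 1 := by
    rw [hn, inv_pow, Real.sq_sqrt hpos.le, inv_mul_cancel₀ hpos.ne']
  have h2 : (n : ℂ) ^ 2 * (a * starRingEnd ℂ a + b * starRingEnd ℂ b) = 1 := by
    rw [Complex.mul_conj, Complex.mul_conj]
    exact_mod_cast h1
  rw [Matrix.mem_specialUnitaryGroup_iff, Matrix.mem_unitaryGroup_iff]
  change normalizedMatrix (a, b) * star (normalizedMatrix (a, b)) = 1 ∧
    (normalizedMatrix (a, b)).det = 1
  constructor
  · ext i j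
    fin_cases i <;> fin_cases j <;>
      simp [normalizedMatrix, ← hn, Matrix.mul_apply, Fin.sum_univ_two,
        Matrix.star_eq_conjTranspose] <;>
      first
        | linear_combination h2
        | ring1
  · simp [normalizedMatrix, ← hn, Matrix.det_fin_two]
    linear_combination h2

open Classical in
/-- The radial projection `ℂ² ∖ {0} → S³ ≅ SU(2)`, sending `v = (a, b)` to the element of `SU(2)`
whose first column is `v / |v|` (and the irrelevant point `v = 0` to the identity). -/
def radialSU2 (v : ℂ × ℂ) : SU2 :=
  if hv : v ≠ 0 then ⟨normalizedMatrix v, normalizedMatrix_mem hv⟩ else 1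

/-! ### Fields on `ℝ_τ × ℝ_ρ × SU(2)` and their derivatives -/

/-- Complex functions of `(τ, ρ)` and of a point of `SU(2)`. -/
abbrev Field : Type := ℝ × ℝ → SU2 → ℂ

/-- `f` is of class `C^n` on `K × SU(2)`, up to the boundary of the region `K` of the
`(τ, ρ)`-plane. Since `radialSU2` is a smooth submersion of `ℂ² ∖ {0}` onto `SU(2)` which admits a
smooth section, a function on `SU(2)` is `C^n` if and only if its composition with `radialSU2` is
`C^n` on `ℂ² ∖ {0}`. -/
def IsCk (n : ℕ) (K : Set (ℝ × ℝ)) (f : Field) : Prop :=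
  ContDiffOn ℝ n (fun w : (ℝ × ℝ) × (ℂ × ℂ) => f w.1 (radialSU2 w.2)) (K ×ˢ {0}ᶜ)

/-- `∂_τ f` on `K` (one-sided at the boundary of `K`). -/
def dTau (K : Set (ℝ × ℝ)) (f : Field) : Field :=
  fun z g => fderivWithin ℝ (fun w => f w g) K z (1, 0)

/-- `∂_ρ f` on `K` (one-sided at the boundary of `K`). -/
def dRho (K : Set (ℝ × ℝ)) (f : Field) : Field :=
  fun z g => fderivWithin ℝ (fun w => f w g) K z (0, 1)

/-- The left-invariant vector field `Zₖ` on `SU(2)` generated by `ξₖ = -(i/2) σₖ`; these satisfy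
`[Z₁, Z₂] = Z₃` and cyclic permutations. -/
def Z (k : Fin 3) (f : Field) : Field :=
  fun z g => deriv (fun t : ℝ => f z (g * oneParam k t)) 0

/-- `X₊ = -(Z₂ + i Z₁)`. -/
def Xplus (f : Field) : Field := fun z g => -(Z 1 f z g + Complex.I * Z 0 f z g)

/-- `X₋ = -(Z₂ - i Z₁)`. -/
def Xminus (f : Field) : Field := fun z g => -(Z 1 f z g - Complex.I * Z 0 f z g)

/-- `Z^α = Z₁^{α₁} Z₂^{α₂} Z₃^{α₃}`. -/
def Zpow (α : Fin 3 → ℕ) (f : Field) : Field :=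
  (Z 0)^[α 0] ((Z 1)^[α 1] ((Z 2)^[α 2] f))

/-- The operator `D' = ∂_ρ^{p'} ∂_τ^{q'} Z^α`. -/
def D (K : Set (ℝ × ℝ)) (p' q' : ℕ) (α : Fin 3 → ℕ) (f : Field) : Field :=
  (dRho K)^[p'] ((dTau K)^[q'] (Zpow α f))

/-- The finite set of all `(q', p', α) ∈ ℕ × ℕ × ℕ³` with `q' + p' + |α| ≤ m`. -/
def mho (m : ℕ) : Finset (ℕ × ℕ × (Fin 3 → ℕ)) :=
  (Finset.range (m + 1) ×ˢ Finset.range (m + 1) ×ˢ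
    Fintype.piFinset fun _ : Fin 3 => Finset.range (m + 1)).filter
      fun x => x.1 + x.2.1 + ∑ i, x.2.2 i ≤ m

theorem mem_mho {m : ℕ} {x : ℕ × ℕ × (Fin 3 → ℕ)} :
    x ∈ mho m ↔ x.1 + x.2.1 + ∑ i, x.2.2 i ≤ m := by
  simp only [mho, Finset.mem_filter, Finset.mem_product, Finset.mem_range, Fintype.mem_piFinset,
    and_iff_right_iff_imp]
  intro h
  refine ⟨by omega, by omega, fun i => ?_⟩
  have hi := Finset.single_le_sum (f := x.2.2) (fun _ _ => Nat.zero_le _) (Finset.mem_univ i)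
  omega

/-! ### The lower domain and the norms -/

/-- The `ρ`-coordinate `2 ρ⋆ / (1 - τ)` of the incoming null hypersurface at time `τ`. -/
def edge (ρs τ : ℝ) : ℝ := 2 * ρs / (1 - τ)

/-- The `(τ, ρ)`-region of the lower domain:
`-1 ≤ τ ≤ -1 + ε` and `0 ≤ ρ ≤ 2 ρ⋆ / (1 - τ)`. -/
def region (ε ρs : ℝ) : Set (ℝ × ℝ) :=
  {z | -1 ≤ z.1 ∧ z.1 ≤ -1 + ε ∧ 0 ≤ z.2 ∧ z.2 ≤ edge ρs z.1}

/-- The density with respect to `dτ dμ` of the measure `e₁₁' ⌟ (dτ ∧ dρ ∧ dμ)` induced on the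
incoming null hypersurface `ρ = 2 ρ⋆ / (1 - τ)`, where
`e₁₁' = ((1 + τ) ∂_τ - ρ ∂_ρ) / √2`. -/
def edgeDensity (ρs τ : ℝ) : ℝ := Real.sqrt 2 * edge ρs τ / (1 - τ)

/-- Contracting gives `((1 + τ) dρ ∧ dμ + ρ dτ ∧ dμ) / √2`, whose pull-back to the hypersurface
has the density above. -/
theorem edgeDensity_eq (ρs : ℝ) {τ : ℝ} (hτ : τ < 1) :
    edgeDensity ρs τ = ((1 + τ) * deriv (edge ρs) τ + edge ρs τ) / Real.sqrt 2 := by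
  have h1 : 1 - τ ≠ 0 := by linarith
  have hd : HasDerivAt (edge ρs) (2 * ρs / (1 - τ) ^ 2) τ := by
    have h := ((hasDerivAt_id τ).const_sub 1).fun_inv h1
    have h' := h.const_mul (2 * ρs)
    have e1 : edge ρs = fun y => 2 * ρs * (1 - id y)⁻¹ := by
      funext y
      simp only [edge, id, div_eq_mul_inv]
    have e2 : 2 * ρs / (1 - τ) ^ 2 = 2 * ρs * (- -1 / (1 - id τ) ^ 2) := by
      simp only [id]
      ring
    rw [e1, e2]
    exact h'
  have h2 : Real.sqrt 2 * Real.sqrt 2 = 2 := Real.mul_self_sqrt (by norm_num)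
  have h3 : Real.sqrt 2 ≠ 0 := by positivity
  rw [hd.deriv, edgeDensity, edge, eq_div_iff h3]
  field_simp
  linear_combination (ρs) * h2

/-- `‖f‖²_{H^m}` of the lower domain: the sum over `(q', p', α)` with `q' + p' + |α| ≤ m` of the
integrals of `|D' f|²` against `dτ dρ dμ`. -/
def sobolevSq (ε ρs : ℝ) (m : ℕ) (f : Field) : ENNReal :=
  ∑ x ∈ mho m, ∫⁻ z in region ε ρs, ∫⁻ g, ‖D (region ε ρs) x.2.1 x.1 x.2.2 f z g‖ₑ ^ 2 ∂haarSU2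

/-- The sum over `(q', p', α)` with `q' + p' + |α| ≤ m` of the integrals of `|D' f|²` over the
portion `0 ≤ ρ ≤ ρ⋆` of past null infinity `τ = -1`, against `dρ dμ`. -/
def scriDataSq (ε ρs : ℝ) (m : ℕ) (f : Field) : ENNReal :=
  ∑ x ∈ mho m, ∫⁻ ρ in Icc 0 ρs, ∫⁻ g,
    ‖D (region ε ρs) x.2.1 x.1 x.2.2 f (-1, ρ) g‖ₑ ^ 2 ∂haarSU2

/-- The sum over `(q', p', α)` with `q' + p' + |α| ≤ m` of the integrals of `|D' f|²` over the
incoming null hypersurface `ρ = 2 ρ⋆ / (1 - τ)`, `-1 ≤ τ ≤ -1 + ε`, against its induced measure. -/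
def edgeDataSq (ε ρs : ℝ) (m : ℕ) (f : Field) : ENNReal :=
  ∑ x ∈ mho m, ∫⁻ τ in Icc (-1) (-1 + ε), ENNReal.ofReal (edgeDensity ρs τ) *
    ∫⁻ g, ‖D (region ε ρs) x.2.1 x.1 x.2.2 f (τ, edge ρs τ) g‖ₑ ^ 2 ∂haarSU2

/-- The first-order transport system for `ψ, ψ₀, ψ₁, ψ₂` at all points of `K × SU(2)`. -/
structure SolvesTransport (K : Set (ℝ × ℝ)) (ψ ψ₀ ψ₁ ψ₂ : Field) : Prop where
  A₀ : ∀ τ ρ : ℝ, (τ, ρ) ∈ K → ∀ g : SU2,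
    (1 + τ) * dTau K ψ₂ (τ, ρ) g - ρ * dRho K ψ₂ (τ, ρ) g
      - 1 / 2 * Xminus ψ (τ, ρ) g - Xminus ψ₁ (τ, ρ) g = 0
  B₀ : ∀ τ ρ : ℝ, (τ, ρ) ∈ K → ∀ g : SU2,
    (1 - τ) * dTau K ψ₁ (τ, ρ) g + ρ * dRho K ψ₁ (τ, ρ) g
      + 1 / 2 * ((1 - τ) * dTau K ψ (τ, ρ) g + ρ * dRho K ψ (τ, ρ) g)
      - Xplus ψ₂ (τ, ρ) g - 1 / 2 * ψ (τ, ρ) g - ψ₁ (τ, ρ) g = 0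
  A₁ : ∀ τ ρ : ℝ, (τ, ρ) ∈ K → ∀ g : SU2,
    (1 + τ) * dTau K ψ₁ (τ, ρ) g - ρ * dRho K ψ₁ (τ, ρ) g
      - 1 / 2 * ((1 + τ) * dTau K ψ (τ, ρ) g - ρ * dRho K ψ (τ, ρ) g)
      - Xminus ψ₀ (τ, ρ) g - 1 / 2 * ψ (τ, ρ) g + ψ₁ (τ, ρ) g = 0
  B₁ : ∀ τ ρ : ℝ, (τ, ρ) ∈ K → ∀ g : SU2,
    (1 - τ) * dTau K ψ₀ (τ, ρ) g + ρ * dRho K ψ₀ (τ, ρ) g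
      + 1 / 2 * Xplus ψ (τ, ρ) g - Xplus ψ₁ (τ, ρ) g = 0

end

end LowerDomain

open LowerDomain

namespace LowerDomain

/-! ### The radial projection -/

/-! Put `W = ψ₁ + ψ/2`. The equations `A₀` and `B₀` then form a closed system for the pair `(ψ₂,
W)`: with `L = (1 + τ)∂_τ - ρ∂_ρ` and `N = (1 - τ)∂_τ + ρ∂_ρ` they read `L ψ₂ = X₋ W` and `N W - W =
X₊ ψ₂` (`transports_incoming`, `transports_outgoing`). Commuting either equation with `∂_τ` or `∂_ρ`
only shifts the zeroth order coefficient, so `u = Z^α ∂_ρ^P ∂_τ^Q ψ₂` and `w = Z^α ∂_ρ^P ∂_τ^Q W`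
satisfy `L u + a u = X₋ w + c` and `N w - (1 + a) w = X₊ u + d` with `a = Q - P`. Here `c` and `d`
are the commutators of `Z^α` with `X₋` and `X₊`.

For `P = p + p'` and `Q = q + q'` with `q' + p' + |α| ≤ m`, the condition `m + p < q` gives `a ≥ 1`.
This positive sign makes the estimate work: in the identity for `L|u|² + N|w|²` the bulk term
`-2a|u|²` bounds `u` with no Grönwall argument, while every term in `|w|²` is controlled by the
assumed norms of `ψ` and `ψ₁`.

Three facts close the argument. Since `X₊` is minus the formal adjoint of `X₋` on `SU(2)`, the cross
terms integrate to zero (`integral_xOp_adjoint`). The fields `L` and `N` are divergence free for `dτ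
dρ`, `L` is tangent to past null infinity, `N` is tangent to the incoming hypersurface, and both are
tangent to `ρ = 0`; the only fluxes with an unfavourable sign are therefore those of `|u|²` through
the incoming hypersurface and of `|w|²` through past null infinity, which are data
(`integral_incoming_ge`, `integral_outgoing_ge`). Finally `[Z^α, X]` is a constant coefficient
combination of ordered monomials `Z^β` with `|β| ≤ |α|`, a Poincaré–Birkhoff–Witt argument
(`exists_commutator_bound`), so `c` is bounded by the `w`-energy and `d` by the `u`-energy; the
latter is absorbed by giving it a small weight.

These constants are purely algebraic, so the bound is independent of `ε` and `ρ⋆`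
(`energy_inequality`). Differentiation on `SU(2)` is carried out on `ℂ² ∖ {0}`, where the
left-invariant fields lift to linear vector fields. -/

theorem su2_apply (g : SU2) :
    g.1 1 1 = starRingEnd ℂ (g.1 0 0) ∧ g.1 0 1 = -starRingEnd ℂ (g.1 1 0) ∧
      Complex.normSq (g.1 0 0) + Complex.normSq (g.1 1 0) = 1 := by
  obtain ⟨hU, hdet⟩ := Matrix.mem_specialUnitaryGroup_iff.mp g.2
  have h1 : star g.1 * g.1 = 1 := Matrix.mem_unitaryGroup_iff'.mp hU
  have h2 : star g.1 = g.1.adjugate := by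
    calc star g.1 = star g.1 * (g.1 * g.1.adjugate) := by
            rw [Matrix.mul_adjugate, hdet, one_smul, mul_one]
      _ = g.1.adjugate := by rw [← mul_assoc, h1, one_mul]
  have e00 := congrFun (congrFun h2 0) 0
  have e01 := congrFun (congrFun h2 0) 1
  simp only [Matrix.star_apply, Matrix.adjugate_fin_two, Matrix.of_apply, Matrix.cons_val',
    Matrix.cons_val_zero, Matrix.cons_val_one, RCLike.star_def, Matrix.cons_val_fin_one] at e00 e01
  have h01 : g.1 0 1 = -starRingEnd ℂ (g.1 1 0) := by rw [e01, neg_neg]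
  refine ⟨e00.symm, h01, ?_⟩
  rw [Matrix.det_fin_two, ← e00, h01] at hdet
  have : ((Complex.normSq (g.1 0 0) + Complex.normSq (g.1 1 0) : ℝ) : ℂ) = 1 := by
    push_cast
    rw [← Complex.mul_conj, ← Complex.mul_conj]
    linear_combination hdet
  exact_mod_cast this

/-- The first column of a matrix in `SU(2)`. -/
def firstCol (g : SU2) : ℂ × ℂ := (g.1 0 0, g.1 1 0)

theorem continuous_firstCol : Continuous firstCol :=
  (continuous_subtype_val.matrix_elem 0 0).prodMk (continuous_subtype_val.matrix_elem 1 0)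

theorem firstCol_ne_zero (g : SU2) : firstCol g ≠ 0 := by
  intro h
  have h0 : g.1 0 0 = 0 := congrArg Prod.fst h
  have h1 : g.1 1 0 = 0 := congrArg Prod.snd h
  have := (su2_apply g).2.2
  simp [h0, h1] at this

theorem radialSU2_firstCol (g : SU2) : radialSU2 (firstCol g) = g := by
  obtain ⟨h1, h2, h3⟩ := su2_apply g
  rw [radialSU2, dif_pos (firstCol_ne_zero g)]
  apply Subtype.ext
  change normalizedMatrix (g.1 0 0, g.1 1 0) = g.1
  simp only [normalizedMatrix, h3, Real.sqrt_one, inv_one, one_smul]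
  ext i j
  fin_cases i <;> fin_cases j <;> simp [h1, h2]

/-- The first column of the product of `!![v.1, -v̄.2; v.2, v̄.1]` with `P`. -/
noncomputable def colMul (P : Matrix (Fin 2) (Fin 2) ℂ) : (ℂ × ℂ) →L[ℝ] (ℂ × ℂ) :=
  LinearMap.toContinuousLinearMap
    { toFun := fun v => (v.1 * P 0 0 - starRingEnd ℂ v.2 * P 1 0,
        v.2 * P 0 0 + starRingEnd ℂ v.1 * P 1 0)
      map_add' := fun v w => by
        ext <;> simp <;> ring
      map_smul' := fun c v => by
        ext <;> simp <;> ring }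

theorem colMul_apply (P : Matrix (Fin 2) (Fin 2) ℂ) (v : ℂ × ℂ) :
    colMul P v = (v.1 * P 0 0 - starRingEnd ℂ v.2 * P 1 0,
        v.2 * P 0 0 + starRingEnd ℂ v.1 * P 1 0) := rfl

theorem normSq_colMul (P : Matrix (Fin 2) (Fin 2) ℂ) (v : ℂ × ℂ) :
    Complex.normSq (colMul P v).1 + Complex.normSq (colMul P v).2
      = (Complex.normSq v.1 + Complex.normSq v.2)
        * (Complex.normSq (P 0 0) + Complex.normSq (P 1 0)) := by
  simp only [colMul_apply, Complex.normSq_apply, Complex.add_re, Complex.add_im, Complex.sub_re,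
    Complex.sub_im, Complex.mul_re, Complex.mul_im, Complex.conj_re, Complex.conj_im]
  ring

theorem normSq_add_pos {v : ℂ × ℂ} (hv : v ≠ 0) :
    0 < Complex.normSq v.1 + Complex.normSq v.2 := by
  by_contra h
  have h1 := Complex.normSq_nonneg v.1
  have h2 := Complex.normSq_nonneg v.2
  apply hv
  ext1
  · exact Complex.normSq_eq_zero.mp (by linarith)
  · exact Complex.normSq_eq_zero.mp (by linarith)

theorem colMul_ne_zero (e : SU2) {v : ℂ × ℂ} (hv : v ≠ 0) : colMul e.1 v ≠ 0 := by
  intro h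
  have h1 := normSq_colMul e.1 v
  rw [h, (su2_apply e).2.2] at h1
  have := normSq_add_pos hv
  simp at h1
  linarith

/-- The matrix built from `v` is a positive multiple of an element of `SU(2)`, so right translation
by `e` acts on its first column by the real-linear map `colMul`. This map preserves the norm, hence
both sides are normalised by the same factor. -/
theorem radialSU2_mul (e : SU2) {v : ℂ × ℂ} (hv : v ≠ 0) :
    radialSU2 v * e = radialSU2 (colMul e.1 v) := by
  obtain ⟨h1, h2, h3⟩ := su2_apply e
  have hn := normSq_colMul e.1 v
  rw [h3, mul_one] at hn
  rw [radialSU2, dif_pos hv, radialSU2, dif_pos (colMul_ne_zero e hv)]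
  apply Subtype.ext
  change normalizedMatrix v * e.1 = normalizedMatrix (colMul e.1 v)
  rw [normalizedMatrix, normalizedMatrix, hn, Matrix.smul_mul, colMul_apply]
  congr 1
  ext i j
  fin_cases i <;> fin_cases j <;> simp [h1, h2, Matrix.mul_apply, Fin.sum_univ_two] <;> ring

theorem oneParam_zero (k : Fin 3) : oneParam k 0 = 1 := by
  apply Subtype.ext
  change NormedSpace.exp ((0 : ℝ) • su2Basis k) = 1
  rw [exp_su2Basis]
  simp

theorem colMul_oneParam (k : Fin 3) (t : ℝ) (v : ℂ × ℂ) :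
    colMul (oneParam k t).1 v
      = Real.cos (t / 2) • v + Real.sin (t / 2) • colMul (pauliJ k) v := by
  change colMul (NormedSpace.exp (t • su2Basis k)) v = _
  rw [exp_su2Basis]
  simp only [colMul_apply]
  ext <;> simp [Matrix.algebraMap_eq_diagonal] <;> ring

theorem hasDerivAt_colMul_oneParam (k : Fin 3) (v : ℂ × ℂ) :
    HasDerivAt (fun t : ℝ => colMul (oneParam k t).1 v) (colMul (su2Basis k) v) 0 := by
  have h2 : HasDerivAt (fun t : ℝ => t / 2) (1 / 2) 0 := (hasDerivAt_id (0 : ℝ)).div_const 2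
  have hc := h2.cos.smul_const v
  have hs := h2.sin.smul_const (colMul (pauliJ k) v)
  have h := hc.fun_add hs
  have e : (fun t : ℝ => colMul (oneParam k t).1 v)
      = fun t => Real.cos (t / 2) • v + Real.sin (t / 2) • colMul (pauliJ k) v :=
    funext fun t => colMul_oneParam k t v
  rw [e]
  refine h.congr_deriv ?_
  simp only [colMul_apply, su2Basis]
  ext <;> simp <;> ring

theorem colMul_mul (P Q : Matrix (Fin 2) (Fin 2) ℂ)
    (hP : P 1 1 = starRingEnd ℂ (P 0 0)) (hP' : P 0 1 = -starRingEnd ℂ (P 1 0)) (v : ℂ × ℂ) :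
    colMul Q (colMul P v) = colMul (P * Q) v := by
  simp only [colMul_apply, Matrix.mul_apply, Fin.sum_univ_two, hP, hP']
  ext <;> simp <;> ring

theorem colMul_sub (P Q : Matrix (Fin 2) (Fin 2) ℂ) (v : ℂ × ℂ) :
    colMul (P - Q) v = colMul P v - colMul Q v := by
  simp only [colMul_apply]
  ext <;> simp <;> ring

/-- Right multiplications compose in the reverse order of the matrix product, so the commutator of
the linear maps is taken in the order opposite to that of `su2Basis_commutator`. -/
theorem colMul_commutator (k : Fin 3) (v : ℂ × ℂ) :
    colMul (su2Basis (k + 1)) (colMul (su2Basis k) v)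
      - colMul (su2Basis k) (colMul (su2Basis (k + 1)) v) = colMul (su2Basis (k + 2)) v := by
  have h : ∀ k, su2Basis k 1 1 = starRingEnd ℂ (su2Basis k 0 0) ∧
      su2Basis k 0 1 = -starRingEnd ℂ (su2Basis k 1 0) := by
    intro k
    fin_cases k <;> simp [su2Basis, pauliJ, map_ofNat]
  rw [colMul_mul _ _ (h _).1 (h _).2, colMul_mul _ _ (h _).1 (h _).2, ← colMul_sub,
    su2Basis_commutator]

/-! ### Derivatives along vector fields -/

section DirDeriv

variable {E : Type*} [NormedAddCommGroup E] [NormedSpace ℝ E]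

/-- The derivative of `F` within `S` along the vector field `V`. -/
noncomputable def dirDeriv (S : Set E) (V : E → E) (F : E → ℂ) : E → ℂ :=
  fun x => fderivWithin ℝ F S x (V x)

theorem contDiffOn_dirDeriv {S : Set E} (hS : UniqueDiffOn ℝ S) {V : E → E} {n : ℕ}
    (hV : ContDiff ℝ n V) {F : E → ℂ} (hF : ContDiffOn ℝ (n + 1 : ℕ) F S) :
    ContDiffOn ℝ n (dirDeriv S V F) S :=
  (hF.fderivWithin hS (by norm_cast)).clm_apply hV.contDiffOn

/-- The second derivative terms cancel by symmetry of the second derivative, leaving the derivative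
of `F` along the Lie bracket. Up to the boundary this symmetry follows from that in the interior,
which is why `S` must lie in the closure of its interior. -/
theorem dirDeriv_commutator {S : Set E} (hS : UniqueDiffOn ℝ S) (hS' : S ⊆ closure (interior S))
    {V W : E → E} {V' W' : E →L[ℝ] E} {F : E → ℂ} (hF : ContDiffOn ℝ 2 F S) {x : E} (hx : x ∈ S)
    (hV : HasFDerivAt V V' x) (hW : HasFDerivAt W W' x) :
    dirDeriv S V (dirDeriv S W F) x - dirDeriv S W (dirDeriv S V F) x
      = fderivWithin ℝ F S x (W' (V x) - V' (W x)) := by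
  have hd : DifferentiableWithinAt ℝ (fderivWithin ℝ F S) S x :=
    (hF.fderivWithin hS (m := 1) (by norm_num)).differentiableOn one_ne_zero x hx
  have hsymm : IsSymmSndFDerivWithinAt ℝ F S x :=
    (hF x hx).isSymmSndFDerivWithinAt (by simp) hS (hS' hx) hx
  have key : ∀ {U : E → E} {U' : E →L[ℝ] E}, HasFDerivAt U U' x → ∀ y : E,
      fderivWithin ℝ (dirDeriv S U F) S x y
        = fderivWithin ℝ F S x (U' y) + fderivWithin ℝ (fderivWithin ℝ F S) S x y (U x) := by
    intro U U' hU y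
    have h := (hd.hasFDerivWithinAt.clm_apply hU.hasFDerivWithinAt).fderivWithin (hS x hx)
    have := congrArg (fun A : E →L[ℝ] ℂ => A y) h
    simp only [add_apply, ContinuousLinearMap.comp_apply,
      ContinuousLinearMap.flip_apply] at this
    exact this
  have h1 := key hW (V x)
  have h2 := key hV (W x)
  have h3 := hsymm (V x) (W x)
  simp only [dirDeriv] at h1 h2 ⊢
  rw [h1, h2, h3, map_sub]
  ring

end DirDeriv

/-! ### Regularity of fields and of their derivatives -/

/-- The lift of a field to `ℝ² × ℂ²` along `radialSU2`. -/
noncomputable def lift (f : Field) : (ℝ × ℝ) × (ℂ × ℂ) → ℂ := fun w => f w.1 (radialSU2 w.2)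

/-- The domain of the lift of a field on `K × SU(2)`. -/
def liftDomain (K : Set (ℝ × ℝ)) : Set ((ℝ × ℝ) × (ℂ × ℂ)) := K ×ˢ {0}ᶜ

/-- A closed region with non-degenerate boundary, on which one-sided derivatives make sense. -/
structure RegularRegion (K : Set (ℝ × ℝ)) : Prop where
  uniqueDiffOn : UniqueDiffOn ℝ K
  subset_closure : K ⊆ closure (interior K)

theorem RegularRegion.univ : RegularRegion Set.univ :=
  ⟨uniqueDiffOn_univ, by simp⟩

/-- Two fields agree on `K × SU(2)`. -/
def EqF (K : Set (ℝ × ℝ)) (f f' : Field) : Prop := ∀ z ∈ K, f z = f' z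

section

variable {K : Set (ℝ × ℝ)} {n : ℕ} {f f' f'' : Field}

theorem EqF.trans (h : EqF K f f') (h' : EqF K f' f'') : EqF K f f'' :=
  fun z hz => (h z hz).trans (h' z hz)

theorem EqF.refl (K : Set (ℝ × ℝ)) (f : Field) : EqF K f f := fun _ _ => rfl

theorem RegularRegion.uniqueDiffOn_lift (hK : RegularRegion K) :
    UniqueDiffOn ℝ (liftDomain K) :=
  hK.uniqueDiffOn.prod isOpen_compl_singleton.uniqueDiffOn

theorem RegularRegion.lift_subset_closure (hK : RegularRegion K) :
    liftDomain K ⊆ closure (interior (liftDomain K)) := by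
  rw [liftDomain, interior_prod_eq, closure_prod_eq, isOpen_compl_singleton.interior_eq]
  exact prod_mono hK.subset_closure _root_.subset_closure

theorem IsCk.of_le {m : ℕ} (hf : IsCk n K f) (h : m ≤ n) : IsCk m K f :=
  ContDiffOn.of_le hf (by exact_mod_cast h)

theorem IsCk.add (hf : IsCk n K f) (hf' : IsCk n K f') :
    IsCk n K (fun z g => f z g + f' z g) := ContDiffOn.add hf hf'

theorem IsCk.mul (hf : IsCk n K f) (hf' : IsCk n K f') :
    IsCk n K (fun z g => f z g * f' z g) := ContDiffOn.mul hf hf'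

theorem IsCk.conj (hf : IsCk n K f) : IsCk n K (fun z g => starRingEnd ℂ (f z g)) :=
  Complex.conjCLE.contDiff.comp_contDiffOn hf

theorem IsCk.const_mul (c : ℂ) (hf : IsCk n K f) : IsCk n K (fun z g => c * f z g) :=
  ContDiffOn.mul contDiffOn_const hf

theorem IsCk.sum {ι : Type*} {s : Finset ι} {F : ι → Field} (h : ∀ i ∈ s, IsCk n K (F i)) :
    IsCk n K (fun z g => ∑ i ∈ s, F i z g) := ContDiffOn.sum h

theorem IsCk.slice (hf : IsCk n K f) (g : SU2) : ContDiffOn ℝ n (fun w => f w g) K := by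
  have h : ContDiffOn ℝ n (fun w : ℝ × ℝ => (w, firstCol g)) K :=
    (contDiff_id.prodMk contDiff_const).contDiffOn
  have := ContDiffOn.comp hf h (fun w hw => ⟨hw, firstCol_ne_zero g⟩)
  refine this.congr fun w _ => ?_
  simp only [Function.comp, radialSU2_firstCol]

theorem IsCk.differentiableWithinAt (hf : IsCk (n + 1) K f) {z : ℝ × ℝ} (hz : z ∈ K) (g : SU2) :
    DifferentiableWithinAt ℝ (fun w => f w g) K z :=
  (hf.slice g).differentiableOn (by simp) z hz

theorem IsCk.continuousOn (hf : IsCk n K f) :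
    ContinuousOn (fun x : (ℝ × ℝ) × SU2 => f x.1 x.2) (K ×ˢ Set.univ) := by
  have h : ContinuousOn (fun x : (ℝ × ℝ) × SU2 => (x.1, firstCol x.2)) (K ×ˢ Set.univ) :=
    (continuous_fst.prodMk (continuous_firstCol.comp continuous_snd)).continuousOn
  have := (ContDiffOn.continuousOn hf).comp h (fun x hx => ⟨hx.1, firstCol_ne_zero x.2⟩)
  refine this.congr fun x _ => ?_
  simp only [Function.comp, radialSU2_firstCol]

theorem IsCk.continuous_fiber (hf : IsCk n K f) {z : ℝ × ℝ} (hz : z ∈ K) : Continuous (f z) :=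
  hf.continuousOn.comp_continuous (f := fun g : SU2 => (z, g))
    (continuous_const.prodMk continuous_id) (fun _ => ⟨hz, mem_univ _⟩)

theorem IsCk.hasFDerivWithinAt_lift (hf : IsCk (n + 1) K f) {z : ℝ × ℝ} (hz : z ∈ K)
    {v : ℂ × ℂ} (hv : v ≠ 0) :
    HasFDerivWithinAt (lift f) (fderivWithin ℝ (lift f) (liftDomain K) (z, v)) (liftDomain K)
      (z, v) :=
  (ContDiffOn.differentiableOn hf (by simp) (z, v) ⟨hz, hv⟩).hasFDerivWithinAt

theorem IsCk.fderivWithin_slice (hK : RegularRegion K) (hf : IsCk (n + 1) K f) {z : ℝ × ℝ}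
    (hz : z ∈ K) {v : ℂ × ℂ} (hv : v ≠ 0) (y : ℝ × ℝ) :
    fderivWithin ℝ (fun w => f w (radialSU2 v)) K z y
      = fderivWithin ℝ (lift f) (liftDomain K) (z, v) (y, 0) := by
  have h := hf.hasFDerivWithinAt_lift hz hv
  have hi : HasFDerivWithinAt (fun w : ℝ × ℝ => (w, v))
      (ContinuousLinearMap.inl ℝ (ℝ × ℝ) (ℂ × ℂ)) K z :=
    (hasFDerivAt_prodMk_left z v).hasFDerivWithinAt
  have hc := HasFDerivWithinAt.comp (t := liftDomain K) z h hi
    (fun w hw => mk_mem_prod hw hv)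
  have := hc.fderivWithin (hK.uniqueDiffOn z hz)
  change fderivWithin ℝ (lift f ∘ fun w => (w, v)) K z y = _
  rw [this]
  simp

theorem lift_dTau (hK : RegularRegion K) (hf : IsCk (n + 1) K f) :
    EqOn (lift (dTau K f)) (dirDeriv (liftDomain K) (fun _ => ((1, 0), 0)) (lift f))
      (liftDomain K) :=
  fun _ hw => hf.fderivWithin_slice hK hw.1 hw.2 (1, 0)

theorem lift_dRho (hK : RegularRegion K) (hf : IsCk (n + 1) K f) :
    EqOn (lift (dRho K f)) (dirDeriv (liftDomain K) (fun _ => ((0, 1), 0)) (lift f))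
      (liftDomain K) :=
  fun _ hw => hf.fderivWithin_slice hK hw.1 hw.2 (0, 1)

/-- The lift of the vector field `Zₖ`. -/
noncomputable def liftZ (k : Fin 3) : (ℝ × ℝ) × (ℂ × ℂ) →L[ℝ] (ℝ × ℝ) × (ℂ × ℂ) :=
  (ContinuousLinearMap.inr ℝ (ℝ × ℝ) (ℂ × ℂ)).comp
    ((colMul (su2Basis k)).comp (ContinuousLinearMap.snd ℝ (ℝ × ℝ) (ℂ × ℂ)))

theorem liftZ_apply (k : Fin 3) (w : (ℝ × ℝ) × (ℂ × ℂ)) :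
    liftZ k w = (0, colMul (su2Basis k) w.2) := rfl

/-- The one-parameter subgroup lifts to a curve through `v` that keeps `z` fixed and avoids the
origin of `ℂ²`. It never leaves the domain of the lift, so the derivative within that domain yields
a two-sided derivative in `t`, even when `z` is a boundary point of `K`. -/
theorem IsCk.hasDerivAt_lift_oneParam (hf : IsCk (n + 1) K f) (k : Fin 3) {z : ℝ × ℝ}
    (hz : z ∈ K) {v : ℂ × ℂ} (hv : v ≠ 0) :
    HasDerivAt (fun t : ℝ => f z (radialSU2 v * oneParam k t))
      (dirDeriv (liftDomain K) (liftZ k) (lift f) (z, v)) 0 := by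
  have hcurve : HasDerivAt (fun t : ℝ => (z, colMul (oneParam k t).1 v))
      (0, colMul (su2Basis k) v) 0 :=
    (hasDerivAt_const (0 : ℝ) z).prodMk (hasDerivAt_colMul_oneParam k v)
  have hv0 : colMul (oneParam k 0).1 v = v := by
    rw [colMul_oneParam]; simp
  have h := (hf.hasFDerivWithinAt_lift hz hv).comp_hasDerivAt_of_eq (f := fun t : ℝ =>
    (z, colMul (oneParam k t).1 v)) 0 hcurve
    (Filter.Eventually.of_forall fun t => ⟨hz, colMul_ne_zero _ hv⟩) (by simp only [hv0])
  have e : (fun t : ℝ => f z (radialSU2 v * oneParam k t))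
      = lift f ∘ fun t : ℝ => (z, colMul (oneParam k t).1 v) := by
    funext t
    simp only [lift, Function.comp, radialSU2_mul _ hv]
  rw [e]
  exact h

theorem lift_Z (hf : IsCk (n + 1) K f) (k : Fin 3) :
    EqOn (lift (Z k f)) (dirDeriv (liftDomain K) (liftZ k) (lift f)) (liftDomain K) :=
  fun w hw => (hf.hasDerivAt_lift_oneParam k (v := w.2) hw.1 hw.2).deriv

theorem IsCk.hasDerivAt_Z (hf : IsCk (n + 1) K f) (k : Fin 3) {z : ℝ × ℝ} (hz : z ∈ K)
    (g : SU2) : HasDerivAt (fun t : ℝ => f z (g * oneParam k t)) (Z k f z g) 0 := by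
  have h := hf.hasDerivAt_lift_oneParam k hz (firstCol_ne_zero g)
  rw [radialSU2_firstCol] at h
  exact h.differentiableAt.hasDerivAt

theorem IsCk.dTau (hK : RegularRegion K) (hf : IsCk (n + 1) K f) : IsCk n K (dTau K f) :=
  (contDiffOn_dirDeriv hK.uniqueDiffOn_lift contDiff_const hf).congr (lift_dTau hK hf)

theorem IsCk.dRho (hK : RegularRegion K) (hf : IsCk (n + 1) K f) : IsCk n K (dRho K f) :=
  (contDiffOn_dirDeriv hK.uniqueDiffOn_lift contDiff_const hf).congr (lift_dRho hK hf)

theorem IsCk.Z (hK : RegularRegion K) (hf : IsCk (n + 1) K f) (k : Fin 3) :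
    IsCk n K (Z k f) :=
  (contDiffOn_dirDeriv hK.uniqueDiffOn_lift (liftZ k).contDiff hf).congr (lift_Z hf k)

theorem EqF.dTau (h : EqF K f f') : EqF K (dTau K f) (dTau K f') := fun z hz => by
  funext g
  exact congrArg (fun A : ℝ × ℝ →L[ℝ] ℂ => A (1, 0))
    (fderivWithin_congr (fun w hw => congrFun (h w hw) g) (congrFun (h z hz) g))

theorem EqF.dRho (h : EqF K f f') : EqF K (dRho K f) (dRho K f') := fun z hz => by
  funext g
  exact congrArg (fun A : ℝ × ℝ →L[ℝ] ℂ => A (0, 1))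
    (fderivWithin_congr (fun w hw => congrFun (h w hw) g) (congrFun (h z hz) g))

theorem EqF.Z (h : EqF K f f') (k : Fin 3) : EqF K (Z k f) (Z k f') := fun z hz => by
  funext g
  simp only [LowerDomain.Z, h z hz]

/-! ### Commutators -/

theorem eqF_of_lift (h : EqOn (lift f) (lift f') (liftDomain K)) : EqF K f f' := fun z hz => by
  funext g
  have := h (show (z, firstCol g) ∈ liftDomain K from ⟨hz, firstCol_ne_zero g⟩)
  simpa [lift, radialSU2_firstCol] using this

theorem dirDeriv_congr {E : Type*} [NormedAddCommGroup E] [NormedSpace ℝ E] {S : Set E}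
    {V : E → E} {F G : E → ℂ} (h : EqOn F G S) :
    EqOn (dirDeriv S V F) (dirDeriv S V G) S := fun x hx => by
  simp only [dirDeriv, fderivWithin_congr h (h hx)]

theorem dTau_dRho_comm (hK : RegularRegion K) (hf : IsCk 2 K f) :
    EqF K (LowerDomain.dTau K (LowerDomain.dRho K f))
      (LowerDomain.dRho K (LowerDomain.dTau K f)) := by
  refine eqF_of_lift fun w hw => ?_
  rw [lift_dTau (n := 0) hK (IsCk.dRho (n := 1) hK hf) hw,
    lift_dRho (n := 0) hK (IsCk.dTau (n := 1) hK hf) hw,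
    dirDeriv_congr (lift_dRho (n := 1) hK hf) hw, dirDeriv_congr (lift_dTau (n := 1) hK hf) hw]
  have := dirDeriv_commutator (F := lift f) hK.uniqueDiffOn_lift hK.lift_subset_closure hf hw
    (hasFDerivAt_const ((1, 0), 0) w) (hasFDerivAt_const ((0, 1), 0) w)
  simpa [sub_eq_zero] using this

/-- The lift of `∂_τ` is constant with values in the first factor and the lift of `Zₖ` is linear in
the second, so their Lie bracket vanishes. -/
theorem dTau_Z_comm (hK : RegularRegion K) (hf : IsCk 2 K f) (k : Fin 3) :
    EqF K (LowerDomain.dTau K (LowerDomain.Z k f)) (LowerDomain.Z k (LowerDomain.dTau K f)) := by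
  refine eqF_of_lift fun w hw => ?_
  rw [lift_dTau (n := 0) hK (IsCk.Z (n := 1) hK hf k) hw,
    lift_Z (n := 0) (IsCk.dTau (n := 1) hK hf) k hw,
    dirDeriv_congr (lift_Z (n := 1) hf k) hw, dirDeriv_congr (lift_dTau (n := 1) hK hf) hw]
  have := dirDeriv_commutator (F := lift f) hK.uniqueDiffOn_lift hK.lift_subset_closure hf hw
    (hasFDerivAt_const ((1, 0), 0) w) (liftZ k).hasFDerivAt
  rw [liftZ_apply, zero_apply, sub_zero, map_zero, Prod.mk_zero_zero, map_zero,
    sub_eq_zero] at this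
  exact this

theorem dRho_Z_comm (hK : RegularRegion K) (hf : IsCk 2 K f) (k : Fin 3) :
    EqF K (LowerDomain.dRho K (LowerDomain.Z k f)) (LowerDomain.Z k (LowerDomain.dRho K f)) := by
  refine eqF_of_lift fun w hw => ?_
  rw [lift_dRho (n := 0) hK (IsCk.Z (n := 1) hK hf k) hw,
    lift_Z (n := 0) (IsCk.dRho (n := 1) hK hf) k hw,
    dirDeriv_congr (lift_Z (n := 1) hf k) hw, dirDeriv_congr (lift_dRho (n := 1) hK hf) hw]
  have := dirDeriv_commutator (F := lift f) hK.uniqueDiffOn_lift hK.lift_subset_closure hf hw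
    (hasFDerivAt_const ((0, 1), 0) w) (liftZ k).hasFDerivAt
  rw [liftZ_apply, zero_apply, sub_zero, map_zero, Prod.mk_zero_zero, map_zero,
    sub_eq_zero] at this
  exact this

/-- For linear vector fields the Lie bracket is a commutator of matrices, so the relation reduces to
`colMul_commutator`. -/
theorem Z_commutator (hK : RegularRegion K) (hf : IsCk 2 K f) (k : Fin 3) :
    EqF K (fun z g => LowerDomain.Z k (LowerDomain.Z (k + 1) f) z g
      - LowerDomain.Z (k + 1) (LowerDomain.Z k f) z g) (LowerDomain.Z (k + 2) f) := by
  refine eqF_of_lift fun w hw => ?_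
  change lift (LowerDomain.Z k (LowerDomain.Z (k + 1) f)) w
    - lift (LowerDomain.Z (k + 1) (LowerDomain.Z k f)) w = _
  rw [lift_Z (n := 0) (IsCk.Z (n := 1) hK hf _) k hw,
    lift_Z (n := 0) (IsCk.Z (n := 1) hK hf _) (k + 1) hw, lift_Z (n := 1) hf _ hw,
    dirDeriv_congr (lift_Z (n := 1) hf k) hw, dirDeriv_congr (lift_Z (n := 1) hf (k + 1)) hw]
  have := dirDeriv_commutator (F := lift f) hK.uniqueDiffOn_lift hK.lift_subset_closure hf hw
    (liftZ k).hasFDerivAt (liftZ (k + 1)).hasFDerivAt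
  rw [this]
  simp only [liftZ_apply, dirDeriv, ← colMul_commutator k, Prod.mk_sub_mk, sub_zero]

end

/-! ### The enveloping algebra of the left-invariant fields -/

/-- `h` is of class `C^n` on `SU(2)`. -/
def IsCkGroup (n : ℕ) (h : SU2 → ℂ) : Prop := IsCk n Set.univ fun _ => h

/-- The left-invariant field `Zₖ` on functions on `SU(2)`. -/
noncomputable def zDeriv (k : Fin 3) (h : SU2 → ℂ) : SU2 → ℂ :=
  fun g => deriv (fun t : ℝ => h (g * oneParam k t)) 0

/-- The monomial `Z^α` on functions on `SU(2)`. -/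
noncomputable def zMono (α : Fin 3 → ℕ) (h : SU2 → ℂ) : SU2 → ℂ :=
  (zDeriv 0)^[α 0] ((zDeriv 1)^[α 1] ((zDeriv 2)^[α 2] h))

theorem Z_iterate_apply (k : Fin 3) (n : ℕ) (f : Field) (z : ℝ × ℝ) :
    (Z k)^[n] f z = (zDeriv k)^[n] (f z) := by
  induction n generalizing f with
  | zero => rfl
  | succ n ih => exact ih (Z k f)

theorem Zpow_apply (α : Fin 3 → ℕ) (f : Field) (z : ℝ × ℝ) : Zpow α f z = zMono α (f z) := by
  rw [Zpow, zMono, Z_iterate_apply, Z_iterate_apply, Z_iterate_apply]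

theorem IsCk.fiber {K : Set (ℝ × ℝ)} {n : ℕ} {f : Field} (hf : IsCk n K f) {z : ℝ × ℝ}
    (hz : z ∈ K) : IsCkGroup n (f z) := by
  have h : ContDiffOn ℝ n (fun w : (ℝ × ℝ) × (ℂ × ℂ) => (z, w.2)) (Set.univ ×ˢ {0}ᶜ) :=
    (contDiff_const.prodMk contDiff_snd).contDiffOn
  exact ContDiffOn.comp (t := K ×ˢ {0}ᶜ) hf h (fun w hw => mk_mem_prod hz hw.2)

section

variable {n m : ℕ} {h h' : SU2 → ℂ}

theorem IsCkGroup.of_le (hh : IsCkGroup n h) (hm : m ≤ n) : IsCkGroup m h := IsCk.of_le hh hm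

theorem IsCkGroup.zDeriv (hh : IsCkGroup (n + 1) h) (k : Fin 3) : IsCkGroup n (zDeriv k h) :=
  IsCk.Z RegularRegion.univ hh k

theorem IsCkGroup.add (hh : IsCkGroup n h) (hh' : IsCkGroup n h') : IsCkGroup n (h + h') :=
  IsCk.add hh hh'

theorem IsCkGroup.smul (c : ℂ) (hh : IsCkGroup n h) : IsCkGroup n (c • h) := IsCk.const_mul c hh

theorem IsCkGroup.zero : IsCkGroup n 0 := contDiffOn_const (c := (0 : ℂ))

theorem IsCkGroup.hasDerivAt (hh : IsCkGroup (n + 1) h) (k : Fin 3) (g : SU2) :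
    HasDerivAt (fun t : ℝ => h (g * oneParam k t)) (LowerDomain.zDeriv k h g) 0 :=
  IsCk.hasDerivAt_Z hh k (mem_univ (0, 0)) g

theorem zDeriv_add (hh : IsCkGroup 1 h) (hh' : IsCkGroup 1 h') (k : Fin 3) :
    zDeriv k (h + h') = zDeriv k h + zDeriv k h' := funext fun g =>
  ((hh.hasDerivAt (n := 0) k g).add (hh'.hasDerivAt (n := 0) k g)).deriv

theorem zDeriv_smul (c : ℂ) (h : SU2 → ℂ) (k : Fin 3) :
    zDeriv k (c • h) = c • zDeriv k h := funext fun g => by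
  simp only [zDeriv, Pi.smul_apply, smul_eq_mul]
  exact deriv_const_mul_field c

theorem zDeriv_zero (k : Fin 3) : zDeriv k 0 = 0 := funext fun g => by simp [zDeriv]

/-- The structure constants are chosen before `h`; this uniformity is what allows the later
expansions to be identities between operators. -/
theorem zDeriv_comm (j i : Fin 3) : ∃ c : Fin 3 → ℂ, ∀ h, IsCkGroup 2 h →
    zDeriv j (zDeriv i h) = zDeriv i (zDeriv j h) + ∑ k, c k • zDeriv k h := by
  have key : ∀ k h, IsCkGroup 2 h →
      zDeriv k (zDeriv (k + 1) h) - zDeriv (k + 1) (zDeriv k h) = zDeriv (k + 2) h :=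
    fun k h hh => Z_commutator RegularRegion.univ hh k (0, 0) (mem_univ _)
  -- Modulo 3, two distinct indices are always cyclic neighbours, so the three cyclic commutation
  -- relations cover every pair.
  have hcases : i = j ∨ i = j + 1 ∨ j = i + 1 := by revert i j; decide
  rcases hcases with rfl | rfl | rfl
  · exact ⟨0, fun h _ => by simp⟩
  · refine ⟨Pi.single (j + 2) 1, fun h hh => ?_⟩
    rw [Finset.sum_eq_single (j + 2) (fun k _ hk => by simp [Pi.single_eq_of_ne hk]) (by simp)]
    rw [Pi.single_eq_same, one_smul, ← key j h hh]
    abel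
  · refine ⟨Pi.single (i + 2) (-1), fun h hh => ?_⟩
    rw [Finset.sum_eq_single (i + 2) (fun k _ hk => by simp [Pi.single_eq_of_ne hk]) (by simp)]
    rw [Pi.single_eq_same, neg_one_smul, ← key i h hh]
    abel

/-! ### Ordered monomials and induction on multi-indices -/

theorem zMono_zero (h : SU2 → ℂ) : zMono 0 h = h := by
  simp only [zMono, Pi.zero_apply, Function.iterate_zero, id]

/-- In `Z^α` the smallest index stands outermost. Prepending `Zᵢ` therefore keeps the monomial
ordered exactly when no smaller index occurs, and then no commutator arises. -/
theorem zMono_add_single {α : Fin 3 → ℕ} {i : Fin 3} (hi : ∀ l < i, α l = 0) (h : SU2 → ℂ) :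
    zMono (α + Pi.single i 1) h = zDeriv i (zMono α h) := by
  have hne : ∀ l, l ≠ i → (α + Pi.single i 1 : Fin 3 → ℕ) l = α l := fun l hl => by
    rw [Pi.add_apply, Pi.single_eq_of_ne hl, add_zero]
  have heq : (α + Pi.single i 1 : Fin 3 → ℕ) i = α i + 1 := by
    rw [Pi.add_apply, Pi.single_eq_same]
  have hi3 : i = 0 ∨ i = 1 ∨ i = 2 := by clear hi hne heq h; revert i; decide
  rcases hi3 with rfl | rfl | rfl
  · rw [zMono, zMono, heq, hne 1 (by decide), hne 2 (by decide), Function.iterate_succ_apply']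
  · rw [zMono, zMono, heq, hne 0 (by decide), hne 2 (by decide), hi 0 (by decide),
      Function.iterate_zero, id, id, Function.iterate_succ_apply']
  · rw [zMono, zMono, heq, hne 0 (by decide), hne 1 (by decide), hi 0 (by decide),
      hi 1 (by decide), Function.iterate_zero, Function.iterate_zero, id, id, id, id,
      Function.iterate_succ_apply']

theorem sum_add_single (α : Fin 3 → ℕ) (i : Fin 3) :
    ∑ l, (α + Pi.single i 1 : Fin 3 → ℕ) l = ∑ l, α l + 1 := by
  simp [Finset.sum_add_distrib]

theorem multiIndex_cases (α : Fin 3 → ℕ) :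
    α = 0 ∨ ∃ (β : Fin 3 → ℕ) (i : Fin 3), (∀ l < i, β l = 0) ∧ α = β + Pi.single i 1 := by
  by_cases hα : α = 0
  · exact Or.inl hα
  right
  obtain ⟨i, hi, hmin⟩ : ∃ i, α i ≠ 0 ∧ ∀ l < i, α l = 0 := by
    by_cases h0 : α 0 = 0
    · by_cases h1 : α 1 = 0
      · have h2 : α 2 ≠ 0 := fun h2 => hα (by ext l; fin_cases l <;> simp [h0, h1, h2])
        exact ⟨2, h2, fun l hl => by fin_cases l <;> simp_all⟩
      · exact ⟨1, h1, fun l hl => by fin_cases l <;> simp_all⟩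
    · exact ⟨0, h0, fun l hl => by simp at hl⟩
  refine ⟨α - Pi.single i 1, i, fun l hl => ?_, ?_⟩
  · simp [hmin l hl]
  · funext l
    by_cases hl : l = i
    · subst hl
      simp only [Pi.add_apply, Pi.sub_apply, Pi.single_eq_same]
      omega
    · simp [Pi.single_eq_of_ne hl]

/-- The factor removed at each stage is the one with the smallest index, that is the outermost
derivative of `Z^α`, so the step always matches `zMono_add_single`. -/
theorem multiIndex_induction {P : (Fin 3 → ℕ) → Prop} (h0 : P 0)
    (hs : ∀ β i, (∀ l < i, β l = 0) → P β → P (β + Pi.single i 1)) (α : Fin 3 → ℕ) : P α := by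
  induction hn : ∑ l, α l generalizing α with
  | zero =>
    have : α = 0 := by
      funext l
      exact (Finset.sum_eq_zero_iff.mp hn) l (Finset.mem_univ l)
    rw [this]; exact h0
  | succ n ih =>
    rcases multiIndex_cases α with rfl | ⟨β, i, hi, rfl⟩
    · exact h0
    · rw [sum_add_single] at hn
      exact hs β i hi (ih β (by omega))

theorem IsCkGroup.zMono {α : Fin 3 → ℕ} (hh : IsCkGroup (n + ∑ l, α l) h) :
    IsCkGroup n (zMono α h) := by
  induction α using multiIndex_induction generalizing n with
  | h0 => simpa [zMono_zero] using hh
  | hs β i hi ih =>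
    rw [zMono_add_single hi]
    rw [sum_add_single] at hh
    exact (ih (n := n + 1) (hh.of_le (by omega))).zDeriv i

theorem zMono_add {α : Fin 3 → ℕ} (hh : IsCkGroup (∑ l, α l) h) (hh' : IsCkGroup (∑ l, α l) h') :
    zMono α (h + h') = zMono α h + zMono α h' := by
  induction α using multiIndex_induction with
  | h0 => simp only [zMono_zero]
  | hs β i hi ih =>
    rw [sum_add_single] at hh hh'
    rw [zMono_add_single hi, zMono_add_single hi, zMono_add_single hi,
      ih (hh.of_le (by omega)) (hh'.of_le (by omega)),
      zDeriv_add (hh.of_le (by omega)).zMono (hh'.of_le (by omega)).zMono]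

theorem zMono_smul (c : ℂ) (α : Fin 3 → ℕ) (h : SU2 → ℂ) :
    zMono α (c • h) = c • zMono α h := by
  induction α using multiIndex_induction with
  | h0 => simp only [zMono_zero]
  | hs β i hi ih => rw [zMono_add_single hi, zMono_add_single hi, ih, zDeriv_smul]

end

/-- Operators on functions of class `C^N`. -/
abbrev Operator (N : ℕ) : Type := {h : SU2 → ℂ // IsCkGroup N h} → SU2 → ℂ

/-- The operator `Z^α`. -/
noncomputable def monoOp (N : ℕ) (α : Fin 3 → ℕ) : Operator N := fun h => zMono α h.1

/-- The linear combinations of the operators `Z^α` with `|α| ≤ n`. -/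
noncomputable def filtration (N n : ℕ) : Submodule ℂ (Operator N) :=
  Submodule.span ℂ (monoOp N '' {α | ∑ l, α l ≤ n})

section

variable {N n : ℕ}

theorem monoOp_mem {α : Fin 3 → ℕ} (hα : ∑ l, α l ≤ n) : monoOp N α ∈ filtration N n :=
  Submodule.subset_span ⟨α, hα, rfl⟩

theorem filtration_mono {n' : ℕ} (h : n ≤ n') : filtration N n ≤ filtration N n' :=
  Submodule.span_mono (image_mono fun _ hα => le_trans hα h)

theorem isCkGroup_of_mem_filtration {y : Operator N} (hy : y ∈ filtration N n) {k : ℕ}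
    (hn : n + k ≤ N) (h : {h : SU2 → ℂ // IsCkGroup N h}) : IsCkGroup k (y h) := by
  induction hy using Submodule.span_induction with
  | mem x hx =>
    obtain ⟨α, hα, rfl⟩ := hx
    have hα' : ∑ l, α l ≤ n := hα
    exact (h.2.of_le (by omega)).zMono
  | zero => exact IsCkGroup.zero
  | add x y _ _ hx hy => exact hx.add hy
  | smul c x _ hx => exact hx.smul c

/-- The case of monomials enters as the hypothesis `H`, so that the lemma can be used inside the
induction that proves it for monomials. -/
theorem zDeriv_mem_filtration_of {i : Fin 3}
    (H : ∀ α : Fin 3 → ℕ, ∑ l, α l ≤ n →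
      (fun h => zDeriv i (monoOp N α h)) ∈ filtration N (∑ l, α l + 1))
    {y : Operator N} (hy : y ∈ filtration N n) (hn : n + 1 ≤ N) :
    (fun h => zDeriv i (y h)) ∈ filtration N (n + 1) := by
  induction hy using Submodule.span_induction with
  | mem x hx =>
    obtain ⟨α, hα, rfl⟩ := hx
    have hα' : ∑ l, α l ≤ n := hα
    exact filtration_mono (by omega) (H α hα')
  | zero =>
    simp only [Pi.zero_apply, zDeriv_zero]
    exact zero_mem _
  | add x y hx' hy' hx hy =>
    have : (fun h => zDeriv i ((x + y) h))
        = (fun h => zDeriv i (x h)) + fun h => zDeriv i (y h) := funext fun h =>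
      zDeriv_add (isCkGroup_of_mem_filtration hx' hn h) (isCkGroup_of_mem_filtration hy' hn h) i
    rw [this]
    exact add_mem hx hy
  | smul c x _ hx =>
    have : (fun h => zDeriv i ((c • x) h)) = c • fun h => zDeriv i (x h) :=
      funext fun h => zDeriv_smul c (x h) i
    rw [this]
    exact Submodule.smul_mem _ c hx

/-- The Poincaré–Birkhoff–Witt reordering step: inserting `Z_j` at its place in an ordered monomial
costs only terms of order at most `|α|`. If `i < j` is the smallest index of `α = β + eᵢ`, then `Z_j
Zᵢ Z^β` is `Zᵢ Z_j Z^β` plus terms `Z_k Z^β`, and induction applies to `Z_j Z^β`. -/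
theorem zDeriv_monoOp_sub_mem (n : ℕ) : ∀ α : Fin 3 → ℕ, ∑ l, α l = n → n + 1 ≤ N → ∀ j : Fin 3,
    (fun h => zDeriv j (monoOp N α h)) - monoOp N (α + Pi.single j 1) ∈ filtration N n := by
  induction n using Nat.strong_induction_on with
  | _ n IH =>
  intro α hα hN j
  have hstep : ∀ (i : Fin 3) (β : Fin 3 → ℕ), ∑ l, β l < n →
      (fun h => zDeriv i (monoOp N β h)) ∈ filtration N (∑ l, β l + 1) := by
    intro i β hβ
    have h1 := IH _ hβ β rfl (by omega) i
    have h2 : monoOp N (β + Pi.single i 1) ∈ filtration N (∑ l, β l + 1) :=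
      monoOp_mem (by rw [sum_add_single])
    have := add_mem (filtration_mono (Nat.le_succ _) h1) h2
    rwa [sub_add_cancel] at this
  have hlow : ∀ (γ : Fin 3 → ℕ) (l : Fin 3), (∀ k < l, γ k = 0) →
      (fun h => zDeriv l (monoOp N γ h)) - monoOp N (γ + Pi.single l 1) = 0 := by
    intro γ l hl
    refine sub_eq_zero.mpr (funext fun h => ?_)
    exact (zMono_add_single hl h.1).symm
  rcases multiIndex_cases α with rfl | ⟨β, i, hi, rfl⟩
  · rw [hlow 0 j fun _ _ => rfl]
    exact zero_mem _
  rw [sum_add_single] at hα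
  -- For `j ≤ i` the product `Z_j Z^α` is already ordered and the difference is zero; only `i < j`
  -- requires commuting.
  by_cases hji : j ≤ i
  · rw [hlow _ j fun l hl => ?_]
    · exact zero_mem _
    · simp [hi l (hl.trans_le hji), Pi.single_eq_of_ne (hl.trans_le hji).ne]
  have hij : i < j := not_le.mp hji
  obtain ⟨c, hc⟩ := zDeriv_comm j i
  -- The reordering error for the shorter monomial `Z^β`. It has order at most `|β| = n - 1`, so
  -- `Zᵢ` may still be applied to it within order `n`.
  set y : Operator N := (fun h => zDeriv j (monoOp N β h)) - monoOp N (β + Pi.single j 1) with hy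
  have hymem : y ∈ filtration N (∑ l, β l) := IH _ (by omega) β rfl (by omega) j
  have hiy : (fun h => zDeriv i (y h)) ∈ filtration N n := by
    have := zDeriv_mem_filtration_of (fun γ hγ => hstep i γ (by omega)) hymem (by omega)
    exact filtration_mono (by omega) this
  have hsum : ∑ k, c k • (fun h => zDeriv k (monoOp N β h)) ∈ filtration N n :=
    Submodule.sum_mem _ fun k _ => Submodule.smul_mem _ _
      (filtration_mono (by omega) (hstep k β (by omega)))
  have : (fun h => zDeriv j (monoOp N (β + Pi.single i 1) h))
        - monoOp N (β + Pi.single i 1 + Pi.single j 1)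
      = (fun h => zDeriv i (y h)) + ∑ k, c k • (fun h => zDeriv k (monoOp N β h)) := by
    funext h
    have hreg : IsCkGroup 2 (zMono β h.1) := (h.2.of_le (by omega)).zMono
    have hreg1 : IsCkGroup 1 (zMono (β + Pi.single j 1) h.1) :=
      (h.2.of_le (by rw [sum_add_single]; omega)).zMono
    have hreg2 : IsCkGroup 1 (y h) := isCkGroup_of_mem_filtration hymem (by omega) h
    have hyh : zDeriv j (zMono β h.1) = y h + zMono (β + Pi.single j 1) h.1 := by
      rw [hy]
      exact (sub_add_cancel _ _).symm
    have e1 : zMono (β + Pi.single i 1 + Pi.single j 1) h.1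
        = zDeriv i (zMono (β + Pi.single j 1) h.1) := by
      rw [add_right_comm, zMono_add_single]
      intro l hl
      simp [hi l hl, Pi.single_eq_of_ne (hl.trans hij).ne]
    simp only [Pi.sub_apply, Pi.add_apply, Finset.sum_apply, Pi.smul_apply, monoOp]
    rw [e1, zMono_add_single hi, hc _ hreg, hyh, zDeriv_add hreg2 hreg1]
    abel
  rw [this]
  exact add_mem hiy hsum

theorem zDeriv_monoOp_mem {α : Fin 3 → ℕ} (hN : ∑ l, α l + 1 ≤ N) (j : Fin 3) :
    (fun h => zDeriv j (monoOp N α h)) ∈ filtration N (∑ l, α l + 1) := by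
  have h1 := zDeriv_monoOp_sub_mem (N := N) _ α rfl hN j
  have h2 : monoOp N (α + Pi.single j 1) ∈ filtration N (∑ l, α l + 1) :=
    monoOp_mem (by rw [sum_add_single])
  have := add_mem (filtration_mono (Nat.le_succ _) h1) h2
  rwa [sub_add_cancel] at this

/-- Induction through `[Zᵢ Z^β, Z_j] = Zᵢ [Z^β, Z_j] + [Zᵢ, Z_j] Z^β`: since `[Zᵢ, Z_j]` is again of
first order, the commutator gains no order over `Z^α`. -/
theorem zMono_zDeriv_commutator_mem (j : Fin 3) (α : Fin 3 → ℕ) (hN : ∑ l, α l + 1 ≤ N) :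
    ((fun h => zMono α (zDeriv j h.1) - zDeriv j (zMono α h.1)) : Operator N)
      ∈ filtration N (∑ l, α l) := by
  induction α using multiIndex_induction with
  | h0 =>
    simp only [zMono_zero, sub_self]
    exact zero_mem _
  | hs β i hi ih =>
    rw [sum_add_single] at hN
    obtain ⟨c, hc⟩ := zDeriv_comm j i
    have hy := ih (by omega)
    set y : Operator N := fun h => zMono β (zDeriv j h.1) - zDeriv j (zMono β h.1) with hydef
    have hiy : (fun h => zDeriv i (y h)) ∈ filtration N (∑ l, β l + 1) :=
      zDeriv_mem_filtration_of (fun γ hγ => zDeriv_monoOp_mem (by omega) i) hy (by omega)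
    have hsum : ∑ k, c k • (fun h => zDeriv k (monoOp N β h)) ∈ filtration N (∑ l, β l + 1) :=
      Submodule.sum_mem _ fun k _ => Submodule.smul_mem _ _ (zDeriv_monoOp_mem (by omega) k)
    have : ((fun h => zMono (β + Pi.single i 1) (zDeriv j h.1)
          - zDeriv j (zMono (β + Pi.single i 1) h.1)) : Operator N)
        = (fun h => zDeriv i (y h)) - ∑ k, c k • (fun h => zDeriv k (monoOp N β h)) := by
      funext h
      have hreg : IsCkGroup 2 (zMono β h.1) := (h.2.of_le (by omega)).zMono
      have hreg2 : IsCkGroup 1 (y h) := isCkGroup_of_mem_filtration hy (by omega) h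
      have hyh : zMono β (zDeriv j h.1) = y h + zDeriv j (zMono β h.1) :=
        (sub_add_cancel _ _).symm
      simp only [Pi.sub_apply, Finset.sum_apply, Pi.smul_apply, monoOp]
      rw [zMono_add_single hi, zMono_add_single hi, hyh,
        zDeriv_add hreg2 (hreg.zDeriv (n := 1) j), hc _ hreg]
      abel
    rw [this, sum_add_single]
    exact sub_mem hiy hsum

end

/-- `X = a Z₂ + b Z₁` on functions on `SU(2)`. -/
noncomputable def xOp (a b : ℂ) (h : SU2 → ℂ) : SU2 → ℂ := a • zDeriv 1 h + b • zDeriv 0 h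

theorem Xminus_apply (f : Field) (z : ℝ × ℝ) : Xminus f z = xOp (-1) Complex.I (f z) := by
  funext g
  simp only [Xminus, xOp, Pi.add_apply, Pi.smul_apply, smul_eq_mul, Z, zDeriv]
  ring

theorem Xplus_apply (f : Field) (z : ℝ × ℝ) : Xplus f z = xOp (-1) (-Complex.I) (f z) := by
  funext g
  simp only [Xplus, xOp, Pi.add_apply, Pi.smul_apply, smul_eq_mul, Z, zDeriv]
  ring

/-- The multi-indices of order at most `n`. -/
def multiIndices (n : ℕ) : Finset (Fin 3 → ℕ) :=
  (Fintype.piFinset fun _ : Fin 3 => Finset.range (n + 1)).filter fun α => ∑ i, α i ≤ n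

theorem mem_multiIndices {n : ℕ} {α : Fin 3 → ℕ} : α ∈ multiIndices n ↔ ∑ i, α i ≤ n := by
  simp only [multiIndices, Finset.mem_filter, Fintype.mem_piFinset, Finset.mem_range,
    and_iff_right_iff_imp]
  intro h i
  have hi := Finset.single_le_sum (f := α) (fun _ _ => Nat.zero_le _) (Finset.mem_univ i)
  omega

/-- Membership in `filtration` is an identity of operators, so its coefficients depend on neither
the function nor the point. Cauchy–Schwarz then gives the bound, with the sum of their squared
moduli as constant. -/
theorem exists_commutator_bound (a b : ℂ) (α : Fin 3 → ℕ) : ∃ C : ℝ, 0 ≤ C ∧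
    ∀ h, IsCkGroup (∑ l, α l + 1) h → ∀ g,
      ‖zMono α (xOp a b h) g - xOp a b (zMono α h) g‖ ^ 2
        ≤ C * ∑ β ∈ multiIndices (∑ l, α l), ‖zMono β h g‖ ^ 2 := by
  -- One derivative more than `|α|`, since `Z^α X` has order `|α| + 1`.
  set N := ∑ l, α l + 1 with hN
  have hmem : ((fun h => zMono α (xOp a b h.1) - xOp a b (zMono α h.1)) : Operator N)
      ∈ filtration N (∑ l, α l) := by
    have h1 := Submodule.smul_mem _ a (zMono_zDeriv_commutator_mem (N := N) 1 α le_rfl)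
    have h0 := Submodule.smul_mem _ b (zMono_zDeriv_commutator_mem (N := N) 0 α le_rfl)
    have := add_mem h1 h0
    convert this using 1
    funext h
    have hr : ∀ k, IsCkGroup (∑ l, α l) (zDeriv k h.1) := fun k => h.2.zDeriv k
    simp only [xOp, Pi.add_apply, Pi.smul_apply]
    rw [zMono_add ((hr 1).smul a) ((hr 0).smul b), zMono_smul, zMono_smul]
    simp only [smul_sub]
    abel
  have himage : monoOp N '' {β | ∑ l, β l ≤ ∑ l, α l}
      = monoOp N '' (multiIndices (∑ l, α l) : Set (Fin 3 → ℕ)) := by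
    congr 1
    ext β
    simp [mem_multiIndices]
  rw [filtration, himage, Submodule.mem_span_image_finset_iff_exists_fun'] at hmem
  obtain ⟨c, hc⟩ := hmem
  refine ⟨∑ β ∈ multiIndices (∑ l, α l), ‖c β‖ ^ 2, Finset.sum_nonneg fun _ _ => sq_nonneg _,
    fun h hh g => ?_⟩
  have e : zMono α (xOp a b h) g - xOp a b (zMono α h) g
      = ∑ β ∈ multiIndices (∑ l, α l), c β * zMono β h g := by
    have := congrFun (congrFun hc ⟨h, hh⟩) g
    simpa [monoOp, Finset.sum_apply] using this.symm
  rw [e]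
  calc ‖∑ β ∈ multiIndices (∑ l, α l), c β * zMono β h g‖ ^ 2
      ≤ (∑ β ∈ multiIndices (∑ l, α l), ‖c β‖ * ‖zMono β h g‖) ^ 2 := by
        gcongr
        exact (norm_sum_le _ _).trans_eq (by simp)
    _ ≤ _ := Finset.sum_mul_sq_le_sq_mul_sq _ _ _

/-! ### Integration by parts on `SU(2)` -/

instance isHaarMeasure_haarSU2 : haarSU2.IsHaarMeasure := by
  unfold haarSU2; infer_instance

instance isProbabilityMeasure_haarSU2 : IsProbabilityMeasure haarSU2 :=
  ⟨by simpa [haarSU2] using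
    Measure.haarMeasure_self (K₀ := (⊤ : TopologicalSpace.PositiveCompacts SU2))⟩

instance isMulRightInvariant_haarSU2 : haarSU2.IsMulRightInvariant where
  map_mul_right_eq_self g := by
    -- The right translate is again left invariant, hence a multiple of Haar measure on the compact
    -- group; total mass one fixes the factor.
    have h : IsProbabilityMeasure (Measure.map (· * g) haarSU2) :=
      Measure.isProbabilityMeasure_map (continuous_mul_const g).aemeasurable
    have := Measure.isMulInvariant_eq_smul_of_compactSpace (Measure.map (· * g) haarSU2) haarSU2
    rw [this]
    have h1 := congrArg (fun μ : Measure SU2 => μ Set.univ) this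
    simp only [Measure.smul_apply, measure_univ] at h1
    have h2 : Measure.haarScalarFactor (Measure.map (· * g) haarSU2) haarSU2 = 1 := by
      have : ((Measure.haarScalarFactor (Measure.map (· * g) haarSU2) haarSU2 : NNReal) : ENNReal)
          = 1 := by
        simpa [ENNReal.smul_def] using h1.symm
      exact_mod_cast this
    rw [h2, one_smul]

theorem oneParam_add (k : Fin 3) (s t : ℝ) : oneParam k (s + t) = oneParam k s * oneParam k t := by
  apply Subtype.ext
  change NormedSpace.exp ((s + t) • su2Basis k)
    = NormedSpace.exp (s • su2Basis k) * NormedSpace.exp (t • su2Basis k)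
  rw [add_smul]
  exact Matrix.exp_add_of_commute _ _ (((Commute.refl _).smul_left s).smul_right t)

theorem IsCkGroup.continuous {n : ℕ} {h : SU2 → ℂ} (hh : IsCkGroup n h) : Continuous h :=
  IsCk.continuous_fiber hh (mem_univ (0, 0))

theorem exists_bound_of_continuous {h : SU2 → ℂ} (hh : Continuous h) : ∃ M, ∀ g, ‖h g‖ ≤ M := by
  obtain ⟨M, hM⟩ := (isCompact_range hh).isBounded.exists_norm_le
  exact ⟨M, fun g => hM _ (mem_range_self g)⟩

theorem integrable_of_continuous {E : Type*} [NormedAddCommGroup E]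
    {h : SU2 → E} (hh : Continuous h) : Integrable h haarSU2 :=
  hh.integrable_of_hasCompactSupport (HasCompactSupport.of_compactSpace h)

theorem IsCkGroup.hasDerivAt_oneParam {n : ℕ} {h : SU2 → ℂ} (hh : IsCkGroup (n + 1) h)
    (k : Fin 3) (g : SU2) (t : ℝ) :
    HasDerivAt (fun s : ℝ => h (g * oneParam k s)) (LowerDomain.zDeriv k h (g * oneParam k t))
      t := by
  have h0 := hh.hasDerivAt k (g * oneParam k t)
  have h1 : HasDerivAt (fun s : ℝ => s - t) 1 t := (hasDerivAt_id t).sub_const t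
  have h2 := HasDerivAt.scomp_of_eq (g₁ := fun s : ℝ => h (g * oneParam k t * oneParam k s)) t
    h0 h1 (sub_self t).symm
  rw [one_smul] at h2
  refine h2.congr_of_eventuallyEq (Filter.Eventually.of_forall fun s => ?_)
  simp only [Function.comp, mul_assoc, ← oneParam_add, add_sub_cancel]

/-- By right invariance `t ↦ ∫ h(g exp(tξₖ))` is constant, and its derivative at zero is the
integral of `Zₖ h`. Compactness supplies the dominating bound. -/
theorem integral_zDeriv {h : SU2 → ℂ} (hh : IsCkGroup 1 h) (k : Fin 3) :
    ∫ g, zDeriv k h g ∂haarSU2 = 0 := by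
  have hc : Continuous (zDeriv k h) := (hh.zDeriv (n := 0) k).continuous
  obtain ⟨M, hM⟩ := exists_bound_of_continuous hc
  have hd := (hasDerivAt_integral_of_dominated_loc_of_deriv_le (μ := haarSU2)
    (F := fun (t : ℝ) g => h (g * oneParam k t))
    (F' := fun (t : ℝ) g => zDeriv k h (g * oneParam k t)) (x₀ := (0 : ℝ)) (s := Metric.ball 0 1)
    (bound := fun _ => M) (Metric.ball_mem_nhds _ one_pos)
    (Filter.Eventually.of_forall fun t =>
      (hh.continuous.comp (continuous_mul_const _)).aestronglyMeasurable)
    (integrable_of_continuous (hh.continuous.comp (continuous_mul_const _)))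
    (hc.comp (continuous_mul_const _)).aestronglyMeasurable
    (Filter.Eventually.of_forall fun g t _ => hM _) (integrable_const _)
    (Filter.Eventually.of_forall fun g t _ => hh.hasDerivAt_oneParam (n := 0) k g t)).2
  simp only [integral_mul_right_eq_self] at hd
  exact hd.unique (hasDerivAt_const _ _)

theorem continuous_xOp {a b : ℂ} {h : SU2 → ℂ} (hh : IsCkGroup 1 h) : Continuous (xOp a b h) :=
  ((hh.zDeriv (n := 0) 1).continuous.const_smul a).add
    ((hh.zDeriv (n := 0) 0).continuous.const_smul b)

theorem zDeriv_conj_mul {u w : SU2 → ℂ} (hu : IsCkGroup 1 u) (hw : IsCkGroup 1 w) (k : Fin 3)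
    (g : SU2) : zDeriv k (fun g => starRingEnd ℂ (u g) * w g) g
      = starRingEnd ℂ (zDeriv k u g) * w g + starRingEnd ℂ (u g) * zDeriv k w g := by
  have h1 := hu.hasDerivAt (n := 0) k g
  have h2 := hw.hasDerivAt (n := 0) k g
  have h3 : HasDerivAt (fun t : ℝ => starRingEnd ℂ (u (g * oneParam k t)))
      (starRingEnd ℂ (zDeriv k u g)) 0 :=
    Complex.conjCLE.toContinuousLinearMap.hasFDerivAt.comp_hasDerivAt 0 h1
  have h := (h3.fun_mul h2).deriv
  simpa [oneParam_zero, zDeriv] using h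

/-- `X₊` is the negative of the formal adjoint of `X₋`. -/
theorem integral_xOp_adjoint {u w : SU2 → ℂ} (hu : IsCkGroup 1 u) (hw : IsCkGroup 1 w) :
    ∫ g, ((starRingEnd ℂ (u g) * xOp (-1) Complex.I w g).re
      + (starRingEnd ℂ (w g) * xOp (-1) (-Complex.I) u g).re) ∂haarSU2 = 0 := by
  have huw : IsCkGroup 1 (fun g => starRingEnd ℂ (u g) * w g) := (IsCk.conj hu).mul hw
  have hi : ∀ k, Integrable (zDeriv k fun g => starRingEnd ℂ (u g) * w g) haarSU2 := fun k =>
    integrable_of_continuous (huw.zDeriv (n := 0) k).continuous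
  have h : ∫ g, xOp (-1) Complex.I (fun g => starRingEnd ℂ (u g) * w g) g ∂haarSU2 = 0 := by
    simp only [xOp, Pi.add_apply, Pi.smul_apply, smul_eq_mul]
    rw [integral_add ((hi 1).const_mul _) ((hi 0).const_mul _), integral_const_mul,
      integral_const_mul, integral_zDeriv huw, integral_zDeriv huw, mul_zero, mul_zero, add_zero]
  have h' := Complex.reCLM.integral_comp_comm
    (integrable_of_continuous (continuous_xOp (a := -1) (b := Complex.I) huw))
  rw [h, map_zero] at h'
  rw [← h']
  congr 1
  funext g
  simp only [Complex.reCLM_apply, xOp, Pi.add_apply, Pi.smul_apply, zDeriv_conj_mul hu hw,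
    smul_eq_mul, Complex.add_re, Complex.mul_re, Complex.conj_re, Complex.conj_im, Complex.I_re,
    Complex.I_im, Complex.neg_re, Complex.neg_im, Complex.one_re, Complex.one_im, Complex.add_im,
    Complex.mul_im]
  ring

/-! ### Iterated derivatives of fields -/

/-- An operator on fields which lowers the regularity by one and only depends on the values of the
field on `K × SU(2)`. -/
structure FirstOrder (K : Set (ℝ × ℝ)) (A : Field → Field) : Prop where
  reg : ∀ {n : ℕ} {f : Field}, IsCk (n + 1) K f → IsCk n K (A f)
  congr : ∀ {f f' : Field}, EqF K f f' → EqF K (A f) (A f')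

section

variable {K : Set (ℝ × ℝ)} {A B : Field → Field} {f f' : Field}

theorem firstOrder_dTau (hK : RegularRegion K) : FirstOrder K (dTau K) :=
  ⟨fun h => h.dTau hK, fun h => h.dTau⟩

theorem firstOrder_dRho (hK : RegularRegion K) : FirstOrder K (dRho K) :=
  ⟨fun h => h.dRho hK, fun h => h.dRho⟩

theorem firstOrder_Z (hK : RegularRegion K) (k : Fin 3) : FirstOrder K (Z k) :=
  ⟨fun h => h.Z hK k, fun h => h.Z k⟩

theorem FirstOrder.iterate_reg (hA : FirstOrder K A) {n k : ℕ} (hf : IsCk (n + k) K f) :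
    IsCk n K (A^[k] f) := by
  induction k generalizing f with
  | zero => exact hf
  | succ k ih => exact ih (hA.reg hf)

theorem FirstOrder.iterate_congr (hA : FirstOrder K A) (k : ℕ) (h : EqF K f f') :
    EqF K (A^[k] f) (A^[k] f') := by
  induction k generalizing f f' with
  | zero => exact h
  | succ k ih => exact ih (hA.congr h)

theorem FirstOrder.comm_iterate (hB : FirstOrder K B)
    (hAB : ∀ f, IsCk 2 K f → EqF K (A (B f)) (B (A f))) {b : ℕ} (hf : IsCk (b + 1) K f) :
    EqF K (A (B^[b] f)) (B^[b] (A f)) := by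
  induction b generalizing f with
  | zero => exact EqF.refl _ _
  | succ b ih =>
    exact (ih (hB.reg hf)).trans (hB.iterate_congr b (hAB f (hf.of_le (by omega))))

/-- The operators commute only on `K × SU(2)` and only on `C²` fields, so each interchange spends
regularity; class `C^(a+b)` suffices for all of them. -/
theorem FirstOrder.iterate_comm (hA : FirstOrder K A) (hB : FirstOrder K B)
    (hAB : ∀ f, IsCk 2 K f → EqF K (A (B f)) (B (A f))) {a b : ℕ} (hf : IsCk (a + b) K f) :
    EqF K (A^[a] (B^[b] f)) (B^[b] (A^[a] f)) := by
  induction a generalizing f with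
  | zero => exact EqF.refl _ _
  | succ a ih =>
    exact (hA.iterate_congr a (hB.comm_iterate hAB (hf.of_le (by omega)))).trans
      (ih (hA.reg (hf.of_le (by omega))))

theorem sum_multiIndex (α : Fin 3 → ℕ) : ∑ l, α l = α 0 + α 1 + α 2 := Fin.sum_univ_three α

theorem IsCk.Zpow (hK : RegularRegion K) {n : ℕ} {α : Fin 3 → ℕ}
    (hf : IsCk (n + ∑ l, α l) K f) : IsCk n K (Zpow α f) := by
  rw [sum_multiIndex] at hf
  exact (firstOrder_Z hK 0).iterate_reg ((firstOrder_Z hK 1).iterate_reg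
    ((firstOrder_Z hK 2).iterate_reg (hf.of_le (by omega))))

theorem EqF.Zpow (h : EqF K f f') (α : Fin 3 → ℕ) : EqF K (Zpow α f) (Zpow α f') :=
  fun z hz => by rw [Zpow_apply, Zpow_apply, h z hz]

theorem FirstOrder.iterate_Zpow_comm (hK : RegularRegion K) (hA : FirstOrder K A)
    (hAZ : ∀ k f, IsCk 2 K f → EqF K (A (Z k f)) (Z k (A f))) {a : ℕ} {α : Fin 3 → ℕ}
    (hf : IsCk (a + ∑ l, α l) K f) : EqF K (A^[a] (Zpow α f)) (Zpow α (A^[a] f)) := by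
  rw [sum_multiIndex] at hf
  have hZ := firstOrder_Z hK
  have h2 : IsCk (a + α 0 + α 1) K ((Z 2)^[α 2] f) := (hZ 2).iterate_reg (hf.of_le (by omega))
  have h1 : IsCk (a + α 0) K ((Z 1)^[α 1] ((Z 2)^[α 2] f)) := (hZ 1).iterate_reg h2
  refine (hA.iterate_comm (hZ 0) (hAZ 0) h1).trans ((hZ 0).iterate_congr _ ?_)
  refine (hA.iterate_comm (hZ 1) (hAZ 1) (h2.of_le (by omega))).trans
    ((hZ 1).iterate_congr _ ?_)
  exact hA.iterate_comm (hZ 2) (hAZ 2) (hf.of_le (by omega))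

theorem IsCk.mixed (hK : RegularRegion K) {n P Q : ℕ} (hf : IsCk (n + P + Q) K f) :
    IsCk n K ((LowerDomain.dRho K)^[P] ((LowerDomain.dTau K)^[Q] f)) :=
  (firstOrder_dRho hK).iterate_reg ((firstOrder_dTau hK).iterate_reg hf)

theorem D_congr (hK : RegularRegion K) (p' q' : ℕ) (α : Fin 3 → ℕ) (h : EqF K f f') :
    EqF K (D K p' q' α f) (D K p' q' α f') :=
  (firstOrder_dRho hK).iterate_congr _ ((firstOrder_dTau hK).iterate_congr _ (h.Zpow α))

/-- Moves every derivative to the normal form with `Z^α` outermost. The `∂_τ` and `∂_ρ` orders then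
simply add, and the transport equations can be commuted once for this form. -/
theorem D_eq_Zpow (hK : RegularRegion K) {p q p' q' : ℕ} {α : Fin 3 → ℕ}
    (hf : IsCk (p + q + (q' + p' + ∑ l, α l)) K f) :
    EqF K (D K p' q' α ((dRho K)^[p] ((dTau K)^[q] f)))
      (Zpow α ((dRho K)^[p + p'] ((dTau K)^[q + q'] f))) := by
  have hT := firstOrder_dTau hK
  have hR := firstOrder_dRho hK
  have hF : IsCk (q' + p' + ∑ l, α l) K ((dRho K)^[p] ((dTau K)^[q] f)) :=
    IsCk.mixed hK (hf.of_le (by omega))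
  have h1 := hT.iterate_Zpow_comm hK (fun k f hf => dTau_Z_comm hK hf k) (a := q') (α := α)
    (hF.of_le (by omega))
  have hF' : IsCk (p' + ∑ l, α l) K ((dTau K)^[q'] ((dRho K)^[p] ((dTau K)^[q] f))) :=
    hT.iterate_reg (hF.of_le (by omega))
  have h2 := hR.iterate_Zpow_comm hK (fun k f hf => dRho_Z_comm hK hf k) (a := p') (α := α) hF'
  have hq : IsCk (q' + p) K ((dTau K)^[q] f) := hT.iterate_reg (hf.of_le (by omega))
  have h3 := hT.iterate_comm hR (fun f hf => dTau_dRho_comm hK hf) hq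
  refine (hR.iterate_congr p' h1).trans (h2.trans (EqF.Zpow ?_ α))
  have h4 := hR.iterate_congr p' h3
  rwa [← Function.iterate_add_apply, ← Function.iterate_add_apply, add_comm p' p,
    add_comm q' q] at h4

/-- The characteristic data are stated for `∂_τ^q ∂_ρ^p` and the norms for `∂_ρ^p ∂_τ^q`; both lead
to the same normal form. -/
theorem D_eq_Zpow' (hK : RegularRegion K) {p q p' q' : ℕ} {α : Fin 3 → ℕ}
    (hf : IsCk (p + q + (q' + p' + ∑ l, α l)) K f) :
    EqF K (D K p' q' α ((dTau K)^[q] ((dRho K)^[p] f)))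
      (Zpow α ((dRho K)^[p + p'] ((dTau K)^[q + q'] f))) :=
  (D_congr hK p' q' α ((firstOrder_dTau hK).iterate_comm (firstOrder_dRho hK)
    (fun _ hf => dTau_dRho_comm hK hf) (hf.of_le (by omega)))).trans (D_eq_Zpow hK hf)

/-! ### Commutation of a transport equation with derivatives -/

/-- The equation `((c + d τ) ∂_τ + e ρ ∂_ρ + a) u = h` on `K × SU(2)`. -/
def Transports (K : Set (ℝ × ℝ)) (c d e a : ℝ) (u h : Field) : Prop :=
  EqF K (fun z g => (c + d * z.1) • dTau K u z g + (e * z.2) • dRho K u z g + a • u z g) h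

theorem fderivWithin_transport (hK : RegularRegion K) (c d e a : ℝ) (hf : IsCk 2 K f)
    {z : ℝ × ℝ} (hz : z ∈ K) (g : SU2) (y : ℝ × ℝ) :
    fderivWithin ℝ (fun w : ℝ × ℝ => (c + d * w.1) • dTau K f w g + (e * w.2) • dRho K f w g
        + a • f w g) K z y
      = (c + d * z.1) • fderivWithin ℝ (fun w => dTau K f w g) K z y + (d * y.1) • dTau K f z g
        + ((e * z.2) • fderivWithin ℝ (fun w => dRho K f w g) K z y + (e * y.2) • dRho K f z g)
        + a • fderivWithin ℝ (fun w => f w g) K z y := by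
  have hT : IsCk 1 K (dTau K f) := IsCk.dTau (n := 1) hK hf
  have hR : IsCk 1 K (dRho K f) := IsCk.dRho (n := 1) hK hf
  have h1 := (hT.differentiableWithinAt (n := 0) hz g).hasFDerivWithinAt
  have h2 := (hR.differentiableWithinAt (n := 0) hz g).hasFDerivWithinAt
  have h3 := (hf.differentiableWithinAt (n := 1) hz g).hasFDerivWithinAt
  have hA : HasFDerivWithinAt (fun w : ℝ × ℝ => c + d * w.1)
      (d • ContinuousLinearMap.fst ℝ ℝ ℝ) K z :=
    ((hasFDerivAt_fst.const_mul d).const_add c).hasFDerivWithinAt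
  have hB : HasFDerivWithinAt (fun w : ℝ × ℝ => e * w.2)
      (e • ContinuousLinearMap.snd ℝ ℝ ℝ) K z :=
    (hasFDerivAt_snd.const_mul e).hasFDerivWithinAt
  have h := (((hA.fun_smul h1).fun_add (hB.fun_smul h2)).fun_add
    (h3.fun_const_smul a)).fderivWithin (hK.uniqueDiffOn z hz)
  rw [h]
  simp

/-- Differentiating the coefficient `c + dτ` returns `d ∂_τ u`, a zeroth order term in the new
unknown. Each `∂_τ` thus adds `d` to `a`, just as each `∂_ρ` adds `e`; these shifts produce the
damping. -/
theorem Transports.dTau (hK : RegularRegion K) {c d e a : ℝ} {u h : Field} (hu : IsCk 2 K u)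
    (H : Transports K c d e a u h) : Transports K c d e (a + d) (dTau K u) (dTau K h) := by
  refine EqF.trans (fun z hz => ?_) (EqF.dTau H)
  funext g
  have hc := congrFun (dTau_dRho_comm hK hu z hz) g
  change _ = fderivWithin ℝ (fun w : ℝ × ℝ => (c + d * w.1) • LowerDomain.dTau K u w g
    + (e * w.2) • LowerDomain.dRho K u w g + a • u w g) K z (1, 0)
  rw [fderivWithin_transport hK c d e a hu hz g]
  change _ = (c + d * z.1) • LowerDomain.dTau K (LowerDomain.dTau K u) z g + _
    + ((e * z.2) • LowerDomain.dTau K (LowerDomain.dRho K u) z g + _)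
    + a • LowerDomain.dTau K u z g
  rw [hc]
  simp only [mul_one, mul_zero, zero_smul, add_zero, add_smul]
  abel

theorem Transports.dRho (hK : RegularRegion K) {c d e a : ℝ} {u h : Field} (hu : IsCk 2 K u)
    (H : Transports K c d e a u h) : Transports K c d e (a + e) (dRho K u) (dRho K h) := by
  refine EqF.trans (fun z hz => ?_) (EqF.dRho H)
  funext g
  have hc := congrFun (dTau_dRho_comm hK hu z hz) g
  change _ = fderivWithin ℝ (fun w : ℝ × ℝ => (c + d * w.1) • LowerDomain.dTau K u w g
    + (e * w.2) • LowerDomain.dRho K u w g + a • u w g) K z (0, 1)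
  rw [fderivWithin_transport hK c d e a hu hz g]
  change _ = (c + d * z.1) • LowerDomain.dRho K (LowerDomain.dTau K u) z g + _
    + ((e * z.2) • LowerDomain.dRho K (LowerDomain.dRho K u) z g + _)
    + a • LowerDomain.dRho K u z g
  rw [hc]
  simp only [mul_one, mul_zero, zero_smul, add_zero, add_smul]
  abel

theorem Transports.Z (hK : RegularRegion K) {c d e a : ℝ} {u h : Field} (hu : IsCk 2 K u)
    (H : Transports K c d e a u h) (k : Fin 3) :
    Transports K c d e a (Z k u) (Z k h) := by
  refine EqF.trans (fun z hz => ?_) (EqF.Z H k)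
  funext g
  have h1 := (IsCk.dTau (n := 1) hK hu).hasDerivAt_Z (n := 0) k hz g
  have h2 := (IsCk.dRho (n := 1) hK hu).hasDerivAt_Z (n := 0) k hz g
  have h3 := hu.hasDerivAt_Z (n := 1) k hz g
  have hd := (((h1.fun_const_smul (c + d * z.1)).fun_add (h2.fun_const_smul (e * z.2))).fun_add
    (h3.fun_const_smul a)).deriv
  rw [← congrFun (dTau_Z_comm hK hu k z hz) g, ← congrFun (dRho_Z_comm hK hu k z hz) g] at hd
  exact hd.symm

theorem Transports.iterate_dTau (hK : RegularRegion K) {c d e a : ℝ} {u h : Field} {n : ℕ}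
    (hu : IsCk (n + 1) K u) (H : Transports K c d e a u h) :
    Transports K c d e (a + n * d) ((LowerDomain.dTau K)^[n] u) ((LowerDomain.dTau K)^[n] h) := by
  induction n generalizing a u h with
  | zero => simpa using H
  | succ n ih =>
    have := ih (IsCk.dTau hK hu) (H.dTau hK (hu.of_le (by omega)))
    have e : a + ((n + 1 : ℕ) : ℝ) * d = a + d + n * d := by push_cast; ring
    rw [e]
    exact this

theorem Transports.iterate_dRho (hK : RegularRegion K) {c d e a : ℝ} {u h : Field} {n : ℕ}
    (hu : IsCk (n + 1) K u) (H : Transports K c d e a u h) :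
    Transports K c d e (a + n * e) ((LowerDomain.dRho K)^[n] u) ((LowerDomain.dRho K)^[n] h) := by
  induction n generalizing a u h with
  | zero => simpa using H
  | succ n ih =>
    have := ih (IsCk.dRho hK hu) (H.dRho hK (hu.of_le (by omega)))
    have e : a + ((n + 1 : ℕ) : ℝ) * e = a + e + n * e := by push_cast; ring
    rw [e]
    exact this

theorem Transports.iterate_Z (hK : RegularRegion K) {c d e a : ℝ} {u h : Field} {n : ℕ}
    (hu : IsCk (n + 1) K u) (H : Transports K c d e a u h) (k : Fin 3) :
    Transports K c d e a ((LowerDomain.Z k)^[n] u) ((LowerDomain.Z k)^[n] h) := by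
  induction n generalizing u h with
  | zero => exact H
  | succ n ih => exact ih (IsCk.Z hK hu k) (H.Z hK (hu.of_le (by omega)) k)

theorem Transports.Zpow (hK : RegularRegion K) {c d e a : ℝ} {u h : Field} {α : Fin 3 → ℕ}
    (hu : IsCk (∑ l, α l + 1) K u) (H : Transports K c d e a u h) :
    Transports K c d e a (Zpow α u) (Zpow α h) := by
  rw [sum_multiIndex] at hu
  have hZ := firstOrder_Z hK
  have h2 : IsCk (α 0 + α 1 + 1) K ((LowerDomain.Z 2)^[α 2] u) :=
    (hZ 2).iterate_reg (hu.of_le (by omega))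
  have h1 : IsCk (α 0 + 1) K ((LowerDomain.Z 1)^[α 1] ((LowerDomain.Z 2)^[α 2] u)) :=
    (hZ 1).iterate_reg (h2.of_le (by omega))
  exact ((H.iterate_Z hK (hu.of_le (by omega)) 2).iterate_Z hK (h2.of_le (by omega)) 1).iterate_Z
    hK h1 0

/-- The field of operators `a Z₂ + b Z₁`. -/
noncomputable def xField (a b : ℂ) (f : Field) : Field := fun z => xOp a b (f z)

theorem firstOrder_xField (hK : RegularRegion K) (a b : ℂ) : FirstOrder K (xField a b) :=
  ⟨fun h => ((h.Z hK 1).const_mul a).add ((h.Z hK 0).const_mul b),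
    fun h z hz => by simp only [xField, h z hz]⟩

theorem fderivWithin_xField (hK : RegularRegion K) {a b : ℂ} (hf : IsCk 2 K f) {z : ℝ × ℝ}
    (hz : z ∈ K) (g : SU2) (y : ℝ × ℝ) :
    fderivWithin ℝ (fun w => xField a b f w g) K z y
      = a * fderivWithin ℝ (fun w => Z 1 f w g) K z y
        + b * fderivWithin ℝ (fun w => Z 0 f w g) K z y := by
  have h1 := ((IsCk.Z (n := 1) hK hf 1).differentiableWithinAt (n := 0) hz g).hasFDerivWithinAt
  have h0 := ((IsCk.Z (n := 1) hK hf 0).differentiableWithinAt (n := 0) hz g).hasFDerivWithinAt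
  have h := ((h1.fun_const_smul a).fun_add (h0.fun_const_smul b)).fderivWithin
    (hK.uniqueDiffOn z hz)
  exact (congrArg (fun L : ℝ × ℝ →L[ℝ] ℂ => L y) h).trans (by simp)

theorem dTau_xField_comm (hK : RegularRegion K) (a b : ℂ) (hf : IsCk 2 K f) :
    EqF K (dTau K (xField a b f)) (xField a b (dTau K f)) := fun z hz => by
  funext g
  refine (fderivWithin_xField hK hf hz g _).trans ?_
  exact congrArg₂ (fun x y => a * x + b * y) (congrFun (dTau_Z_comm hK hf 1 z hz) g)
    (congrFun (dTau_Z_comm hK hf 0 z hz) g)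

theorem dRho_xField_comm (hK : RegularRegion K) (a b : ℂ) (hf : IsCk 2 K f) :
    EqF K (dRho K (xField a b f)) (xField a b (dRho K f)) := fun z hz => by
  funext g
  refine (fderivWithin_xField hK hf hz g _).trans ?_
  exact congrArg₂ (fun x y => a * x + b * y) (congrFun (dRho_Z_comm hK hf 1 z hz) g)
    (congrFun (dRho_Z_comm hK hf 0 z hz) g)

/-- On the right-hand side `X` is pulled out of the `∂_τ` and `∂_ρ`, with which it commutes, but
stays inside `Z^α`, with which it does not. -/
theorem Transports.commute (hK : RegularRegion K) {c d e a : ℝ} {x y : ℂ} {u w : Field}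
    {P Q : ℕ} {α : Fin 3 → ℕ} (hu : IsCk (P + Q + ∑ l, α l + 1) K u)
    (hw : IsCk (P + Q + 1) K w) (H : Transports K c d e a u (xField x y w)) :
    Transports K c d e (a + Q * d + P * e)
      (LowerDomain.Zpow α ((LowerDomain.dRho K)^[P] ((LowerDomain.dTau K)^[Q] u)))
      (LowerDomain.Zpow α (xField x y ((LowerDomain.dRho K)^[P] ((LowerDomain.dTau K)^[Q] w)))) := by
  have hT := firstOrder_dTau hK
  have hR := firstOrder_dRho hK
  have hX := firstOrder_xField hK x y
  have h1 := H.iterate_dTau hK (n := Q) (hu.of_le (by omega))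
  have h2 := h1.iterate_dRho hK (n := P) (hT.iterate_reg (hu.of_le (by omega)))
  have h3 := h2.Zpow hK (α := α) (IsCk.mixed hK (hu.of_le (by omega)))
  refine EqF.trans h3 (EqF.Zpow ?_ α)
  have e1 := hT.iterate_comm hX (fun _ hf => dTau_xField_comm hK x y hf) (a := Q) (b := 1)
    (hw.of_le (by omega))
  have e2 := hR.iterate_comm hX (fun _ hf => dRho_xField_comm hK x y hf) (a := P) (b := 1)
    (f := (LowerDomain.dTau K)^[Q] w) (hT.iterate_reg (hw.of_le (by omega)))
  exact (hR.iterate_congr P e1).trans e2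

end

/-! ### The geometry of the lower domain -/

/-- The map straightening the lower domain to the rectangle `[-1, -1 + ε] × [0, 1]`. -/
noncomputable def straighten (ρs : ℝ) (w : ℝ × ℝ) : ℝ × ℝ := (w.1, w.2 * edge ρs w.1)

theorem edge_pos {ρs τ : ℝ} (hρ : 0 < ρs) (hτ : τ < 1) : 0 < edge ρs τ :=
  div_pos (by linarith) (by linarith)

theorem edge_neg_one (ρs : ℝ) : edge ρs (-1) = ρs := by
  simp only [edge]; ring

theorem hasDerivAt_edge (ρs : ℝ) {τ : ℝ} (hτ : τ < 1) :
    HasDerivAt (edge ρs) (edge ρs τ / (1 - τ)) τ := by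
  have h1 : 1 - τ ≠ 0 := by linarith
  have h := (hasDerivAt_const τ (2 * ρs)).fun_div ((hasDerivAt_id τ).const_sub 1) h1
  refine h.congr_deriv ?_
  simp only [edge, id]
  field_simp
  ring

theorem continuousOn_edge (ρs : ℝ) : ContinuousOn (edge ρs) (Iio 1) := fun _ hτ =>
  (hasDerivAt_edge ρs hτ).continuousAt.continuousWithinAt

section

variable {ε ρs : ℝ}

theorem straighten_image (hε2 : ε < 2) (hρ : 0 < ρs) :
    straighten ρs '' (Icc (-1) (-1 + ε) ×ˢ Icc 0 1) = region ε ρs := by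
  ext ⟨τ, ρ⟩
  constructor
  · rintro ⟨⟨τ', s⟩, ⟨⟨h1, h2⟩, h3, h4⟩, h⟩
    simp only [straighten, Prod.mk.injEq] at h h1 h2 h3 h4
    obtain ⟨rfl, rfl⟩ := h
    have hp := edge_pos hρ (show τ' < 1 by linarith)
    exact ⟨h1, h2, by positivity, mul_le_of_le_one_left hp.le h4⟩
  · rintro ⟨h1, h2, h3, h4⟩
    simp only at h1 h2 h3 h4
    have hp := edge_pos hρ (show τ < 1 by linarith)
    refine ⟨(τ, ρ / edge ρs τ), ⟨⟨h1, h2⟩, by simp only; positivity, ?_⟩, ?_⟩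
    · exact (div_le_one hp).mpr h4
    · simp only [straighten, div_mul_cancel₀ _ hp.ne']

theorem straighten_mem (hε2 : ε < 2) (hρ : 0 < ρs) {τ s : ℝ} (hτ : τ ∈ Icc (-1) (-1 + ε))
    (hs : s ∈ Icc (0 : ℝ) 1) : (τ, s * edge ρs τ) ∈ region ε ρs := by
  rw [← straighten_image hε2 hρ]
  exact ⟨(τ, s), ⟨hτ, hs⟩, rfl⟩

theorem hasFDerivAt_straighten (ρs : ℝ) {w : ℝ × ℝ} (hw : w.1 < 1) :
    HasFDerivAt (straighten ρs)
      ((ContinuousLinearMap.fst ℝ ℝ ℝ).prod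
        (w.2 • ((edge ρs w.1 / (1 - w.1)) • ContinuousLinearMap.fst ℝ ℝ ℝ)
          + edge ρs w.1 • ContinuousLinearMap.snd ℝ ℝ ℝ)) w := by
  have h1 : HasFDerivAt (fun w : ℝ × ℝ => edge ρs w.1)
      ((edge ρs w.1 / (1 - w.1)) • ContinuousLinearMap.fst ℝ ℝ ℝ) w :=
    (hasDerivAt_edge ρs hw).comp_hasFDerivAt w hasFDerivAt_fst
  exact hasFDerivAt_fst.prodMk (hasFDerivAt_snd.fun_mul h1)

theorem continuousOn_straighten (hε2 : ε < 2) :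
    ContinuousOn (straighten ρs) (Icc (-1) (-1 + ε) ×ˢ Icc 0 1) := fun w hw =>
  (hasFDerivAt_straighten ρs (show w.1 < 1 by have := hw.1.2; linarith)).continuousAt
    |>.continuousWithinAt

theorem isCompact_region (hε2 : ε < 2) (hρ : 0 < ρs) : IsCompact (region ε ρs) := by
  rw [← straighten_image hε2 hρ]
  exact (isCompact_Icc.prod isCompact_Icc).image_of_continuousOn (continuousOn_straighten hε2)

/-- Both properties hold for a rectangle and are carried over by `straighten`. Its derivative is
onto because `edge` is positive for `τ < 1`, which `ε < 2` guarantees. -/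
theorem regularRegion_region (hε : 0 < ε) (hε2 : ε < 2) (hρ : 0 < ρs) :
    RegularRegion (region ε ρs) := by
  constructor
  · rw [← straighten_image hε2 hρ]
    refine UniqueDiffOn.image ((uniqueDiffOn_Icc (by linarith)).prod
      (uniqueDiffOn_Icc one_pos)) (fun w hw => (hasFDerivAt_straighten ρs
        (show w.1 < 1 by have := hw.1.2; linarith)).hasFDerivWithinAt) fun w hw => ?_
    have hlt : w.1 < 1 := by have := hw.1.2; linarith
    have hp := edge_pos hρ hlt
    refine Function.Surjective.denseRange fun y => ?_
    refine ⟨(y.1, (y.2 - w.2 * (edge ρs w.1 / (1 - w.1) * y.1)) / edge ρs w.1), ?_⟩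
    ext
    · simp
    · simp
      field_simp
      ring
  · have hopen : IsOpen {z : ℝ × ℝ | (-1 < z.1 ∧ z.1 < -1 + ε) ∧ 0 < z.2 ∧
        z.2 * (1 - z.1) < 2 * ρs} := by
      refine ((isOpen_lt continuous_const continuous_fst).inter
        (isOpen_lt continuous_fst continuous_const)).inter
        ((isOpen_lt continuous_const continuous_snd).inter
        (isOpen_lt (continuous_snd.mul (continuous_const.sub continuous_fst)) continuous_const))
    have hsub : straighten ρs '' (Ioo (-1) (-1 + ε) ×ˢ Ioo 0 1) ⊆ interior (region ε ρs) := by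
      refine Subset.trans ?_ (interior_maximal ?_ hopen)
      · rintro _ ⟨⟨τ, s⟩, ⟨⟨h1, h2⟩, h3, h4⟩, rfl⟩
        simp only at h1 h2 h3 h4
        have hp := edge_pos hρ (show τ < 1 by linarith)
        have h5 : (1 - τ) ≠ 0 := by linarith
        refine ⟨⟨h1, h2⟩, by simp only [straighten]; positivity, ?_⟩
        simp only [straighten, edge]
        field_simp
        linarith
      · rintro z ⟨⟨h1, h2⟩, h3, h4⟩
        refine ⟨h1.le, h2.le, h3.le, ?_⟩
        rw [edge, le_div_iff₀ (by linarith)]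
        exact h4.le
    refine Subset.trans ?_ (closure_mono hsub)
    rw [← straighten_image hε2 hρ]
    have hcl : Icc (-1) (-1 + ε) ×ˢ Icc (0 : ℝ) 1 = closure (Ioo (-1) (-1 + ε) ×ˢ Ioo 0 1) := by
      rw [closure_prod_eq, closure_Ioo (by linarith), closure_Ioo zero_ne_one]
    have hc := continuousOn_straighten (ρs := ρs) hε2
    rw [hcl] at hc ⊢
    exact hc.image_closure

/-! ### Integration over the lower domain -/

/-- Fubini followed by the substitution `ρ = s · edge(τ)`, whose Jacobian is `edge ρs τ`. -/
theorem integral_region (hε : 0 < ε) (hε2 : ε < 2) (hρ : 0 < ρs) {F : ℝ × ℝ → ℝ}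
    (hF : ContinuousOn F (region ε ρs)) :
    ∫ z in region ε ρs, F z
      = ∫ τ in (-1)..(-1 + ε), ∫ s in (0 : ℝ)..1, edge ρs τ * F (τ, s * edge ρs τ) := by
  have hm := (isCompact_region hε2 hρ).measurableSet
  have hi : IntegrableOn F (region ε ρs) := hF.integrableOn_compact (isCompact_region hε2 hρ)
  rw [← integral_indicator hm, Measure.volume_eq_prod, integral_prod]
  · rw [intervalIntegral.integral_of_le (by linarith), ← integral_Icc_eq_integral_Ioc,
      ← integral_indicator measurableSet_Icc]
    congr 1
    funext τ
    by_cases hτ : τ ∈ Icc (-1) (-1 + ε)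
    · have hp := edge_pos hρ (show τ < 1 by have := hτ.2; linarith)
      have h1 : ∀ ρ, (region ε ρs).indicator F (τ, ρ)
          = (Icc 0 (edge ρs τ)).indicator (fun ρ => F (τ, ρ)) ρ := by
        intro ρ
        by_cases h : ρ ∈ Icc 0 (edge ρs τ)
        · rw [indicator_of_mem h, indicator_of_mem]
          exact ⟨hτ.1, hτ.2, h.1, h.2⟩
        · rw [indicator_of_notMem h, indicator_of_notMem]
          exact fun h' => h ⟨h'.2.2.1, h'.2.2.2⟩
      simp only [h1, indicator_of_mem hτ]
      rw [integral_indicator measurableSet_Icc, integral_Icc_eq_integral_Ioc,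
        ← intervalIntegral.integral_of_le hp.le, intervalIntegral.integral_const_mul,
        intervalIntegral.mul_integral_comp_mul_right (f := fun ρ => F (τ, ρ)), zero_mul, one_mul]
    · rw [indicator_of_notMem hτ]
      have h1 : ∀ ρ, (region ε ρs).indicator F (τ, ρ) = 0 := fun ρ =>
        indicator_of_notMem (fun h' => hτ ⟨h'.1, h'.2.1⟩) F
      simp [h1]
  · rw [← Measure.volume_eq_prod]
    exact (integrable_indicator_iff hm).mpr hi

theorem integral_rectangle_swap {a b : ℝ} (hab : a ≤ b) {A : ℝ × ℝ → ℝ}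
    (hA : ContinuousOn A (Icc a b ×ˢ Icc 0 1)) :
    ∫ τ in a..b, ∫ s in (0 : ℝ)..1, A (τ, s) = ∫ s in (0 : ℝ)..1, ∫ τ in a..b, A (τ, s) := by
  refine intervalIntegral_intervalIntegral_swap (F := fun τ s => A (τ, s)) ?_
  rw [uIoc_of_le hab, uIoc_of_le zero_le_one]
  exact (hA.integrableOn_compact (isCompact_Icc.prod isCompact_Icc)).mono_set
    (prod_mono Ioc_subset_Icc_self Ioc_subset_Icc_self)

theorem integral_deriv_slice {a b : ℝ} (hab : a ≤ b) {G A : ℝ → ℝ}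
    (hA : ContinuousOn A (Icc a b))
    (hG : ∀ τ ∈ Icc a b, HasDerivWithinAt G (A τ) (Icc a b) τ) :
    ∫ τ in a..b, A τ = G b - G a := by
  refine intervalIntegral.integral_eq_sub_of_hasDerivAt_of_le hab
    (fun τ hτ => (hG τ hτ).continuousWithinAt) (fun τ hτ => ?_) ?_
  · exact (hG τ (Ioo_subset_Icc_self hτ)).hasDerivAt (Icc_mem_nhds hτ.1 hτ.2)
  · exact hA.intervalIntegrable_of_Icc hab

section

variable {h : ℝ × ℝ → ℝ}

theorem hasDerivWithinAt_straighten_left (hε2 : ε < 2) (hρ : 0 < ρs)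
    (hh : ContDiffOn ℝ 1 h (region ε ρs)) {τ s : ℝ} (hτ : τ ∈ Icc (-1) (-1 + ε))
    (hs : s ∈ Icc (0 : ℝ) 1) :
    HasDerivWithinAt (fun τ => h (τ, s * edge ρs τ))
      (fderivWithin ℝ h (region ε ρs) (τ, s * edge ρs τ) (1, 0)
        + s * (edge ρs τ / (1 - τ))
          * fderivWithin ℝ h (region ε ρs) (τ, s * edge ρs τ) (0, 1))
      (Icc (-1) (-1 + ε)) τ := by
  have hlt : τ < 1 := by have := hτ.2; linarith
  have hd := (hh.differentiableOn one_ne_zero _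
    (straighten_mem hε2 hρ hτ hs)).hasFDerivWithinAt
  have hc : HasDerivWithinAt (fun τ => (τ, s * edge ρs τ)) (1, s * (edge ρs τ / (1 - τ)))
      (Icc (-1) (-1 + ε)) τ :=
    ((hasDerivAt_id τ).prodMk ((hasDerivAt_edge ρs hlt).const_mul s)).hasDerivWithinAt
  have := hd.comp_hasDerivWithinAt τ hc (fun τ' hτ' => straighten_mem hε2 hρ hτ' hs)
  refine this.congr_deriv ?_
  have e : ((1 : ℝ), s * (edge ρs τ / (1 - τ)))
      = (1, 0) + (s * (edge ρs τ / (1 - τ))) • ((0 : ℝ), (1 : ℝ)) := by simp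
  rw [e, map_add, map_smul, smul_eq_mul]

theorem hasDerivWithinAt_straighten_right (hε2 : ε < 2) (hρ : 0 < ρs)
    (hh : ContDiffOn ℝ 1 h (region ε ρs)) {τ s : ℝ} (hτ : τ ∈ Icc (-1) (-1 + ε))
    (hs : s ∈ Icc (0 : ℝ) 1) :
    HasDerivWithinAt (fun s => h (τ, s * edge ρs τ))
      (edge ρs τ * fderivWithin ℝ h (region ε ρs) (τ, s * edge ρs τ) (0, 1))
      (Icc 0 1) s := by
  have hd := (hh.differentiableOn one_ne_zero _
    (straighten_mem hε2 hρ hτ hs)).hasFDerivWithinAt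
  have hc : HasDerivWithinAt (fun s => (τ, s * edge ρs τ)) (0, 1 * edge ρs τ) (Icc 0 1) s :=
    ((hasDerivAt_const s τ).prodMk ((hasDerivAt_id s).mul_const _)).hasDerivWithinAt
  have := hd.comp_hasDerivWithinAt s hc (fun s' hs' => straighten_mem hε2 hρ hτ hs')
  refine this.congr_deriv ?_
  have e : ((0 : ℝ), 1 * edge ρs τ) = edge ρs τ • ((0 : ℝ), (1 : ℝ)) := by simp
  rw [e, map_smul, smul_eq_mul]

theorem continuousOn_comp_straighten (hε2 : ε < 2) (hρ : 0 < ρs) {F : ℝ × ℝ → ℝ}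
    (hF : ContinuousOn F (region ε ρs)) :
    ContinuousOn (fun w : ℝ × ℝ => F (w.1, w.2 * edge ρs w.1))
      (Icc (-1) (-1 + ε) ×ˢ Icc 0 1) :=
  hF.comp (continuousOn_straighten hε2) fun _ hw => straighten_mem hε2 hρ hw.1 hw.2

theorem continuousOn_edge_fst (hε2 : ε < 2) :
    ContinuousOn (fun w : ℝ × ℝ => edge ρs w.1) (Icc (-1) (-1 + ε) ×ˢ Icc (0 : ℝ) 1) :=
  (continuousOn_edge ρs).comp continuousOn_fst fun w hw => by
    have := hw.1.2
    exact (show w.1 < 1 by linarith)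

theorem continuousOn_fderivWithin_region (hε : 0 < ε) (hε2 : ε < 2) (hρ : 0 < ρs)
    (hh : ContDiffOn ℝ 1 h (region ε ρs)) (y : ℝ × ℝ) :
    ContinuousOn (fun z => fderivWithin ℝ h (region ε ρs) z y) (region ε ρs) :=
  (hh.continuousOn_fderivWithin (regularRegion_region hε hε2 hρ).uniqueDiffOn le_rfl).clm_apply
    continuousOn_const

/-- The flux identity for the outgoing field `(1 - τ) ∂_τ + ρ ∂_ρ`. -/
theorem integral_outgoing_ge (hε : 0 < ε) (hε2 : ε < 2) (hρ : 0 < ρs)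
    (hh : ContDiffOn ℝ 1 h (region ε ρs)) (hpos : ∀ z ∈ region ε ρs, 0 ≤ h z) :
    -(2 * ∫ ρ in Icc 0 ρs, h (-1, ρ)) ≤
      ∫ z in region ε ρs, ((1 - z.1) * fderivWithin ℝ h (region ε ρs) z (1, 0)
        + z.2 * fderivWithin ℝ h (region ε ρs) z (0, 1)) := by
  have hab : (-1 : ℝ) ≤ -1 + ε := by linarith
  have hT := continuousOn_fderivWithin_region hε hε2 hρ hh (1, 0)
  have hR := continuousOn_fderivWithin_region hε hε2 hρ hh (0, 1)
  rw [integral_region hε hε2 hρ (by fun_prop)]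
  -- The curves of constant `s` are the integral curves of the outgoing field, and its factor `1 -
  -- τ` times the Jacobian `edge` is the constant `2ρ⋆`. The integrand is thus an exact
  -- `τ`-derivative, `A = ∂_τ (2ρ⋆ h(τ, s · edge τ))`.
  set A : ℝ × ℝ → ℝ := fun w => 2 * ρs *
    (fderivWithin ℝ h (region ε ρs) (w.1, w.2 * edge ρs w.1) (1, 0)
      + w.2 * (edge ρs w.1 / (1 - w.1))
        * fderivWithin ℝ h (region ε ρs) (w.1, w.2 * edge ρs w.1) (0, 1)) with hAdef
  have hA : ContinuousOn A (Icc (-1) (-1 + ε) ×ˢ Icc 0 1) := by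
    have h1 := continuousOn_comp_straighten hε2 hρ hT
    have h2 := continuousOn_comp_straighten hε2 hρ hR
    have h3 := continuousOn_edge_fst (ρs := ρs) hε2
    have h4 : ∀ w ∈ Icc (-1) (-1 + ε) ×ˢ Icc (0 : ℝ) 1, 1 - w.1 ≠ 0 := fun w hw => by
      have := hw.1.2
      linarith
    exact continuousOn_const.mul (h1.add
      ((continuousOn_snd.mul (h3.div (by fun_prop) h4)).mul h2))
  have e1 : ∫ τ in (-1)..(-1 + ε), ∫ s in (0 : ℝ)..1, edge ρs τ *
      ((1 - τ) * fderivWithin ℝ h (region ε ρs) (τ, s * edge ρs τ) (1, 0)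
        + s * edge ρs τ * fderivWithin ℝ h (region ε ρs) (τ, s * edge ρs τ) (0, 1))
      = ∫ τ in (-1)..(-1 + ε), ∫ s in (0 : ℝ)..1, A (τ, s) := by
    refine intervalIntegral.integral_congr fun τ hτ => ?_
    rw [uIcc_of_le hab] at hτ
    refine intervalIntegral.integral_congr fun s _ => ?_
    have : 1 - τ ≠ 0 := by have := hτ.2; linarith
    have e : edge ρs τ * (1 - τ) = 2 * ρs := by rw [edge, div_mul_cancel₀ _ this]
    have e' : edge ρs τ * edge ρs τ = 2 * ρs * (edge ρs τ / (1 - τ)) := by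
      simp only [edge]; field_simp
    simp only [hAdef]
    linear_combination fderivWithin ℝ h (region ε ρs) (τ, s * edge ρs τ) (1, 0) * e
      + s * fderivWithin ℝ h (region ε ρs) (τ, s * edge ρs τ) (0, 1) * e'
  rw [e1, integral_rectangle_swap hab hA]
  have e2 : ∫ s in (0 : ℝ)..1, ∫ τ in (-1)..(-1 + ε), A (τ, s)
      = ∫ s in (0 : ℝ)..1, (2 * ρs * h (-1 + ε, s * edge ρs (-1 + ε))
        - 2 * ρs * h (-1, s * edge ρs (-1))) := by
    refine intervalIntegral.integral_congr fun s hs => ?_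
    rw [uIcc_of_le zero_le_one] at hs
    refine integral_deriv_slice hab (G := fun τ => 2 * ρs * h (τ, s * edge ρs τ)) ?_ ?_
    · exact hA.comp (f := fun τ : ℝ => (τ, s)) (by fun_prop) fun τ hτ => ⟨hτ, hs⟩
    · intro τ hτ
      exact (hasDerivWithinAt_straighten_left hε2 hρ hh hτ hs).const_mul (2 * ρs)
  have hc := continuousOn_comp_straighten hε2 hρ hh.continuousOn
  have hcτ : ∀ τ ∈ Icc (-1) (-1 + ε),
      ContinuousOn (fun s => h (τ, s * edge ρs τ)) (Icc 0 1) := fun τ hτ =>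
    hc.comp (f := fun s : ℝ => (τ, s)) (by fun_prop) fun s hs => ⟨hτ, hs⟩
  have hci : ∀ τ ∈ Icc (-1) (-1 + ε), IntervalIntegrable
      (fun s => 2 * ρs * h (τ, s * edge ρs τ)) volume 0 1 := fun τ hτ =>
    (continuousOn_const.mul (hcτ τ hτ)).intervalIntegrable_of_Icc zero_le_one
  rw [e2, intervalIntegral.integral_sub (hci _ (right_mem_Icc.mpr hab))
    (hci _ (left_mem_Icc.mpr hab))]
  have e3 : ∫ s in (0 : ℝ)..1, 2 * ρs * h (-1, s * edge ρs (-1))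
      = 2 * ∫ ρ in Icc 0 ρs, h (-1, ρ) := by
    simp only [edge_neg_one, mul_assoc]
    rw [intervalIntegral.integral_const_mul, intervalIntegral.integral_const_mul,
      intervalIntegral.mul_integral_comp_mul_right (f := fun ρ => h (-1, ρ)), zero_mul, one_mul,
      intervalIntegral.integral_of_le hρ.le, integral_Icc_eq_integral_Ioc]
  -- The flux through the final slice has the favourable sign and is dropped.
  have e4 : 0 ≤ ∫ s in (0 : ℝ)..1, 2 * ρs * h (-1 + ε, s * edge ρs (-1 + ε)) := by
    refine intervalIntegral.integral_nonneg zero_le_one fun s hs => ?_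
    have := hpos _ (straighten_mem hε2 hρ (right_mem_Icc.mpr hab) hs)
    positivity
  linarith

/-- The flux identity for the incoming field `(1 + τ) ∂_τ - ρ ∂_ρ`. -/
theorem integral_incoming_ge (hε : 0 < ε) (hε2 : ε < 2) (hρ : 0 < ρs)
    (hh : ContDiffOn ℝ 1 h (region ε ρs)) (hpos : ∀ z ∈ region ε ρs, 0 ≤ h z) :
    -∫ τ in Icc (-1) (-1 + ε), 2 * edge ρs τ / (1 - τ) * h (τ, edge ρs τ) ≤
      ∫ z in region ε ρs, ((1 + z.1) * fderivWithin ℝ h (region ε ρs) z (1, 0)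
        - z.2 * fderivWithin ℝ h (region ε ρs) z (0, 1)) := by
  have hab : (-1 : ℝ) ≤ -1 + ε := by linarith
  have hT := continuousOn_fderivWithin_region hε hε2 hρ hh (1, 0)
  have hR := continuousOn_fderivWithin_region hε hε2 hρ hh (0, 1)
  rw [integral_region hε hε2 hρ (by fun_prop)]
  have h1 := continuousOn_comp_straighten hε2 hρ hT
  have h2 := continuousOn_comp_straighten hε2 hρ hR
  have h3 := continuousOn_edge_fst (ρs := ρs) hε2
  have hc := continuousOn_comp_straighten hε2 hρ hh.continuousOn
  have h4 : ∀ w ∈ Icc (-1) (-1 + ε) ×ˢ Icc (0 : ℝ) 1, 1 - w.1 ≠ 0 := fun w hw => by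
    have := hw.1.2
    linarith
  have h5 : ContinuousOn (fun w : ℝ × ℝ => edge ρs w.1 / (1 - w.1))
      (Icc (-1) (-1 + ε) ×ˢ Icc (0 : ℝ) 1) := h3.div (by fun_prop) h4
  -- In straightened coordinates the integrand is the divergence `A - B`, with `A = ∂_τ((1 + τ) edge
  -- · h)` and `B = ∂_s(2 edge/(1 - τ) · s · h)`. The zeroth order terms cancel because `edge + (1 +
  -- τ) edge/(1 - τ) = 2 edge/(1 - τ)`.
  set A : ℝ × ℝ → ℝ := fun w =>
    (edge ρs w.1 + (1 + w.1) * (edge ρs w.1 / (1 - w.1))) * h (w.1, w.2 * edge ρs w.1)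
    + (1 + w.1) * edge ρs w.1 *
    (fderivWithin ℝ h (region ε ρs) (w.1, w.2 * edge ρs w.1) (1, 0)
      + w.2 * (edge ρs w.1 / (1 - w.1))
        * fderivWithin ℝ h (region ε ρs) (w.1, w.2 * edge ρs w.1) (0, 1)) with hAdef
  set B : ℝ × ℝ → ℝ := fun w =>
    2 * (edge ρs w.1 / (1 - w.1)) * h (w.1, w.2 * edge ρs w.1)
    + 2 * (edge ρs w.1 / (1 - w.1)) * w.2 * (edge ρs w.1 *
      fderivWithin ℝ h (region ε ρs) (w.1, w.2 * edge ρs w.1) (0, 1)) with hBdef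
  have hA : ContinuousOn A (Icc (-1) (-1 + ε) ×ˢ Icc 0 1) := by
    exact ((h3.add ((continuousOn_const.add continuousOn_fst).mul h5)).mul hc).add
      (((continuousOn_const.add continuousOn_fst).mul h3).mul
        (h1.add ((continuousOn_snd.mul h5).mul h2)))
  have hB : ContinuousOn B (Icc (-1) (-1 + ε) ×ˢ Icc 0 1) := by
    exact ((continuousOn_const.mul h5).mul hc).add
      (((continuousOn_const.mul h5).mul continuousOn_snd).mul (h3.mul h2))
  have hslice : ∀ {F : ℝ × ℝ → ℝ}, ContinuousOn F (Icc (-1) (-1 + ε) ×ˢ Icc 0 1) →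
      ∀ τ ∈ Icc (-1) (-1 + ε), IntervalIntegrable (fun s => F (τ, s)) volume 0 1 :=
    fun hF τ hτ => (hF.comp (f := fun s : ℝ => (τ, s)) (by fun_prop)
      fun s hs => ⟨hτ, hs⟩).intervalIntegrable_of_Icc zero_le_one
  -- The factor `s` removes the contribution of `ρ = 0`, leaving only the incoming hypersurface `s =
  -- 1`.
  have hBint : ∀ τ ∈ Icc (-1) (-1 + ε),
      ∫ s in (0 : ℝ)..1, B (τ, s) = 2 * edge ρs τ / (1 - τ) * h (τ, edge ρs τ) := by
    intro τ hτ
    rw [integral_deriv_slice zero_le_one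
      (G := fun s => 2 * (edge ρs τ / (1 - τ)) * s * h (τ, s * edge ρs τ))]
    · simp only [mul_one, one_mul, mul_zero, zero_mul, sub_zero, mul_div_assoc]
    · exact hB.comp (f := fun s : ℝ => (τ, s)) (by fun_prop) fun s hs => ⟨hτ, hs⟩
    · intro s hs
      have hd := (((hasDerivAt_id s).const_mul
        (2 * (edge ρs τ / (1 - τ)))).hasDerivWithinAt).fun_mul
        (hasDerivWithinAt_straighten_right hε2 hρ hh hτ hs)
      refine hd.congr_deriv ?_
      simp [hBdef]
  have e1 : ∫ τ in (-1)..(-1 + ε), ∫ s in (0 : ℝ)..1, edge ρs τ *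
      ((1 + τ) * fderivWithin ℝ h (region ε ρs) (τ, s * edge ρs τ) (1, 0)
        - s * edge ρs τ * fderivWithin ℝ h (region ε ρs) (τ, s * edge ρs τ) (0, 1))
      = ∫ τ in (-1)..(-1 + ε), ((∫ s in (0 : ℝ)..1, A (τ, s))
        - 2 * edge ρs τ / (1 - τ) * h (τ, edge ρs τ)) := by
    refine intervalIntegral.integral_congr fun τ hτ => ?_
    rw [uIcc_of_le hab] at hτ
    simp only [← hBint τ hτ]
    rw [← intervalIntegral.integral_sub (hslice hA τ hτ) (hslice hB τ hτ)]
    refine intervalIntegral.integral_congr fun s _ => ?_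
    have : 1 - τ ≠ 0 := by have := hτ.2; linarith
    simp only [hAdef, hBdef]
    field_simp
    ring
  have hedge : ContinuousOn (fun τ => 2 * edge ρs τ / (1 - τ) * h (τ, edge ρs τ))
      (Icc (-1) (-1 + ε)) := by
    have hg : ContinuousOn (fun w : ℝ × ℝ =>
        2 * (edge ρs w.1 / (1 - w.1)) * h (w.1, w.2 * edge ρs w.1))
        (Icc (-1) (-1 + ε) ×ˢ Icc 0 1) := (continuousOn_const.mul h5).mul hc
    have := hg.comp (f := fun τ : ℝ => (τ, 1)) (s := Icc (-1) (-1 + ε)) (by fun_prop)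
      fun τ hτ => ⟨hτ, by simp⟩
    refine this.congr fun τ _ => ?_
    simp only [Function.comp, one_mul, mul_div_assoc]
  have hAint : IntervalIntegrable (fun τ => ∫ s in (0 : ℝ)..1, A (τ, s)) volume (-1) (-1 + ε) := by
    rw [intervalIntegrable_iff_integrableOn_Ioc_of_le hab]
    simp only [intervalIntegral.integral_of_le zero_le_one]
    have : Integrable A ((volume.restrict (Ioc (-1) (-1 + ε))).prod
        (volume.restrict (Ioc (0 : ℝ) 1))) := by
      rw [Measure.prod_restrict, ← Measure.volume_eq_prod]
      exact (hA.integrableOn_compact (isCompact_Icc.prod isCompact_Icc)).mono_set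
        (prod_mono Ioc_subset_Icc_self Ioc_subset_Icc_self)
    exact this.integral_prod_left
  rw [e1, intervalIntegral.integral_sub hAint (hedge.intervalIntegrable_of_Icc hab),
    integral_rectangle_swap hab hA]
  -- The factor `1 + τ` vanishes on past null infinity, so only the nonnegative flux through the
  -- final slice remains.
  have e2 : 0 ≤ ∫ s in (0 : ℝ)..1, ∫ τ in (-1)..(-1 + ε), A (τ, s) := by
    refine intervalIntegral.integral_nonneg zero_le_one fun s hs => ?_
    rw [integral_deriv_slice hab
      (G := fun τ => (1 + τ) * edge ρs τ * h (τ, s * edge ρs τ))]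
    · have := hpos _ (straighten_mem hε2 hρ (right_mem_Icc.mpr hab) hs)
      have hp := edge_pos hρ (show -1 + ε < 1 by linarith)
      have : 0 ≤ (1 + (-1 + ε)) * edge ρs (-1 + ε) * h (-1 + ε, s * edge ρs (-1 + ε)) :=
        mul_nonneg (mul_nonneg (by linarith) hp.le) this
      simpa using this
    · exact hA.comp (f := fun τ : ℝ => (τ, s)) (by fun_prop) fun τ hτ => ⟨hτ, hs⟩
    · intro τ hτ
      have hlt : τ < 1 := by have := hτ.2; linarith
      have hd := ((((hasDerivAt_id τ).const_add 1).fun_mul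
        (hasDerivAt_edge ρs hlt)).hasDerivWithinAt).fun_mul
        (hasDerivWithinAt_straighten_left hε2 hρ hh hτ hs)
      refine hd.congr_deriv ?_
      simp [hAdef]
  rw [intervalIntegral.integral_of_le hab (f := fun τ =>
    2 * edge ρs τ / (1 - τ) * h (τ, edge ρs τ)), ← integral_Icc_eq_integral_Ioc]
  linarith

end

end

/-! ### The energy inequality -/

instance secondCountableTopology_SU2 : SecondCountableTopology SU2 := by
  have : SecondCountableTopology (Matrix (Fin 2) (Fin 2) ℂ) :=
    inferInstanceAs (SecondCountableTopology (Fin 2 → Fin 2 → ℂ))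
  exact TopologicalSpace.Subtype.secondCountableTopology _

theorem integrable_prod_haar {Y : Type*} [TopologicalSpace Y] [MeasurableSpace Y] [BorelSpace Y]
    [T2Space Y] [SecondCountableTopology Y] {μ : Measure Y} [IsFiniteMeasureOnCompacts μ]
    [SFinite μ] {s : Set Y} (hs : IsCompact s) {φ : Y × SU2 → ℝ}
    (hφ : ContinuousOn φ (s ×ˢ Set.univ)) : Integrable φ ((μ.restrict s).prod haarSU2) := by
  have h := hφ.integrableOn_compact (μ := μ.prod haarSU2) (hs.prod isCompact_univ)
  rwa [IntegrableOn, ← Measure.prod_restrict, Measure.restrict_univ] at h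

theorem lintegral_lintegral_haar {Y : Type*} [TopologicalSpace Y] [MeasurableSpace Y]
    [BorelSpace Y] [T2Space Y] [SecondCountableTopology Y] {μ : Measure Y}
    [IsFiniteMeasureOnCompacts μ] [SFinite μ] {s : Set Y} (hs : IsCompact s) {φ : Y → SU2 → ℝ}
    (hφ : ContinuousOn (fun x : Y × SU2 => φ x.1 x.2) (s ×ˢ Set.univ)) (h0 : ∀ y g, 0 ≤ φ y g) :
    ∫⁻ y in s, ∫⁻ g, ENNReal.ofReal (φ y g) ∂haarSU2 ∂μ
      = ENNReal.ofReal (∫ y in s, ∫ g, φ y g ∂haarSU2 ∂μ) := by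
  have hi := integrable_prod_haar (μ := μ) hs hφ
  rw [← integral_prod _ hi, ofReal_integral_eq_lintegral_ofReal hi
    (Filter.Eventually.of_forall fun x => h0 x.1 x.2),
    lintegral_prod _ hi.aestronglyMeasurable.aemeasurable.ennreal_ofReal]

section

variable {ι : Type*} {s : Finset ι} {K : Set (ℝ × ℝ)}

/-- The sum of the squares of a finite family of fields. -/
noncomputable def energy (s : Finset ι) (u : ι → Field) (z : ℝ × ℝ) (g : SU2) : ℝ :=
  ∑ i ∈ s, ‖u i z g‖ ^ 2

theorem energy_nonneg (u : ι → Field) (z : ℝ × ℝ) (g : SU2) : 0 ≤ energy s u z g :=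
  Finset.sum_nonneg fun _ _ => sq_nonneg _

theorem continuousOn_energy {u : ι → Field} {n : ℕ} (hu : ∀ i ∈ s, IsCk n K (u i)) :
    ContinuousOn (fun x : (ℝ × ℝ) × SU2 => energy s u x.1 x.2) (K ×ˢ Set.univ) :=
  continuousOn_finsetSum _ fun i hi => ((hu i hi).continuousOn.norm).pow 2

theorem contDiffOn_energy {u : ι → Field} {n : ℕ} (hu : ∀ i ∈ s, IsCk n K (u i)) (g : SU2) :
    ContDiffOn ℝ n (fun z => energy s u z g) K :=
  ContDiffOn.sum fun i hi => ((hu i hi).slice g).norm_sq ℝ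

theorem fderivWithin_energy (hK : RegularRegion K) {u : ι → Field}
    (hu : ∀ i ∈ s, IsCk 1 K (u i)) {z : ℝ × ℝ} (hz : z ∈ K) (g : SU2) (y : ℝ × ℝ) :
    fderivWithin ℝ (fun z => energy s u z g) K z y
      = ∑ i ∈ s, 2 * (starRingEnd ℂ (u i z g) * fderivWithin ℝ (fun w => u i w g) K z y).re := by
  have h : HasFDerivWithinAt (fun z => energy s u z g) _ K z :=
    HasFDerivWithinAt.fun_sum fun i hi =>
      ((hu i hi).differentiableWithinAt (n := 0) hz g).hasFDerivWithinAt.norm_sq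
  rw [h.fderivWithin (hK.uniqueDiffOn z hz)]
  simp [Complex.inner, mul_comm, mul_add]

/-- The derivative of the energy along `(1 + d τ) ∂_τ + e ρ ∂_ρ`. -/
noncomputable def energyFlux (K : Set (ℝ × ℝ)) (s : Finset ι) (d e : ℝ) (u : ι → Field)
    (z : ℝ × ℝ) (g : SU2) : ℝ :=
  ∑ i ∈ s, 2 * (starRingEnd ℂ (u i z g)
    * ((1 + d * z.1) • dTau K (u i) z g + (e * z.2) • dRho K (u i) z g)).re

theorem energyFlux_eq (hK : RegularRegion K) {u : ι → Field}
    (hu : ∀ i ∈ s, IsCk 1 K (u i)) (d e : ℝ) {z : ℝ × ℝ} (hz : z ∈ K) (g : SU2) :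
    energyFlux K s d e u z g
      = (1 + d * z.1) * fderivWithin ℝ (fun z => energy s u z g) K z (1, 0)
        + (e * z.2) * fderivWithin ℝ (fun z => energy s u z g) K z (0, 1) := by
  rw [fderivWithin_energy hK hu hz, fderivWithin_energy hK hu hz, Finset.mul_sum, Finset.mul_sum,
    ← Finset.sum_add_distrib]
  refine Finset.sum_congr rfl fun i _ => ?_
  change _ = (1 + d * z.1) * (2 * (starRingEnd ℂ (u i z g) * dTau K (u i) z g).re)
    + (e * z.2) * (2 * (starRingEnd ℂ (u i z g) * dRho K (u i) z g).re)
  rw [mul_add, mul_smul_comm, mul_smul_comm, Complex.add_re, Complex.smul_re, Complex.smul_re,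
    smul_eq_mul, smul_eq_mul]
  ring

theorem continuousOn_energyFlux (hK : RegularRegion K) {u : ι → Field}
    (hu : ∀ i ∈ s, IsCk 1 K (u i)) (d e : ℝ) :
    ContinuousOn (fun x : (ℝ × ℝ) × SU2 => energyFlux K s d e u x.1 x.2) (K ×ˢ Set.univ) := by
  refine continuousOn_finsetSum _ fun i hi => continuousOn_const.mul
    (Complex.continuous_re.comp_continuousOn ?_)
  have h0 := (hu i hi).continuousOn
  have h1 := (IsCk.dTau (n := 0) hK (hu i hi)).continuousOn
  have h2 := (IsCk.dRho (n := 0) hK (hu i hi)).continuousOn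
  have h3 : Continuous fun x : (ℝ × ℝ) × SU2 => 1 + d * x.1.1 := by fun_prop
  have h4 : Continuous fun x : (ℝ × ℝ) × SU2 => e * x.1.2 := by fun_prop
  exact (Complex.continuous_conj.comp_continuousOn h0).mul
    ((h3.continuousOn.smul h1).add (h4.continuousOn.smul h2))

theorem two_mul_re_le (x y : ℂ) {δ : ℝ} (hδ : 0 < δ) :
    2 * (starRingEnd ℂ x * y).re ≤ δ * ‖x‖ ^ 2 + δ⁻¹ * ‖y‖ ^ 2 := by
  have h1 : (starRingEnd ℂ x * y).re ≤ ‖x‖ * ‖y‖ := by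
    refine (Complex.re_le_norm _).trans_eq ?_
    rw [norm_mul, Complex.norm_conj]
  have h2 : 0 ≤ δ⁻¹ * (δ * ‖x‖ - ‖y‖) ^ 2 := by positivity
  have h3 : δ⁻¹ * (δ * ‖x‖ - ‖y‖) ^ 2
      = δ * ‖x‖ ^ 2 + δ⁻¹ * ‖y‖ ^ 2 - 2 * (‖x‖ * ‖y‖) := by
    field_simp
    ring
  linarith

/-- The constant in the energy inequality, for commutator terms bounded by `B`, a family of `n`
fields and lower order coefficients bounded by `A`. -/
noncomputable def energyConst (n : ℕ) (A B : ℝ) : ℝ := 4 * (n * B) + 2 * A + 4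

/-- Pointwise form of the energy identity. The zeroth order terms contribute `-2a‖u‖² + 2(1 +
a)‖w‖²`, so `a ≥ 1` leaves room to absorb the commutators and still keep `-‖u‖²`. The cross terms
are left untouched, since they cancel only after integration over `SU(2)`. -/
theorem energyFlux_add_le {u w c d : ι → Field} {a : ι → ℝ} {A B : ℝ} (hB : 0 ≤ B)
    (ha : ∀ i ∈ s, 1 ≤ a i ∧ a i ≤ A)
    (hu : ∀ i ∈ s, Transports K 1 1 (-1) (a i) (u i)
      (fun z g => xField (-1) Complex.I (w i) z g + c i z g))
    (hw : ∀ i ∈ s, Transports K 1 (-1) 1 (-1 - a i) (w i)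
      (fun z g => xField (-1) (-Complex.I) (u i) z g + d i z g))
    (hc : ∀ i ∈ s, ∀ z ∈ K, ∀ g, ‖c i z g‖ ^ 2 ≤ B * energy s w z g)
    (hd : ∀ i ∈ s, ∀ z ∈ K, ∀ g, ‖d i z g‖ ^ 2 ≤ B * energy s u z g)
    {z : ℝ × ℝ} (hz : z ∈ K) (g : SU2) :
    energyFlux K s 1 (-1) u z g + energyFlux K s (-1) 1 w z g
      ≤ 2 * ∑ i ∈ s, ((starRingEnd ℂ (u i z g) * xOp (-1) Complex.I (w i z) g).re
          + (starRingEnd ℂ (w i z g) * xOp (-1) (-Complex.I) (u i z) g).re)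
        - energy s u z g + energyConst s.card A B * energy s w z g := by
  set n : ℝ := (s.card : ℝ) with hn
  have hn0 : 0 ≤ n := Nat.cast_nonneg _
  set Eu := energy s u z g with hEu
  set Ew := energy s w z g with hEw
  have hEu0 : 0 ≤ Eu := energy_nonneg u z g
  have hEw0 : 0 ≤ Ew := energy_nonneg w z g
  -- Chosen so that `n B / δ ≤ 1/2`: the commutators `d`, bounded by the `u`-energy, use up one half
  -- of the damping. The commutators `c` use another half through the weight `1/2` in `b1`, so of
  -- the coefficient `-2` there remains `-1`.
  set δ : ℝ := 2 * (n * B + 1) with hδ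
  have hδ0 : 0 < δ := by positivity
  have hterm : ∀ i ∈ s,
      2 * (starRingEnd ℂ (u i z g)
        * ((1 + 1 * z.1) • dTau K (u i) z g + (-1 * z.2) • dRho K (u i) z g)).re
      + 2 * (starRingEnd ℂ (w i z g)
        * ((1 + -1 * z.1) • dTau K (w i) z g + (1 * z.2) • dRho K (w i) z g)).re
      ≤ 2 * ((starRingEnd ℂ (u i z g) * xOp (-1) Complex.I (w i z) g).re
          + (starRingEnd ℂ (w i z g) * xOp (-1) (-Complex.I) (u i z) g).re)
        + (-(3 / 2) * ‖u i z g‖ ^ 2 + (2 * (1 + A) + δ) * ‖w i z g‖ ^ 2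
          + (2 * (B * Ew) + δ⁻¹ * (B * Eu))) := by
    intro i hi
    have e1 := congrFun (hu i hi z hz) g
    have e2 := congrFun (hw i hi z hz) g
    simp only [xField] at e1 e2
    rw [← eq_sub_iff_add_eq] at e1 e2
    rw [e1, e2]
    have n1 : ∀ x : ℂ, (starRingEnd ℂ x * x).re = ‖x‖ ^ 2 := fun x => by
      rw [mul_comm, Complex.mul_conj, Complex.ofReal_re, Complex.normSq_eq_norm_sq]
    have b1 := two_mul_re_le (u i z g) (c i z g) (δ := 1 / 2) (by norm_num)
    have b2 := two_mul_re_le (w i z g) (d i z g) hδ0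
    have b3 : δ⁻¹ * ‖d i z g‖ ^ 2 ≤ δ⁻¹ * (B * Eu) := by
      gcongr
      exact hd i hi z hz g
    have b4 := hc i hi z hz g
    obtain ⟨a1, a2⟩ := ha i hi
    have b5 : 1 * ‖u i z g‖ ^ 2 ≤ a i * ‖u i z g‖ ^ 2 := by gcongr
    have b6 : a i * ‖w i z g‖ ^ 2 ≤ A * ‖w i z g‖ ^ 2 := by gcongr
    simp only [mul_sub, mul_add, mul_smul_comm, Complex.sub_re, Complex.add_re, Complex.smul_re,
      smul_eq_mul, n1]
    rw [show ((1 : ℝ) / 2)⁻¹ = 2 by norm_num] at b1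
    linarith
  have hsum := Finset.sum_le_sum hterm
  rw [Finset.sum_add_distrib, Finset.sum_add_distrib, Finset.sum_add_distrib,
    Finset.sum_add_distrib, ← Finset.mul_sum, ← Finset.mul_sum, ← Finset.mul_sum,
    Finset.sum_const, nsmul_eq_mul, ← hn] at hsum
  have hδB : n * (δ⁻¹ * (B * Eu)) ≤ 1 / 2 * Eu := by
    have : n * (δ⁻¹ * (B * Eu)) = (n * B) / δ * Eu := by
      field_simp
    rw [this]
    refine mul_le_mul_of_nonneg_right ?_ hEu0
    rw [div_le_iff₀ hδ0]
    linarith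
  rw [energyFlux, energyFlux, ← Finset.mul_sum, ← Finset.mul_sum]
  refine hsum.trans ?_
  rw [← Finset.mul_sum, ← Finset.mul_sum]
  change _ + (-(3 / 2) * Eu + (2 * (1 + A) + δ) * Ew + n * (2 * (B * Ew) + δ⁻¹ * (B * Eu))) ≤ _
  rw [energyConst, hδ]
  nlinarith [hδB]

end

section

variable {ι : Type*} {s : Finset ι} {ε ρs : ℝ}

/-- The total flux is bounded below by minus the data, for each fixed `g`, and above by minus the
`u`-energy plus a multiple of the `w`-energy, for each fixed `(τ, ρ)`. Comparing the two bounds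
gives the estimate; the constant involves neither `ε` nor `ρ⋆`. -/
theorem energy_inequality (hε : 0 < ε) (hε2 : ε < 2) (hρ : 0 < ρs)
    {u w c d : ι → Field} {a : ι → ℝ} {A B : ℝ} (hB : 0 ≤ B)
    (ha : ∀ i ∈ s, 1 ≤ a i ∧ a i ≤ A)
    (hu1 : ∀ i ∈ s, IsCk 1 (region ε ρs) (u i)) (hw1 : ∀ i ∈ s, IsCk 1 (region ε ρs) (w i))
    (hu : ∀ i ∈ s, Transports (region ε ρs) 1 1 (-1) (a i) (u i)
      (fun z g => xField (-1) Complex.I (w i) z g + c i z g))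
    (hw : ∀ i ∈ s, Transports (region ε ρs) 1 (-1) 1 (-1 - a i) (w i)
      (fun z g => xField (-1) (-Complex.I) (u i) z g + d i z g))
    (hc : ∀ i ∈ s, ∀ z ∈ region ε ρs, ∀ g, ‖c i z g‖ ^ 2 ≤ B * energy s w z g)
    (hd : ∀ i ∈ s, ∀ z ∈ region ε ρs, ∀ g, ‖d i z g‖ ^ 2 ≤ B * energy s u z g) :
    ∫ z in region ε ρs, ∫ g, energy s u z g ∂haarSU2
      ≤ energyConst s.card A B * (∫ z in region ε ρs, ∫ g, energy s w z g ∂haarSU2)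
        + (∫ τ in Icc (-1) (-1 + ε), ∫ g, 2 * edge ρs τ / (1 - τ)
            * energy s u (τ, edge ρs τ) g ∂haarSU2)
        + 2 * ∫ ρ in Icc 0 ρs, ∫ g, energy s w (-1, ρ) g ∂haarSU2 := by
  set K := region ε ρs with hKdef
  have hK : RegularRegion K := regularRegion_region hε hε2 hρ
  have hKc : IsCompact K := isCompact_region hε2 hρ
  set C := energyConst s.card A B with hC
  have hab : (-1 : ℝ) ≤ -1 + ε := by linarith
  have cEu := continuousOn_energy hu1
  have cEw := continuousOn_energy hw1
  have cFu := continuousOn_energyFlux hK hu1 1 (-1)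
  have cFw := continuousOn_energyFlux hK hw1 (-1) 1
  have iEu := integrable_prod_haar (μ := volume) hKc cEu
  have iEw := integrable_prod_haar (μ := volume) hKc cEw
  have iFu := integrable_prod_haar (μ := volume) hKc cFu
  have iFw := integrable_prod_haar (μ := volume) hKc cFw
  have hedge_mem : ∀ τ ∈ Icc (-1) (-1 + ε), (τ, edge ρs τ) ∈ K := fun τ hτ => by
    simpa using straighten_mem hε2 hρ hτ (right_mem_Icc.mpr zero_le_one)
  have hscri_mem : ∀ ρ ∈ Icc 0 ρs, ((-1 : ℝ), ρ) ∈ K := fun ρ hρ' =>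
    ⟨le_rfl, hab, hρ'.1, by rw [edge_neg_one]; exact hρ'.2⟩
  have cedge : ContinuousOn (edge ρs) (Icc (-1) (-1 + ε)) :=
    (continuousOn_edge ρs).mono fun τ hτ => by
      have := hτ.2
      exact (show τ < 1 by linarith)
  have cB : ContinuousOn (fun x : ℝ × SU2 => 2 * edge ρs x.1 / (1 - x.1)
      * energy s u (x.1, edge ρs x.1) x.2) (Icc (-1) (-1 + ε) ×ˢ Set.univ) := by
    have h1 : ContinuousOn (fun x : ℝ × SU2 => edge ρs x.1) (Icc (-1) (-1 + ε) ×ˢ Set.univ) :=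
      cedge.comp continuousOn_fst fun x hx => hx.1
    have h2 : ContinuousOn (fun x : ℝ × SU2 => energy s u (x.1, edge ρs x.1) x.2)
        (Icc (-1) (-1 + ε) ×ˢ Set.univ) :=
      cEu.comp (f := fun x : ℝ × SU2 => ((x.1, edge ρs x.1), x.2))
        ((continuousOn_fst.prodMk h1).prodMk continuousOn_snd)
        fun x hx => mk_mem_prod (hedge_mem x.1 hx.1) (mem_univ x.2)
    refine ((continuousOn_const.mul h1).div (continuousOn_const.sub continuousOn_fst) ?_).mul h2
    intro x hx
    have h3 : x.1 ≤ -1 + ε := hx.1.2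
    have h4 : 1 - x.1 ≠ 0 := by linarith
    exact h4
  have cS : ContinuousOn (fun x : ℝ × SU2 => energy s w (-1, x.1) x.2)
      (Icc 0 ρs ×ˢ Set.univ) :=
    cEw.comp (f := fun x : ℝ × SU2 => ((-1, x.1), x.2))
      ((continuousOn_const.prodMk continuousOn_fst).prodMk continuousOn_snd)
      fun x hx => mk_mem_prod (hscri_mem x.1 hx.1) (mem_univ x.2)
  have iB := integrable_prod_haar (μ := volume) isCompact_Icc cB
  have iS := integrable_prod_haar (μ := volume) isCompact_Icc cS
  have iBr : Integrable (fun g => -∫ τ in Icc (-1) (-1 + ε), 2 * edge ρs τ / (1 - τ)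
    * energy s u (τ, edge ρs τ) g) haarSU2 := iB.integral_prod_right.neg
  have iSr : Integrable (fun g => 2 * ∫ ρ in Icc 0 ρs, energy s w (-1, ρ) g) haarSU2 :=
    iS.integral_prod_right.const_mul 2
  have iFur : Integrable (fun g => ∫ z in K, energyFlux K s 1 (-1) u z g) haarSU2 :=
    iFu.integral_prod_right
  have iFwr : Integrable (fun g => ∫ z in K, energyFlux K s (-1) 1 w z g) haarSU2 :=
    iFw.integral_prod_right
  have iEul : IntegrableOn (fun z => -∫ g, energy s u z g ∂haarSU2) K := iEu.integral_prod_left.neg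
  have iEwl : IntegrableOn (fun z => C * ∫ g, energy s w z g ∂haarSU2) K :=
    iEw.integral_prod_left.const_mul C
  have iFul : IntegrableOn (fun z => ∫ g, energyFlux K s 1 (-1) u z g ∂haarSU2) K :=
    iFu.integral_prod_left
  have iFwl : IntegrableOn (fun z => ∫ g, energyFlux K s (-1) 1 w z g ∂haarSU2) K :=
    iFw.integral_prod_left
  have hlow : ∀ g, -(∫ τ in Icc (-1) (-1 + ε), 2 * edge ρs τ / (1 - τ)
        * energy s u (τ, edge ρs τ) g) - 2 * ∫ ρ in Icc 0 ρs, energy s w (-1, ρ) g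
      ≤ (∫ z in K, energyFlux K s 1 (-1) u z g) + ∫ z in K, energyFlux K s (-1) 1 w z g := by
    intro g
    have h1 := integral_incoming_ge hε hε2 hρ (contDiffOn_energy hu1 g)
      fun z _ => energy_nonneg u z g
    have h2 := integral_outgoing_ge hε hε2 hρ (contDiffOn_energy hw1 g)
      fun z _ => energy_nonneg w z g
    have e1 : ∫ z in K, energyFlux K s 1 (-1) u z g = _ :=
      setIntegral_congr_fun hKc.measurableSet fun z hz => energyFlux_eq hK hu1 1 (-1) hz g
    have e2 : ∫ z in K, energyFlux K s (-1) 1 w z g = _ :=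
      setIntegral_congr_fun hKc.measurableSet fun z hz => energyFlux_eq hK hw1 (-1) 1 hz g
    rw [e1, e2]
    simp only [one_mul, neg_mul, ← sub_eq_add_neg]
    linarith
  have hlow' := integral_mono (μ := haarSU2)
    (iBr.sub iSr)
    (iFur.add iFwr) hlow
  simp only [Pi.sub_apply, Pi.add_apply] at hlow'
  have hup : (∫ z in K, ∫ g, energyFlux K s 1 (-1) u z g ∂haarSU2)
        + (∫ z in K, ∫ g, energyFlux K s (-1) 1 w z g ∂haarSU2)
      ≤ -(∫ z in K, ∫ g, energy s u z g ∂haarSU2)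
        + C * ∫ z in K, ∫ g, energy s w z g ∂haarSU2 := by
    rw [← integral_add iFul iFwl, ← integral_neg,
      ← integral_const_mul,
      ← integral_add iEul iEwl]
    refine setIntegral_mono_on (iFul.add iFwl)
      (iEul.add iEwl)
      hKc.measurableSet fun z hz => ?_
    have hcont : ∀ φ : ℝ × ℝ → SU2 → ℝ,
        ContinuousOn (fun x : (ℝ × ℝ) × SU2 => φ x.1 x.2) (K ×ˢ Set.univ) →
        Integrable (fun g => φ z g) haarSU2 := fun _ hφ =>
      integrable_of_continuous (hφ.comp_continuous (f := fun g : SU2 => (z, g))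
        (continuous_const.prodMk continuous_id) fun _ => ⟨hz, mem_univ _⟩)
    have hr : ∀ i ∈ s, Integrable (fun g =>
        (starRingEnd ℂ (u i z g) * xOp (-1) Complex.I (w i z) g).re
          + (starRingEnd ℂ (w i z g) * xOp (-1) (-Complex.I) (u i z) g).re) haarSU2 := by
      intro i hi
      have hu' := (hu1 i hi).fiber hz
      have hw' := (hw1 i hi).fiber hz
      exact integrable_of_continuous ((Complex.continuous_re.comp
        ((Complex.continuous_conj.comp hu'.continuous).mul (continuous_xOp hw'))).add
        (Complex.continuous_re.comp
        ((Complex.continuous_conj.comp hw'.continuous).mul (continuous_xOp hu'))))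
    have hr0 : ∫ g, ∑ i ∈ s, ((starRingEnd ℂ (u i z g) * xOp (-1) Complex.I (w i z) g).re
          + (starRingEnd ℂ (w i z g) * xOp (-1) (-Complex.I) (u i z) g).re) ∂haarSU2 = 0 := by
      rw [integral_finsetSum _ hr]
      exact Finset.sum_eq_zero fun i hi =>
        integral_xOp_adjoint ((hu1 i hi).fiber hz) ((hw1 i hi).fiber hz)
    have hR := (integrable_finsetSum s hr).const_mul 2
    have jFu : Integrable (fun g => energyFlux K s 1 (-1) u z g) haarSU2 := hcont (energyFlux K s 1 (-1) u) cFu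
    have jFw : Integrable (fun g => energyFlux K s (-1) 1 w z g) haarSU2 := hcont (energyFlux K s (-1) 1 w) cFw
    have jEu : Integrable (fun g => energy s u z g) haarSU2 := hcont (energy s u) cEu
    have jEw : Integrable (fun g => C * energy s w z g) haarSU2 := (hcont (energy s w) cEw).const_mul C
    have jF : Integrable (fun g => energyFlux K s 1 (-1) u z g + energyFlux K s (-1) 1 w z g)
      haarSU2 := jFu.add jFw
    have jR : Integrable (fun g => 2 * ∑ i ∈ s,
        ((starRingEnd ℂ (u i z g) * xOp (-1) Complex.I (w i z) g).re
          + (starRingEnd ℂ (w i z g) * xOp (-1) (-Complex.I) (u i z) g).re)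
        - energy s u z g) haarSU2 := hR.sub jEu
    calc (∫ g, energyFlux K s 1 (-1) u z g ∂haarSU2)
          + ∫ g, energyFlux K s (-1) 1 w z g ∂haarSU2
        = ∫ g, (energyFlux K s 1 (-1) u z g + energyFlux K s (-1) 1 w z g) ∂haarSU2 :=
          (integral_add jFu jFw).symm
      _ ≤ ∫ g, (2 * ∑ i ∈ s, ((starRingEnd ℂ (u i z g) * xOp (-1) Complex.I (w i z) g).re
          + (starRingEnd ℂ (w i z g) * xOp (-1) (-Complex.I) (u i z) g).re)
        - energy s u z g + C * energy s w z g) ∂haarSU2 :=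
          integral_mono jF
            (jR.add jEw)
            fun g => energyFlux_add_le hB ha hu hw hc hd hz g
      _ = -(∫ g, energy s u z g ∂haarSU2) + C * ∫ g, energy s w z g ∂haarSU2 := by
          rw [integral_add jR jEw,
            integral_sub hR jEu, integral_const_mul, integral_const_mul, hr0]
          ring
  -- The lower bound integrates over `(τ, ρ)` first and the upper bound over `SU(2)` first; Fubini
  -- matches them.
  have sB := integral_integral_swap (f := fun τ g => 2 * edge ρs τ / (1 - τ)
    * energy s u (τ, edge ρs τ) g) iB
  have sS := integral_integral_swap (f := fun ρ g => energy s w (-1, ρ) g) iS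
  have sFu := integral_integral_swap (f := energyFlux K s 1 (-1) u) iFu
  have sFw := integral_integral_swap (f := energyFlux K s (-1) 1 w) iFw
  rw [integral_sub iBr iSr,
    integral_neg, integral_const_mul, integral_add iFur
      iFwr] at hlow'
  linarith

end

/-! ### Linearity of the derivatives -/

section

variable {K : Set (ℝ × ℝ)} {f f' : Field}

theorem fderivWithin_slice_linear (hK : RegularRegion K) (hf : IsCk 1 K f) (hf' : IsCk 1 K f')
    (c : ℂ) {z : ℝ × ℝ} (hz : z ∈ K) (g : SU2) (y : ℝ × ℝ) :
    fderivWithin ℝ (fun w => f w g + c * f' w g) K z y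
      = fderivWithin ℝ (fun w => f w g) K z y + c * fderivWithin ℝ (fun w => f' w g) K z y := by
  have h1 := (hf.differentiableWithinAt (n := 0) hz g).hasFDerivWithinAt
  have h0 := (hf'.differentiableWithinAt (n := 0) hz g).hasFDerivWithinAt
  have h := (h1.fun_add (h0.fun_const_smul c)).fderivWithin (hK.uniqueDiffOn z hz)
  exact (congrArg (fun L : ℝ × ℝ →L[ℝ] ℂ => L y) h).trans (by simp)

theorem dTau_linear (hK : RegularRegion K) (hf : IsCk 1 K f) (hf' : IsCk 1 K f') (c : ℂ) :
    EqF K (dTau K fun z g => f z g + c * f' z g) fun z g => dTau K f z g + c * dTau K f' z g :=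
  fun _ hz => funext fun g => fderivWithin_slice_linear hK hf hf' c hz g _

theorem dRho_linear (hK : RegularRegion K) (hf : IsCk 1 K f) (hf' : IsCk 1 K f') (c : ℂ) :
    EqF K (dRho K fun z g => f z g + c * f' z g) fun z g => dRho K f z g + c * dRho K f' z g :=
  fun _ hz => funext fun g => fderivWithin_slice_linear hK hf hf' c hz g _

theorem FirstOrder.iterate_linear {A : Field → Field} (hA : FirstOrder K A) (c : ℂ)
    (hlin : ∀ f f', IsCk 1 K f → IsCk 1 K f' →
      EqF K (A fun z g => f z g + c * f' z g) fun z g => A f z g + c * A f' z g) {n : ℕ}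
    (hf : IsCk n K f) (hf' : IsCk n K f') :
    EqF K (A^[n] fun z g => f z g + c * f' z g) fun z g => A^[n] f z g + c * A^[n] f' z g := by
  induction n generalizing f f' with
  | zero => exact EqF.refl _ _
  | succ n ih =>
    exact (hA.iterate_congr n (hlin f f' (hf.of_le (by omega)) (hf'.of_le (by omega)))).trans
      (ih (hA.reg hf) (hA.reg hf'))

theorem Zpow_linear {α : Fin 3 → ℕ} (hf : IsCk (∑ l, α l) K f) (hf' : IsCk (∑ l, α l) K f')
    (c : ℂ) :
    EqF K (Zpow α fun z g => f z g + c * f' z g) fun z g => Zpow α f z g + c * Zpow α f' z g :=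
  fun z hz => by
    rw [Zpow_apply]
    change zMono α (f z + c • f' z) = _
    rw [zMono_add (hf.fiber hz) ((hf'.fiber hz).smul c), zMono_smul]
    funext g
    simp only [Zpow_apply]
    rfl

/-- The derivative `∂_ρ^{p + p'} ∂_τ^{q + q'}` followed by `Z^α`, for `x = (q', p', α)`. -/
noncomputable def jet (K : Set (ℝ × ℝ)) (p q : ℕ) (f : Field) (x : ℕ × ℕ × (Fin 3 → ℕ)) : Field :=
  Zpow x.2.2 ((dRho K)^[p + x.2.1] ((dTau K)^[q + x.1] f))

theorem IsCk.jet (hK : RegularRegion K) {m p q : ℕ} (hf : IsCk (m + p + q + 1) K f)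
    {x : ℕ × ℕ × (Fin 3 → ℕ)} (hx : x ∈ mho m) : IsCk 1 K (jet K p q f x) := by
  rw [mem_mho] at hx
  exact IsCk.Zpow hK (IsCk.mixed hK (hf.of_le (by omega)))

theorem jet_linear (hK : RegularRegion K) {m p q : ℕ} (hf : IsCk (m + p + q + 1) K f)
    (hf' : IsCk (m + p + q + 1) K f') (c : ℂ) {x : ℕ × ℕ × (Fin 3 → ℕ)} (hx : x ∈ mho m) :
    EqF K (jet K p q (fun z g => f z g + c * f' z g) x)
      fun z g => jet K p q f x z g + c * jet K p q f' x z g := by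
  rw [mem_mho] at hx
  have hT := firstOrder_dTau hK
  have hR := firstOrder_dRho hK
  have h1 := hT.iterate_linear c (fun _ _ h h' => dTau_linear hK h h' c) (n := q + x.1)
    (hf.of_le (by omega)) (hf'.of_le (by omega))
  have h2 := hR.iterate_linear c (fun _ _ h h' => dRho_linear hK h h' c) (n := p + x.2.1)
    (hT.iterate_reg (k := q + x.1) (hf.of_le (by omega)))
    (hT.iterate_reg (k := q + x.1) (hf'.of_le (by omega)))
  have h3 := Zpow_linear (α := x.2.2)
    (IsCk.mixed hK (P := p + x.2.1) (Q := q + x.1) (hf.of_le (by omega)))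
    (IsCk.mixed hK (P := p + x.2.1) (Q := q + x.1) (hf'.of_le (by omega))) c
  exact (((hR.iterate_congr _ h1).trans h2).Zpow _).trans h3

/-- Jets are linear, and `|x + y/2|² ≤ 2|x|² + |y|²`. This passes bounds for `ψ₁` and `ψ` to the
combination `ψ₁ + ψ/2`. -/
theorem energy_jet_linear_le (hK : RegularRegion K) {m p q : ℕ} (hf : IsCk (m + p + q + 1) K f)
    (hf' : IsCk (m + p + q + 1) K f') {z : ℝ × ℝ} (hz : z ∈ K) (g : SU2) :
    energy (mho m) (jet K p q fun z g => f z g + 1 / 2 * f' z g) z g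
      ≤ 2 * energy (mho m) (jet K p q f) z g + energy (mho m) (jet K p q f') z g := by
  simp only [energy]
  rw [Finset.mul_sum, ← Finset.sum_add_distrib]
  refine Finset.sum_le_sum fun x hx => ?_
  rw [congrFun (jet_linear hK hf hf' (1 / 2) hx z hz) g]
  have h1 : ‖jet K p q f x z g + 1 / 2 * jet K p q f' x z g‖
      ≤ ‖jet K p q f x z g‖ + 1 / 2 * ‖jet K p q f' x z g‖ := by
    refine (norm_add_le _ _).trans_eq ?_
    rw [norm_mul]
    norm_num
  have h2 := norm_nonneg (jet K p q f x z g + 1 / 2 * jet K p q f' x z g)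
  nlinarith [sq_nonneg (‖jet K p q f x z g‖ - 1 / 2 * ‖jet K p q f' x z g‖),
    norm_nonneg (jet K p q f x z g), norm_nonneg (jet K p q f' x z g)]

/-! ### The norms as integrals of energies -/

theorem continuousOn_weighted_energy {ι Y : Type*} {s : Finset ι} [TopologicalSpace Y]
    {t : Set Y} {γ : Y → ℝ × ℝ} (hγ : ContinuousOn γ t) (hγK : MapsTo γ t K) {δ : Y → ℝ}
    (hδ : ContinuousOn δ t) {u : ι → Field} {n : ℕ} (hu : ∀ i ∈ s, IsCk n K (u i)) :
    ContinuousOn (fun x : Y × SU2 => max (δ x.1) 0 * energy s u (γ x.1) x.2)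
      (t ×ˢ Set.univ) := by
  have h1 : ContinuousOn (fun x : Y × SU2 => γ x.1) (t ×ˢ Set.univ) :=
    hγ.comp continuousOn_fst fun x hx => hx.1
  have h2 : ContinuousOn (fun x : Y × SU2 => δ x.1) (t ×ˢ Set.univ) :=
    hδ.comp continuousOn_fst fun x hx => hx.1
  exact ((continuous_id.max continuous_const).comp_continuousOn h2).mul ((continuousOn_energy hu).comp
    (f := fun x : Y × SU2 => (γ x.1, x.2)) (h1.prodMk continuousOn_snd)
    fun x hx => mk_mem_prod (hγK hx.1) (mem_univ x.2))

/-- One conversion from extended nonnegative integrals to real integrals of `energy`, serving the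
bulk norm and both data norms through the choice of `γ` and `δ`. The weight is `max (δ y) 0` because
`ENNReal.ofReal` truncates negative values. -/
theorem sum_lintegral_eq {ι Y : Type*} {s : Finset ι} [TopologicalSpace Y] [MeasurableSpace Y]
    [BorelSpace Y] [T2Space Y] [SecondCountableTopology Y] {μ : Measure Y}
    [IsFiniteMeasureOnCompacts μ] [SFinite μ] {t : Set Y} (ht : IsCompact t) {γ : Y → ℝ × ℝ}
    (hγ : ContinuousOn γ t) (hγK : MapsTo γ t K) {δ : Y → ℝ} (hδ : ContinuousOn δ t)
    {u F : ι → Field} {n : ℕ} (hu : ∀ i ∈ s, IsCk n K (u i)) (hF : ∀ i ∈ s, EqF K (F i) (u i)) :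
    ∑ i ∈ s, ∫⁻ y in t, ENNReal.ofReal (δ y) * ∫⁻ g, ‖F i (γ y) g‖ₑ ^ 2 ∂haarSU2 ∂μ
      = ENNReal.ofReal
        (∫ y in t, ∫ g, max (δ y) 0 * energy s u (γ y) g ∂haarSU2 ∂μ) := by
  set φ : ι → Y → SU2 → ℝ := fun i y g => max (δ y) 0 * energy {i} u (γ y) g with hφ
  have h0 : ∀ i y g, 0 ≤ φ i y g := fun i y g =>
    mul_nonneg (le_max_right _ _) (energy_nonneg _ _ _)
  have hc : ∀ i ∈ s, ContinuousOn (fun x : Y × SU2 => φ i x.1 x.2) (t ×ˢ Set.univ) := fun i hi =>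
    continuousOn_weighted_energy hγ hγK hδ (s := {i}) fun j hj => by
      rw [Finset.mem_singleton.mp hj]
      exact hu i hi
  have h1 : ∀ i ∈ s, ∫⁻ y in t, ENNReal.ofReal (δ y) * ∫⁻ g, ‖F i (γ y) g‖ₑ ^ 2 ∂haarSU2 ∂μ
      = ENNReal.ofReal (∫ y in t, ∫ g, φ i y g ∂haarSU2 ∂μ) := by
    intro i hi
    rw [← lintegral_lintegral_haar ht (hc i hi) (h0 i)]
    refine setLIntegral_congr_fun ht.measurableSet fun y hy => ?_
    rw [← lintegral_const_mul' _ _ ENNReal.ofReal_ne_top]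
    refine lintegral_congr fun g => ?_
    simp only [hφ, energy, Finset.sum_singleton]
    rw [hF i hi _ (hγK hy), ENNReal.ofReal_mul (le_max_right _ _),
      ENNReal.ofReal_pow (norm_nonneg _), ofReal_norm]
    congr 1
    rcases le_total (δ y) 0 with h | h
    · rw [max_eq_right h, ENNReal.ofReal_of_nonpos h, ENNReal.ofReal_zero]
    · rw [max_eq_left h]
  rw [Finset.sum_congr rfl h1, ← ENNReal.ofReal_sum_of_nonneg fun i _ =>
    integral_nonneg fun y => integral_nonneg fun g => h0 i y g]
  congr 1
  have hi : ∀ i ∈ s, Integrable (fun x : Y × SU2 => φ i x.1 x.2)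
      ((μ.restrict t).prod haarSU2) := fun i hi => integrable_prod_haar ht (hc i hi)
  have h2 : ∀ i ∈ s, ∫ y in t, ∫ g, φ i y g ∂haarSU2 ∂μ
      = ∫ x : Y × SU2, φ i x.1 x.2 ∂((μ.restrict t).prod haarSU2) := fun i hi' =>
    (integral_prod _ (hi i hi')).symm
  rw [Finset.sum_congr rfl h2, ← integral_finsetSum _ hi,
    integral_prod _ (integrable_finsetSum _ hi)]
  simp only [hφ, energy, Finset.sum_singleton, Finset.mul_sum]

end

section

variable {ε ρs : ℝ} {f : Field} {m p q : ℕ}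

theorem edge_mem_region (hε2 : ε < 2) (hρ : 0 < ρs) :
    MapsTo (fun τ => (τ, edge ρs τ)) (Icc (-1) (-1 + ε)) (region ε ρs) := fun τ hτ => by
  simpa using straighten_mem hε2 hρ hτ (right_mem_Icc.mpr zero_le_one)

theorem scri_mem_region (hε : 0 < ε) :
    MapsTo (fun ρ => ((-1 : ℝ), ρ)) (Icc 0 ρs) (region ε ρs) := fun ρ hρ =>
  ⟨le_rfl, by simp only; linarith, hρ.1, by rw [edge_neg_one]; exact hρ.2⟩

theorem sobolevSq_eq (hε : 0 < ε) (hε2 : ε < 2) (hρ : 0 < ρs)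
    (hf : IsCk (m + p + q + 1) (region ε ρs) f) :
    sobolevSq ε ρs m ((dRho (region ε ρs))^[p] ((dTau (region ε ρs))^[q] f))
      = ENNReal.ofReal (∫ z in region ε ρs, ∫ g,
          energy (mho m) (jet (region ε ρs) p q f) z g ∂haarSU2) := by
  have hK := regularRegion_region hε hε2 hρ
  have h := sum_lintegral_eq (μ := volume) (s := mho m) (isCompact_region hε2 hρ)
    (γ := fun z => z) continuousOn_id (mapsTo_id _) (δ := fun _ => 1) continuousOn_const
    (F := fun x => D (region ε ρs) x.2.1 x.1 x.2.2
      ((dRho (region ε ρs))^[p] ((dTau (region ε ρs))^[q] f)))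
    (fun x hx => hf.jet hK hx)
    (fun x hx => D_eq_Zpow hK (hf.of_le (by rw [mem_mho] at hx; omega)))
  simpa [sobolevSq] using h

theorem scriDataSq_eq (hε : 0 < ε) (hε2 : ε < 2) (hρ : 0 < ρs)
    (hf : IsCk (m + p + q + 1) (region ε ρs) f) :
    scriDataSq ε ρs m ((dTau (region ε ρs))^[q] ((dRho (region ε ρs))^[p] f))
      = ENNReal.ofReal (∫ ρ in Icc 0 ρs, ∫ g,
          energy (mho m) (jet (region ε ρs) p q f) (-1, ρ) g ∂haarSU2) := by
  have hK := regularRegion_region hε hε2 hρ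
  have h := sum_lintegral_eq (μ := volume) (s := mho m) (isCompact_Icc (a := 0) (b := ρs))
    (γ := fun ρ => ((-1 : ℝ), ρ)) (by fun_prop) (scri_mem_region hε) (δ := fun _ => 1)
    continuousOn_const
    (F := fun x => D (region ε ρs) x.2.1 x.1 x.2.2
      ((dTau (region ε ρs))^[q] ((dRho (region ε ρs))^[p] f)))
    (fun x hx => hf.jet hK hx)
    (fun x hx => D_eq_Zpow' hK (hf.of_le (by rw [mem_mho] at hx; omega)))
  simpa [scriDataSq] using h

theorem edgeDataSq_eq (hε : 0 < ε) (hε2 : ε < 2) (hρ : 0 < ρs)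
    (hf : IsCk (m + p + q + 1) (region ε ρs) f) :
    edgeDataSq ε ρs m ((dTau (region ε ρs))^[q] ((dRho (region ε ρs))^[p] f))
      = ENNReal.ofReal (∫ τ in Icc (-1) (-1 + ε), ∫ g, max (edgeDensity ρs τ) 0 *
          energy (mho m) (jet (region ε ρs) p q f) (τ, edge ρs τ) g ∂haarSU2) := by
  have hK := regularRegion_region hε hε2 hρ
  have hlt : ∀ τ ∈ Icc (-1) (-1 + ε), τ < 1 := fun τ hτ => by have := hτ.2; linarith
  have hc : ContinuousOn (edge ρs) (Icc (-1) (-1 + ε)) := (continuousOn_edge ρs).mono hlt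
  exact sum_lintegral_eq (μ := volume) (s := mho m) isCompact_Icc
    (γ := fun τ => (τ, edge ρs τ)) (continuousOn_id.prodMk hc) (edge_mem_region hε2 hρ)
    (δ := edgeDensity ρs) ((continuousOn_const.mul hc).div
      (continuousOn_const.sub continuousOn_id)
      fun τ hτ => show (1 : ℝ) - τ ≠ 0 by have := hlt τ hτ; linarith)
    (F := fun x => D (region ε ρs) x.2.1 x.1 x.2.2
      ((dTau (region ε ρs))^[q] ((dRho (region ε ρs))^[p] f)))
    (fun x hx => hf.jet hK hx)
    (fun x hx => D_eq_Zpow' hK (hf.of_le (by rw [mem_mho] at hx; omega)))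

end

/-! ### The commuted transport equations -/

theorem exists_uniform_commutator_bound (a b : ℂ) (m : ℕ) : ∃ B : ℝ, 0 ≤ B ∧
    ∀ α : Fin 3 → ℕ, ∑ l, α l ≤ m → ∀ h, IsCkGroup (∑ l, α l + 1) h → ∀ g,
      ‖zMono α (xOp a b h) g - xOp a b (zMono α h) g‖ ^ 2
        ≤ B * ∑ β ∈ multiIndices (∑ l, α l), ‖zMono β h g‖ ^ 2 := by
  choose C hC0 hC using exists_commutator_bound a b
  refine ⟨∑ α ∈ multiIndices m, C α, Finset.sum_nonneg fun α _ => hC0 α, fun α hα h hh g => ?_⟩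
  refine (hC α h hh g).trans (mul_le_mul_of_nonneg_right ?_
    (Finset.sum_nonneg fun _ _ => sq_nonneg _))
  exact Finset.single_le_sum (f := C) (fun β _ => hC0 β) (mem_multiIndices.mpr hα)

/-- The commutator of `Z^α` with `a Z₂ + b Z₁` in the jet of `f`. -/
noncomputable def jetCommutator (K : Set (ℝ × ℝ)) (p q : ℕ) (a b : ℂ) (f : Field)
    (x : ℕ × ℕ × (Fin 3 → ℕ)) : Field := fun z g =>
  zMono x.2.2 (xOp a b ((dRho K)^[p + x.2.1] ((dTau K)^[q + x.1] f) z)) g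
    - xOp a b (zMono x.2.2 ((dRho K)^[p + x.2.1] ((dTau K)^[q + x.1] f) z)) g

section

variable {K : Set (ℝ × ℝ)} {m p q : ℕ} {x : ℕ × ℕ × (Fin 3 → ℕ)}

/-- Puts the commuted equation into the shape needed by `energy_inequality`: the same operator `X`
applied to the jet, plus the commutator with `Z^α` as a source. -/
theorem Transports.jet (hK : RegularRegion K) {c d e a : ℝ} {y y' : ℂ} {u w : Field}
    (hu : IsCk (m + p + q + 1) K u) (hw : IsCk (m + p + q + 1) K w)
    (H : Transports K c d e a u (xField y y' w)) (hx : x ∈ mho m) :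
    Transports K c d e (a + (q + x.1 : ℕ) * d + (p + x.2.1 : ℕ) * e) (jet K p q u x)
      (fun z g => xField y y' (LowerDomain.jet K p q w x) z g
        + jetCommutator K p q y y' w x z g) := by
  rw [mem_mho] at hx
  have h := H.commute hK (P := p + x.2.1) (Q := q + x.1) (α := x.2.2)
    (hu.of_le (by omega)) (hw.of_le (by omega))
  refine EqF.trans h fun z _ => ?_
  funext g
  simp only [xField, jetCommutator, LowerDomain.jet, Zpow_apply]
  ring

/-- Commuting with `Z^α` leaves `(q', p')` fixed and only lowers or keeps `|α|`, so every term that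
arises is again indexed by `mho m`. -/
theorem sum_fiber_le_energy (f : Field) (hx : x ∈ mho m) (z : ℝ × ℝ) (g : SU2) :
    ∑ β ∈ multiIndices (∑ l, x.2.2 l),
      ‖zMono β ((dRho K)^[p + x.2.1] ((dTau K)^[q + x.1] f) z) g‖ ^ 2
      ≤ energy (mho m) (jet K p q f) z g := by
  rw [mem_mho] at hx
  have hinj : Function.Injective fun β : Fin 3 → ℕ => (x.1, x.2.1, β) := fun β β' h => by
    simpa using h
  have hsub : (multiIndices (∑ l, x.2.2 l)).map ⟨_, hinj⟩ ⊆ mho m := by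
    intro y hy
    obtain ⟨β, hβ, rfl⟩ := Finset.mem_map.mp hy
    rw [mem_multiIndices] at hβ
    rw [mem_mho]
    simp only [Function.Embedding.coeFn_mk]
    omega
  refine le_trans (le_of_eq ?_) (Finset.sum_le_sum_of_subset_of_nonneg hsub
    fun _ _ _ => sq_nonneg _)
  rw [Finset.sum_map]
  simp only [Function.Embedding.coeFn_mk, jet, Zpow_apply]

theorem jetCommutator_le (hK : RegularRegion K) {a b : ℂ} {B : ℝ} (hB0 : 0 ≤ B)
    (hB : ∀ α : Fin 3 → ℕ, ∑ l, α l ≤ m → ∀ h, IsCkGroup (∑ l, α l + 1) h → ∀ g,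
      ‖zMono α (xOp a b h) g - xOp a b (zMono α h) g‖ ^ 2
        ≤ B * ∑ β ∈ multiIndices (∑ l, α l), ‖zMono β h g‖ ^ 2)
    {f : Field} (hf : IsCk (m + p + q + 1) K f) (hx : x ∈ mho m) {z : ℝ × ℝ} (hz : z ∈ K)
    (g : SU2) :
    ‖jetCommutator K p q a b f x z g‖ ^ 2 ≤ B * energy (mho m) (jet K p q f) z g := by
  have hx' := hx
  rw [mem_mho] at hx'
  have hreg : IsCk (∑ l, x.2.2 l + 1) K ((dRho K)^[p + x.2.1] ((dTau K)^[q + x.1] f)) :=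
    IsCk.mixed hK (hf.of_le (by omega))
  exact (hB x.2.2 (by omega) _ (hreg.fiber hz) g).trans
    (mul_le_mul_of_nonneg_left (sum_fiber_le_energy f hx z g) hB0)

variable {ψ ψ₀ ψ₁ ψ₂ : Field}

theorem SolvesTransport.transports_incoming (hψ : IsCk 1 K ψ) (hψ₁ : IsCk 1 K ψ₁)
    (h : SolvesTransport K ψ ψ₀ ψ₁ ψ₂) :
    Transports K 1 1 (-1) 0 ψ₂
      (xField (-1) Complex.I fun z g => ψ₁ z g + 1 / 2 * ψ z g) := fun z hz => by
  funext g
  have hA := h.A₀ z.1 z.2 hz g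
  have e : xField (-1) Complex.I (fun z g => ψ₁ z g + 1 / 2 * ψ z g) z g
      = 1 / 2 * Xminus ψ z g + Xminus ψ₁ z g := by
    rw [Xminus_apply, Xminus_apply]
    change xOp (-1) Complex.I (ψ₁ z + (1 / 2 : ℂ) • ψ z) g = _
    simp only [xOp, zDeriv_add (hψ₁.fiber hz) ((hψ.fiber hz).smul _), zDeriv_smul, Pi.add_apply,
      Pi.smul_apply, smul_eq_mul]
    ring
  rw [e]
  simp only [Complex.real_smul]
  push_cast
  linear_combination hA

/-- Equation `B₀` involves `ψ` and `ψ₁` only through `ψ₁ + ψ/2`, including its zeroth order terms,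
which give the coefficient `-1`. -/
theorem SolvesTransport.transports_outgoing (hK : RegularRegion K) (hψ : IsCk 1 K ψ)
    (hψ₁ : IsCk 1 K ψ₁) (h : SolvesTransport K ψ ψ₀ ψ₁ ψ₂) :
    Transports K 1 (-1) 1 (-1) (fun z g => ψ₁ z g + 1 / 2 * ψ z g)
      (xField (-1) (-Complex.I) ψ₂) := fun z hz => by
  funext g
  have hB := h.B₀ z.1 z.2 hz g
  rw [Xplus_apply] at hB
  beta_reduce
  rw [congrFun (dTau_linear hK hψ₁ hψ (1 / 2) z hz) g,
    congrFun (dRho_linear hK hψ₁ hψ (1 / 2) z hz) g]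
  simp only [Complex.real_smul, xField]
  push_cast
  linear_combination hB

end

theorem ofReal_le_of_nonneg_right {a b : ℝ} (hb : 0 ≤ b)
    (h : ENNReal.ofReal a ≤ ENNReal.ofReal b) : a ≤ b :=
  (ENNReal.ofReal_le_ofReal_iff hb).mp h

theorem integral_energy_linear_le {K : Set (ℝ × ℝ)} (hK : RegularRegion K) {m p q : ℕ}
    {f f' : Field} (hf : IsCk (m + p + q + 1) K f) (hf' : IsCk (m + p + q + 1) K f')
    {Y : Type*} [TopologicalSpace Y] [MeasurableSpace Y] [BorelSpace Y] [T2Space Y]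
    [SecondCountableTopology Y] {μ : Measure Y} [IsFiniteMeasureOnCompacts μ] [SFinite μ]
    {t : Set Y} (ht : IsCompact t) {γ : Y → ℝ × ℝ} (hγ : ContinuousOn γ t)
    (hγK : MapsTo γ t K) :
    ∫ y in t, ∫ g, energy (mho m) (jet K p q fun z g => f z g + 1 / 2 * f' z g) (γ y) g
        ∂haarSU2 ∂μ
      ≤ 2 * (∫ y in t, ∫ g, energy (mho m) (jet K p q f) (γ y) g ∂haarSU2 ∂μ)
        + ∫ y in t, ∫ g, energy (mho m) (jet K p q f') (γ y) g ∂haarSU2 ∂μ := by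
  have hint : ∀ {F : Field}, IsCk (m + p + q + 1) K F →
      Integrable (fun x : Y × SU2 => energy (mho m) (jet K p q F) (γ x.1) x.2)
        ((μ.restrict t).prod haarSU2) := fun hF => by
    have hc := continuousOn_weighted_energy hγ hγK (δ := fun _ => 1) continuousOn_const
      (s := mho m) fun x hx => hF.jet hK hx
    refine integrable_prod_haar ht (hc.congr fun x _ => ?_)
    simp
  have hW : IsCk (m + p + q + 1) K fun z g => f z g + 1 / 2 * f' z g :=
    hf.add (hf'.const_mul _)
  have i1 := hint hf
  have i2 := hint hf'
  have iW := hint hW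
  have j1 := integral_prod _ i1
  have j2 := integral_prod _ i2
  have jW := integral_prod _ iW
  simp only at j1 j2 jW
  rw [← j1, ← j2, ← jW, ← integral_const_mul, ← integral_add (i1.const_mul 2) i2]
  refine integral_mono_ae iW ((i1.const_mul 2).add i2) ?_
  have hae : ∀ᵐ x ∂((μ.restrict t).prod haarSU2), x ∈ t ×ˢ (Set.univ : Set SU2) := by
    have : (μ.restrict t).prod haarSU2 = (μ.prod haarSU2).restrict (t ×ˢ Set.univ) := by
      rw [← Measure.prod_restrict, Measure.restrict_univ]
    rw [this]
    exact ae_restrict_mem (ht.measurableSet.prod MeasurableSet.univ)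
  filter_upwards [hae] with x hx
  exact energy_jet_linear_le hK hf hf' (hγK hx.1) x.2

end LowerDomain

/-! ### The estimate for `ψ₂` -/

theorem proposition2 (m p q : ℕ) (hmpq : m + p < q) :
    ∃ C : ℝ, 0 < C ∧
      ∀ ε ρs Ω : ℝ, 0 < ε → ε < 2 → 0 < ρs → 0 < Ω →
      ∀ ψ ψ₀ ψ₁ ψ₂ : Field,
        (∀ f ∈ ({ψ, ψ₀, ψ₁, ψ₂} : Set Field), IsCk (m + p + q + 1) (region ε ρs) f) →
        SolvesTransport (region ε ρs) ψ ψ₀ ψ₁ ψ₂ →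
        (∀ f ∈ ({ψ, ψ₀, ψ₁, ψ₂} : Set Field),
          scriDataSq ε ρs m ((dTau (region ε ρs))^[q] ((dRho (region ε ρs))^[p] f))
            + edgeDataSq ε ρs m ((dTau (region ε ρs))^[q] ((dRho (region ε ρs))^[p] f))
            ≤ ENNReal.ofReal Ω) →
        (∀ g ∈ ({ψ, ψ₀, ψ₁} : Set Field),
          sobolevSq ε ρs m ((dRho (region ε ρs))^[p] ((dTau (region ε ρs))^[q] g))
            ≤ ENNReal.ofReal Ω) →
        sobolevSq ε ρs m ((dRho (region ε ρs))^[p] ((dTau (region ε ρs))^[q] ψ₂))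
          ≤ ENNReal.ofReal (C * Ω) := by
  obtain ⟨B₁, hB₁0, hB₁⟩ := exists_uniform_commutator_bound (-1) Complex.I m
  obtain ⟨B₂, hB₂0, hB₂⟩ := exists_uniform_commutator_bound (-1) (-Complex.I) m
  set C := energyConst (mho m).card (q + m : ℕ) (B₁ + B₂) with hC
  have hC0 : 0 ≤ C := by
    rw [hC, energyConst]
    positivity
  -- The energy of `W` costs `2 + 1 = 3` times `Ω`, which gives `3C` from the bulk and `2 · 3 = 6`
  -- from past null infinity; the incoming hypersurface contributes `√2 ≤ 2`.
  refine ⟨3 * C + 8, by positivity, ?_⟩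
  intro ε ρs Ω hε hε2 hρ hΩ ψ ψ₀ ψ₁ ψ₂ hreg hsol hdata hnorm
  have hK := regularRegion_region hε hε2 hρ
  have rψ := hreg ψ (by simp)
  have rψ₁ := hreg ψ₁ (by simp)
  have rψ₂ := hreg ψ₂ (by simp)
  set K := region ε ρs with hKdef
  set W : Field := fun z g => ψ₁ z g + 1 / 2 * ψ z g with hW
  have rW : IsCk (m + p + q + 1) K W := rψ₁.add (rψ.const_mul _)
  have hin := hsol.transports_incoming (rψ.of_le (by omega)) (rψ₁.of_le (by omega))
  have hout := hsol.transports_outgoing hK (rψ.of_le (by omega)) (rψ₁.of_le (by omega))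
  have hmain := energy_inequality (s := mho m) hε hε2 hρ
    (u := jet K p q ψ₂) (w := jet K p q W)
    (c := jetCommutator K p q (-1) Complex.I W)
    (d := jetCommutator K p q (-1) (-Complex.I) ψ₂)
    (a := fun x => 0 + (q + x.1 : ℕ) * 1 + (p + x.2.1 : ℕ) * (-1))
    (A := (q + m : ℕ)) (B := B₁ + B₂) (add_nonneg hB₁0 hB₂0)
    -- The coefficient is `(q + q') - (p + p')`. As `p' ≤ m` and `m + p < q`, it is at least `1`; as
    -- `q' ≤ m`, it is at most `q + m`.
    (fun x hx => by
      rw [mem_mho] at hx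
      have h1 : ((p + x.2.1 + 1 : ℕ) : ℝ) ≤ (q + x.1 : ℕ) := by
        exact_mod_cast (show p + x.2.1 + 1 ≤ q + x.1 by omega)
      have h2 : ((q + x.1 : ℕ) : ℝ) ≤ (q + m : ℕ) := by
        exact_mod_cast (show q + x.1 ≤ q + m by omega)
      have h3 : (0 : ℝ) ≤ (p + x.2.1 : ℕ) := Nat.cast_nonneg _
      push_cast at h1 h2 h3 ⊢
      constructor <;> linarith)
    (fun x hx => rψ₂.jet hK hx) (fun x hx => rW.jet hK hx)
    (fun x hx => hin.jet hK rψ₂ rW hx)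
    -- The outgoing coefficient starts from `-1` and shifts oppositely, so it equals `-1 - a`.
    (fun x hx => by
      have h := hout.jet hK rW rψ₂ hx
      convert h using 1
      ring)
    (fun x hx z hz g => (jetCommutator_le hK hB₁0 hB₁ rW hx hz g).trans
      (mul_le_mul_of_nonneg_right (by linarith) (energy_nonneg _ _ _)))
    (fun x hx z hz g => (jetCommutator_le hK hB₂0 hB₂ rψ₂ hx hz g).trans
      (mul_le_mul_of_nonneg_right (by linarith) (energy_nonneg _ _ _)))
  have hedge : (∫ τ in Icc (-1) (-1 + ε), ∫ g, 2 * edge ρs τ / (1 - τ)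
        * energy (mho m) (jet K p q ψ₂) (τ, edge ρs τ) g ∂haarSU2) ≤ 2 * Ω := by
    have h1 := le_add_self.trans (hdata ψ₂ (by simp))
    rw [edgeDataSq_eq hε hε2 hρ rψ₂] at h1
    have h2 := ofReal_le_of_nonneg_right hΩ.le h1
    -- The flux density `2 edge/(1 - τ)` of the unnormalised incoming field is `√2` times the
    -- induced density, which carries the factor `1/√2` of the contracting vector.
    have h3 : (∫ τ in Icc (-1) (-1 + ε), ∫ g, 2 * edge ρs τ / (1 - τ)
        * energy (mho m) (jet K p q ψ₂) (τ, edge ρs τ) g ∂haarSU2)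
        = Real.sqrt 2 * ∫ τ in Icc (-1) (-1 + ε), ∫ g, max (edgeDensity ρs τ) 0 *
          energy (mho m) (jet K p q ψ₂) (τ, edge ρs τ) g ∂haarSU2 := by
      rw [← integral_const_mul]
      refine setIntegral_congr_fun measurableSet_Icc fun τ hτ => ?_
      have hlt : τ < 1 := by have := hτ.2; linarith
      have hp := edge_pos hρ hlt
      have hd : 0 ≤ edgeDensity ρs τ :=
        div_nonneg (mul_nonneg (Real.sqrt_nonneg _) hp.le) (by linarith)
      have hs : Real.sqrt 2 * Real.sqrt 2 = 2 := Real.mul_self_sqrt (by norm_num)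
      rw [max_eq_left hd, integral_const_mul, integral_const_mul, ← mul_assoc, edgeDensity]
      congr 1
      rw [← mul_div_assoc, ← mul_assoc, hs]
    rw [h3]
    have hs2 : Real.sqrt 2 ≤ 2 := by
      rw [Real.sqrt_le_left (by norm_num)]
      norm_num
    exact (mul_le_mul_of_nonneg_left h2 (Real.sqrt_nonneg 2)).trans
      (mul_le_mul_of_nonneg_right hs2 hΩ.le)
  have hscri : ∀ f ∈ ({ψ, ψ₀, ψ₁, ψ₂} : Set Field), (∫ ρ in Icc 0 ρs, ∫ g,
      energy (mho m) (jet K p q f) (-1, ρ) g ∂haarSU2) ≤ Ω := fun f hf => by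
    have h1 := le_self_add.trans (hdata f hf)
    rw [scriDataSq_eq hε hε2 hρ (hreg f hf)] at h1
    exact ofReal_le_of_nonneg_right hΩ.le h1
  have hbulk : ∀ f ∈ ({ψ, ψ₀, ψ₁} : Set Field), IsCk (m + p + q + 1) K f →
      (∫ z in K, ∫ g, energy (mho m) (jet K p q f) z g ∂haarSU2) ≤ Ω := fun f hf hfr => by
    have h1 := hnorm f hf
    rw [sobolevSq_eq hε hε2 hρ hfr] at h1
    exact ofReal_le_of_nonneg_right hΩ.le h1
  have hWscri := integral_energy_linear_le (μ := volume) hK rψ₁ rψ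
    (isCompact_Icc (a := 0) (b := ρs)) (γ := fun ρ => ((-1 : ℝ), ρ)) (by fun_prop)
    (scri_mem_region hε)
  have hWbulk := integral_energy_linear_le (μ := volume) hK rψ₁ rψ (isCompact_region hε2 hρ)
    (γ := fun z => z) continuousOn_id (mapsTo_id _)
  have s1 := hscri ψ₁ (by simp)
  have s0 := hscri ψ (by simp)
  have b1 := hbulk ψ₁ (by simp) rψ₁
  have b0 := hbulk ψ (by simp) rψ
  rw [sobolevSq_eq hε hε2 hρ rψ₂]
  refine ENNReal.ofReal_le_ofReal (hmain.trans ?_)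
  have hCW : C * (∫ z in K, ∫ g, energy (mho m) (jet K p q W) z g ∂haarSU2) ≤ C * (3 * Ω) :=
    mul_le_mul_of_nonneg_left (by linarith) hC0
  linarith
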